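/- **Setting.** Let $(X,\mathscr F,\mu,T)$ be an ergodic measure preserving system with $\mu$ a probability measure. For $A:X\to \mathrm{Mat}_m(\mathbb R)$ put $A^{(n)}(x)=A(T^{n-1}x)\cdots A(Tx)A(x)$, and let $\|\cdot\|$ be the Euclidean operator norm and $s_1\ge\dots\ge s_m\ge 0$ the singular values. With $\log 0=-\infty$, put $$L_1^{(n)}(A)=\int_X \tfrac1n\log\|A^{(n)}\|\,d\mu,\qquad L_k(A)=\lim_{n\to\infty}\int_X\tfrac1n\log s_k(A^{(n)})\,d\mu\in[-\infty,\infty).$$ *Cocycles.* $\mathcal C=\bigcup_m\mathcal C_m$ is a class of measurable functions $A:X\to\mathrm{Mat}_m(\mathbb R)$ with $\|A\|\in L^\infty(\mu)$, closed under the exterior powers $A\mapsto\wedge_kA$ ($1\le k\le m$). Each $\mathcal C_m$ has a (pseudo)distance with $\mathrm{dist}(B,A)\ge\|B-A\|_{L^\infty}$, and each map $\wedge_k:\mathcal C_m\to\mathcal C_{\binom mk}$ is locally Lipschitz. *Deviation functions.* A deviation size function is a non-increasing $\varepsilon:(0,\infty)\to(0,\infty)$. A deviation measure function is a continuous function $\iota:(0,\infty)\to(0,\infty)$,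 strictly decreasing to $0$, with $\log t\lesssim\log\frac1{\iota(t)}\lesssim t$ as $t\to\infty$, such that the inverse $\phi=\phi_\iota$ of $\psi(t)=\psi_\iota(t)=t\,\iota(t)^{-1/2}$ satisfies $\limsup_{t\to\infty}\phi(2t)/\phi(t)<2$. Write $\iota_n=\iota(n)$, $\varepsilon_n=\varepsilon(n)$. Let $\mathscr E$ be a set of deviation size functions and $\mathscr I$ a set of deviation measure functions that is closed under sums and under multiplication by positive constants. Assume that $\mathscr I$ contains functions that decay arbitrarily slowly on the exponential scale: for every $c>0$ there is $\iota\in\mathscr I$ with $e^{-ct}\le\iota(t)$ for all large $t$. Let $\mathscr P$ be a set of triplets $(\underline n_0,\varepsilon,\iota)$ with $\underline n_0\ge1$ an integer, $\varepsilon\in\mathscr E$, $\iota\in\mathscr I$, such that for every $\epsilon>0$ some triplet in $\mathscr P$ has $\varepsilon_{\underline n_0}\le\epsilon$. *Standing assumptions.* Let $\Xi$ be a set of integrable measurable functions $\xi:X\to\mathbb R$, and assume the following. 1. (Compatibility.) For all $A\in\mathcal C$, all $N\in\mathbb N$, all $F$ in the algebra of sets generated by the sets $\{\|A^{(n)}\|\le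 c\}$ and $\{\|A^{(n)}\|\ge c\}$ ($c\ge0$, $0\le n\le N$), and all $\epsilon>0$, there is $\xi\in\Xi$ with $\mathbf 1_F\le\xi$ and $\int\xi\,d\mu\le\mu(F)+\epsilon$. 2. (Base-LDT.) For all $\xi\in\Xi$ and $\epsilon>0$ there is $(\underline n_0,\varepsilon,\iota)\in\mathscr P$ such that for all $n\ge\underline n_0$: $\varepsilon_n\le\epsilon$ and $\mu\{|\frac1n\sum_{j<n}\xi\circ T^j-\int\xi\,d\mu|>\varepsilon_n\}<\iota_n$. 3. (Uniform $L^2$-boundedness.) For every $A\in\mathcal C_m$ with $L_1(A)>-\infty$ there are $\delta>0$, $C<\infty$ with $\|\frac1n\log\|B^{(n)}\|\|_{L^2}<C$ for all $n\ge1$ and all $B\in\mathcal C_m$ with $\mathrm{dist}(B,A)<\delta$. 4. (Uniform fiber-LDT.) For every $m\ge2$, every $A\in\mathcal C_m$ with $L_1(A)>L_2(A)$ and every $\epsilon>0$ there are $\delta>0$ and $(\underline n_0,\varepsilon,\iota)\in\mathscr P$ such that for all $B\in\mathcal C_m$ with $\mathrm{dist}(B,A)<\delta$ and all $n\ge\underline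 n_0$: $\varepsilon_n\le\epsilon$ and $\mu\{|\frac1n\log\|B^{(n)}\|-L_1^{(n)}(B)|>\varepsilon_n\}<\iota_n$. **Proposition 6.1 (uniform speed of convergence).** Let $m\ge2$ and let $A\in\mathcal C_m$ satisfy $L_1(A)>L_2(A)$. There are $\delta>0$, $C>0$, $n_{00}\in\mathbb N$ and $\iota\in\mathscr I$, depending on $A$, such that, with $\phi=\phi_\iota$, $n_{++}=\lfloor\psi_\iota(n)\rfloor=\lfloor n\,\iota_n^{-1/2}\rfloor$ and $n_{--}=\lfloor\phi_\iota(n)\rfloor$, for all $n\ge n_{00}$ and all $B\in\mathcal C_m$ with $\mathrm{dist}(B,A)<\delta$ one has $L_1(B)>-\infty$ and $$L_1^{(n)}(B)-L_1(B)<C\,\frac{\phi(n)}{n}\le\iota_{n_{--}}^{1/2},$$ $$\bigl|L_1^{(n_{++})}(B)+L_1^{(n)}(B)-2L_1^{(2n)}(B)\bigr|<C\,\frac n{n_{++}}\le\iota_n^{1/2}.$$ -/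

import Mathlib

open MeasureTheory Filter Topology
open scoped ENNReal Matrix.Norms.L2Operator

noncomputable section

/-! ### Deviation functions -/

/-- A deviation size function `(0, ∞) → (0, ∞)`: non-increasing.
Only the values on `(0, ∞)` matter. -/
structure IsDevSize (e : ℝ → ℝ) : Prop where
  pos : ∀ t, 0 < t → 0 < e t
  antitone : AntitoneOn e (Set.Ioi 0)

/-- The map `ψ(t) = t · ι(t)^{-1/2}` on `(0, ∞)`. -/
def psi (i : ℝ → ℝ) (t : ℝ) : ℝ := t * (i t) ^ (-(1 / 2) : ℝ)

/-- The inverse `φ` of `ψ : (0, ∞) → (0, ∞)`. For a deviation measure function `ψ` is an increasing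
bijection of `(0, ∞)`, so for `t > 0` this is the unique `s > 0` with `ψ(s) = t`. -/
def phi (i : ℝ → ℝ) (t : ℝ) : ℝ := Function.invFunOn (psi i) (Set.Ioi 0) t

/-- A deviation set measure function `(0, ∞) → (0, ∞)`: continuous, strictly decreasing to `0`,
with `log t ≲ log (1 / ι(t)) ≲ t` as `t → ∞` and `limsup φ(2t) / φ(t) < 2`.
Only the values on `(0, ∞)` matter. -/
structure IsDevMeasure (i : ℝ → ℝ) : Prop where
  pos : ∀ t, 0 < t → 0 < i t
  continuousOn : ContinuousOn i (Set.Ioi 0)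
  strictAntiOn : StrictAntiOn i (Set.Ioi 0)
  tendsto_zero : Tendsto i atTop (𝓝 0)
  log_isBigO : Real.log =O[atTop] fun t => Real.log (1 / i t)
  isBigO_id : (fun t => Real.log (1 / i t)) =O[atTop] fun t : ℝ => t
  limsup_phi : limsup (fun t : ℝ => ((phi i (2 * t) / phi i t : ℝ) : EReal)) atTop < 2

/-- Spaces of deviation functions `ℰ`, `ℐ` (the latter a convex cone), and a set `𝒫` of LDT
parameters `(n₀, ε, ι)`, `n₀ ≥ 1`, containing parameters with `ε(n₀)` arbitrarily small. -/
structure LDTParameters where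
  sizes : Set (ℝ → ℝ)
  measures : Set (ℝ → ℝ)
  params : Set (ℕ × (ℝ → ℝ) × (ℝ → ℝ))
  isDevSize : ∀ e ∈ sizes, IsDevSize e
  isDevMeasure : ∀ i ∈ measures, IsDevMeasure i
  smul_mem : ∀ a : ℝ, 0 < a → ∀ i ∈ measures, (fun t => a * i t) ∈ measures
  add_mem : ∀ i ∈ measures, ∀ j ∈ measures, (fun t => i t + j t) ∈ measures
  params_mem : ∀ p ∈ params, 1 ≤ p.1 ∧ p.2.1 ∈ sizes ∧ p.2.2 ∈ measures
  exists_small : ∀ ε : ℝ, 0 < ε → ∃ p ∈ params, p.2.1 (p.1 : ℝ) ≤ ε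

/-! ### Exterior powers of matrices -/

/-- The strictly increasing `k`-tuples in `{0, …, m - 1}` (that is, the `k`-element subsets),
in lexicographic order. -/
def strictTuples (m k : ℕ) : Finset (Lex (Fin k → Fin m)) :=
  Finset.univ.filter fun f => StrictMono (ofLex f)

theorem card_strictTuples (m k : ℕ) : (strictTuples m k).card = m.choose k := by
  classical
  have e : {f : Lex (Fin k → Fin m) // f ∈ strictTuples m k} ≃ (Fin k ↪o Fin m) :=
    { toFun := fun f => OrderEmbedding.ofStrictMono (ofLex f.1)
        (by have := f.2; simpa [strictTuples] using this)
      invFun := fun g => ⟨toLex g, by simpa [strictTuples] using g.strictMono⟩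
      left_inv := fun f => by ext; rfl
      right_inv := fun g => by ext; rfl }
  have h1 : (strictTuples m k).card = Nat.card {f // f ∈ strictTuples m k} := by
    rw [Nat.card_eq_fintype_card, Fintype.card_coe]
  rw [h1, Nat.card_congr (e.trans Set.powersetCard.ofFinEmbEquiv), Set.powersetCard.card]
  simp

/-- The `i`-th `k`-element subset of `{0, …, m - 1}`, as an increasing tuple. -/
def tuple (m k : ℕ) (i : Fin (m.choose k)) : Fin k → Fin m :=
  ofLex ((strictTuples m k).orderEmbOfFin (card_strictTuples m k) i)

/-- The `k`-th exterior power `∧ₖ g` of `g ∈ Mat(m, ℝ)` in the standard basis of `∧ₖ ℝᵐ`: the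
matrix of the `k × k` minors of `g`. -/
def wedge {m : ℕ} (k : ℕ) (g : Matrix (Fin m) (Fin m) ℝ) :
    Matrix (Fin (m.choose k)) (Fin (m.choose k)) ℝ :=
  Matrix.of fun i j => (g.submatrix (tuple m k i) (tuple m k j)).det

/-! ### Cocycles and Lyapunov exponents

Matrices carry the Euclidean operator norm. -/

section Cocycles

variable {X : Type*} {m : ℕ}

/-- The iterates `A⁽ⁿ⁾(x) = A(Tⁿ⁻¹ x) ⋯ A(T x) A(x)`. -/
def iter (T : X → X) (A : X → Matrix (Fin m) (Fin m) ℝ) : ℕ → X → Matrix (Fin m) (Fin m) ℝ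
  | 0, _ => 1
  | n + 1, x => A (T^[n] x) * iter T A n x

/-- `(1/n) log ‖A⁽ⁿ⁾(x)‖ ∈ [-∞, ∞)`, with `log 0 = -∞`. -/
def logNormRate (T : X → X) (A : X → Matrix (Fin m) (Fin m) ℝ) (n : ℕ) (x : X) : EReal :=
  ENNReal.log ‖iter T A n x‖ₑ / (n : EReal)

/-- The `k`-th singular value `s₁ ≥ s₂ ≥ … ≥ s_m` of a matrix, for `1 ≤ k ≤ m`. -/
def singVal (k : ℕ) (g : Matrix (Fin m) (Fin m) ℝ) : ℝ :=
  (Matrix.toEuclideanLin g).singularValues (k - 1)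

/-- `(1/n) log s_k(A⁽ⁿ⁾(x)) ∈ [-∞, ∞)`, with `log 0 = -∞`. -/
def logSingRate (T : X → X) (A : X → Matrix (Fin m) (Fin m) ℝ) (k n : ℕ) (x : X) : EReal :=
  ENNReal.log (ENNReal.ofReal (singVal k (iter T A n x))) / (n : EReal)

variable [MeasurableSpace X]

/-- The integral of an extended real valued function, `∫ f⁺ - ∫ f⁻`. It is used only for functions
with `∫ f⁺ < ∞`. -/
def erealIntegral (μ : Measure X) (f : X → EReal) : EReal :=
  ((∫⁻ x, (f x).toENNReal ∂μ : ℝ≥0∞) : EReal) - ((∫⁻ x, (-f x).toENNReal ∂μ : ℝ≥0∞) : EReal)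

/-- The finite scale maximal Lyapunov exponent `L₁⁽ⁿ⁾(A) = ∫ (1/n) log ‖A⁽ⁿ⁾‖ dμ`. -/
def finiteLE (μ : Measure X) (T : X → X) (A : X → Matrix (Fin m) (Fin m) ℝ) (n : ℕ) : EReal :=
  erealIntegral μ (logNormRate T A n)

/-- The Lyapunov exponent `L_k(A) = lim ∫ (1/n) log s_k(A⁽ⁿ⁾) dμ ∈ [-∞, ∞)`, `1 ≤ k ≤ m`. The limit
exists for bounded measurable cocycles, hence it equals the `limsup` written here. -/
def lyap (μ : Measure X) (T : X → X) (A : X → Matrix (Fin m) (Fin m) ℝ) (k : ℕ) : EReal :=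
  limsup (fun n : ℕ => erealIntegral μ (logSingRate T A k n)) atTop

/-- A space of measurable cocycles: a class of bounded measurable matrix valued functions, of all
dimensions, closed under exterior powers, where each `𝒞_m` has a distance at least as fine as the
`L^∞` distance and the exterior powers are locally Lipschitz. (As for the `L^∞` distance itself,
functions that agree almost everywhere may be at distance `0`.) -/
structure CocycleSpace (μ : Measure X) where
  carrier : ∀ m : ℕ, Set (X → Matrix (Fin m) (Fin m) ℝ)
  [metric : ∀ m : ℕ, PseudoMetricSpace (carrier m)]
  measurable : ∀ m, ∀ A ∈ carrier m, ∀ i j, Measurable fun x => A x i j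
  bounded : ∀ m, ∀ A ∈ carrier m, MemLp (fun x => ‖A x‖) ∞ μ
  wedge_mem : ∀ m k, 1 ≤ k → k ≤ m → ∀ A ∈ carrier m,
    (fun x => wedge k (A x)) ∈ carrier (m.choose k)
  dist_ge : ∀ m, ∀ A B : carrier m,
    eLpNorm (fun x => B.1 x - A.1 x) ∞ μ ≤ ENNReal.ofReal (dist B A)
  wedge_lipschitz : ∀ m k, ∀ (h1 : 1 ≤ k) (h2 : k ≤ m),
    LocallyLipschitz fun A : carrier m =>
      (⟨fun x => wedge k (A.1 x), wedge_mem m k h1 h2 A.1 A.2⟩ : carrier (m.choose k))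

attribute [instance] CocycleSpace.metric

/-! ### Standing assumptions -/

/-- The algebra `ℱ_N(A)` generated by the sets `{‖A⁽ⁿ⁾‖ ≤ c}` and `{‖A⁽ⁿ⁾‖ ≥ c}`, `c ≥ 0`,
`0 ≤ n ≤ N`. -/
def normAlgebra (T : X → X) (A : X → Matrix (Fin m) (Fin m) ℝ) (N : ℕ) : Set (Set X) :=
  generateSetAlgebra {F | ∃ n ≤ N, ∃ c : ℝ, 0 ≤ c ∧
    (F = {x | ‖iter T A n x‖ ≤ c} ∨ F = {x | c ≤ ‖iter T A n x‖})}

/-- The set of observables `Ξ` and the cocycle `A` are compatible. -/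
def Compatible (μ : Measure X) (T : X → X) (Ξ : Set (X → ℝ))
    (A : X → Matrix (Fin m) (Fin m) ℝ) : Prop :=
  ∀ N : ℕ, ∀ F ∈ normAlgebra T A N, ∀ ε : ℝ, 0 < ε →
    ∃ ξ ∈ Ξ, (∀ x, F.indicator (fun _ => (1 : ℝ)) x ≤ ξ x) ∧ ∫ x, ξ x ∂μ ≤ μ.real F + ε

/-- The observable `ξ` satisfies a base-LDT estimate with parameters in `𝒫`. -/
def BaseLDT (μ : Measure X) (T : X → X) (P : LDTParameters) (ξ : X → ℝ) : Prop :=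
  ∀ ε : ℝ, 0 < ε → ∃ p ∈ P.params, ∀ n : ℕ, p.1 ≤ n →
    p.2.1 n ≤ ε ∧
    μ {x | p.2.1 n < |1 / (n : ℝ) * ∑ j ∈ Finset.range n, ξ (T^[j] x) - ∫ y, ξ y ∂μ|}
      < ENNReal.ofReal (p.2.2 n)

/-- The cocycle `A ∈ 𝒞_m` is uniformly `L²`-bounded. -/
def UniformlyL2Bounded {μ : Measure X} (T : X → X) (𝒞 : CocycleSpace μ) (A : 𝒞.carrier m) : Prop :=
  ∃ δ : ℝ, 0 < δ ∧ ∃ C : ℝ, ∀ B : 𝒞.carrier m, dist B A < δ → ∀ n : ℕ, 1 ≤ n →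
    eLpNorm (fun x => (logNormRate T B.1 n x).abs) 2 μ < ENNReal.ofReal C

/-- The cocycle `A ∈ 𝒞_m` satisfies a uniform fiber-LDT with parameters in `𝒫`. -/
def UniformFiberLDT {μ : Measure X} (T : X → X) (𝒞 : CocycleSpace μ) (P : LDTParameters)
    (A : 𝒞.carrier m) : Prop :=
  ∀ ε : ℝ, 0 < ε → ∃ δ : ℝ, 0 < δ ∧ ∃ p ∈ P.params, ∀ B : 𝒞.carrier m, dist B A < δ →
    ∀ n : ℕ, p.1 ≤ n →
      p.2.1 n ≤ ε ∧
      μ {x | ENNReal.ofReal (p.2.1 n) < (logNormRate T B.1 n x - finiteLE μ T B.1 n).abs}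
        < ENNReal.ofReal (p.2.2 n)

end Cocycles

/-- The next scale `n++ = ⌊n · ι(n)^{-1/2}⌋`. -/
def nextScale (i : ℝ → ℝ) (n : ℕ) : ℕ := ⌊psi i n⌋₊

/-- The previous scale `n-- = ⌊φ(n)⌋`. -/
def prevScale (i : ℝ → ℝ) (n : ℕ) : ℕ := ⌊phi i n⌋₊

end

/-!
# Uniform speed of convergence of Lyapunov exponents

Write `F(n) = ∫ log ‖B⁽ⁿ⁾‖ dμ = n L₁⁽ⁿ⁾(B)` for `B` near `A`, and `ℓ = L₁(A)`. There are three steps.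

*Almost additivity* (`abs_log_norm_mul_mul_le`, `abs_logIntegral_three_blocks_le`). If `g` has rank
one then `‖x g y‖ ‖g‖ = ‖x g‖ ‖g y‖`. A general `g` is a rank one matrix of the same norm plus a
remainder of size at most a constant times `‖∧₂ g‖ / ‖g‖`, so the identity holds approximately when
`‖x‖ ‖y‖ ‖∧₂ g‖` is much smaller than `‖x g‖ ‖g y‖`. For the factors `x = B⁽ᵃ⁾(T²ᵇ ω)`,
`g = B⁽ᵇ⁾(Tᵇ ω)`, `y = B⁽ᵇ⁾(ω)` of `B⁽ᵃ⁺²ᵇ⁾(ω)` with `b ≤ a ≤ 2b` this is the case for `ω` off a set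
of measure `≲ ι(b)`: there the norms of `B⁽ⁿ⁾` are bounded above by `exp (n (ℓ + ε))` and those of
`∧₂ B⁽ⁿ⁾` by `exp (n (2ℓ - κ))`, with `κ` coming from
the gap `L₁(A) > L₂(A)`, while the fiber deviation estimates give lower bounds for `‖x g‖` and
`‖g y‖` in terms of `F(a + b)` and `F(2b)`. By the `L²` bound and Cauchy–Schwarz the exceptional set
contributes `≲ b ι(b)^{1/2}` to the integral. Hence
`F(a + 2b) + F(b) - F(a + b) - F(2b) = O(b ι(b)^{1/2})` as long as `F(a + b)/(a + b)` and `F(2b)/2b`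
are not much below `ℓ` (`exists_local_estimates`).

*Upper bounds* (`exists_measure_lt_norm_iter_le`). They hold uniformly in a neighbourhood of `A`: at
one fixed scale `N` the truncated function `log max(‖A⁽ᴺ⁾‖, e^{-K})` is bounded above, up to a small
error, by a positive combination of indicators of sets `{‖A⁽ᴺ⁾‖ ≥ c}`, to which compatibility and
the base deviation estimates apply; the passage from scale `N` to scale `n` and from `A` to `B` uses
only subadditivity and continuity. The exterior square `∧₂ A` is treated in the same way.

*Extrapolation* (`AlmostAdditive`). Almost additivity with `a = b` and with `a = 2b` shows that
`V(n) = (F(2n) - F(n))/n = 2 L₁⁽²ⁿ⁾(B) - L₁⁽ⁿ⁾(B)` changes by `O(ι(n)^{1/2})` when `n` is doubled.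
The condition on `φ` makes `ι(2ʲ n)^{1/2}` decay geometrically in `j`
(`IsDevMeasure.exists_rpow_double_le`), so that `V(n) = L₁(B) + O(ι(n)^{1/2})`. Started at a scale
where `F` is lower semicontinuous in `B` (`exists_logIntegral_sub_le`), the same recursion keeps
`F(n)/n` near `ℓ` at all scales `2ʲ n₀`, which gives `L₁(B) > -∞` and removes the proviso in the
almost additivity. Cutting `N` repeatedly into blocks of lengths `b, b, N - 2b` with `b` about `N/3`
gives `F(N) - N L₁(B) ≲ ε n + N ι(n)^{1/2}` for every `n ≤ N` (`AlmostAdditive.sub_limit_le`). With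
`n = φ(N)` the two terms are of size `φ(N)`, and this is the first estimate; the second one compares
`L₁⁽ⁿ⁺⁺⁾(B)` with `V(n)`. Since `ε` is small and `ι` may be replaced by a large multiple of itself,
the constant `C = 1/2` is possible, and then both right hand inequalities hold as well.
-/

/-! ### Second exterior powers, singular values and products of three matrices -/

theorem exists_tuple_eq {m k : ℕ} {f : Fin k → Fin m} (hf : StrictMono f) :
    ∃ c, tuple m k c = f := by
  have h : toLex f ∈ Set.range ((strictTuples m k).orderEmbOfFin (card_strictTuples m k)) := by
    rw [Finset.range_orderEmbOfFin]
    simpa [strictTuples] using hf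
  obtain ⟨c, hc⟩ := h
  exact ⟨c, by rw [tuple, hc]; rfl⟩

theorem sum_tuple_two {m : ℕ} (f : (Fin 2 → Fin m) → ℝ) :
    ∑ c, f (tuple m 2 c) = ∑ k, ∑ l, if k < l then f ![k, l] else 0 := by
  have h1 : ∑ c, f (tuple m 2 c) = ∑ p ∈ strictTuples m 2, f (ofLex p) := by
    rw [← Finset.map_orderEmbOfFin_univ (strictTuples m 2) (card_strictTuples m 2),
      Finset.sum_map]
    rfl
  rw [h1, strictTuples, Finset.sum_filter, ← Fintype.sum_prod_type',
    ← ((finTwoArrowEquiv (Fin m)).symm.trans toLex).sum_comp]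
  refine Finset.sum_congr rfl fun p _ => ?_
  have : StrictMono (![p.1, p.2] : Fin 2 → Fin m) ↔ p.1 < p.2 := by
    rw [Fin.strictMono_iff_lt_succ]; simp
  simp only [Equiv.trans_apply, ofLex_toLex, finTwoArrowEquiv_symm_apply, this]

/-- Cauchy–Binet for `2 × 2` minors. -/
theorem wedge_two_mul {m : ℕ} (g h : Matrix (Fin m) (Fin m) ℝ) :
    wedge 2 (g * h) = wedge 2 g * wedge 2 h := by
  ext a b
  rw [Matrix.mul_apply]
  simp only [wedge, Matrix.of_apply, Matrix.det_fin_two, Matrix.submatrix_apply]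
  rw [sum_tuple_two fun t => (g (tuple m 2 a 0) (t 0) * g (tuple m 2 a 1) (t 1)
    - g (tuple m 2 a 0) (t 1) * g (tuple m 2 a 1) (t 0)) * (h (t 0) (tuple m 2 b 0) *
    h (t 1) (tuple m 2 b 1) - h (t 0) (tuple m 2 b 1) * h (t 1) (tuple m 2 b 0))]
  generalize tuple m 2 a 0 = i
  generalize tuple m 2 a 1 = j
  generalize tuple m 2 b 0 = r
  generalize tuple m 2 b 1 = s
  set F : Fin m → Fin m → ℝ := fun k l => g i k * g j l * (h k r * h l s - h k s * h l r) with hF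
  have hdiag : ∀ k, F k k = 0 := fun k => by simp only [hF]; ring
  have h1 : (g * h) i r * (g * h) j s - (g * h) i s * (g * h) j r = ∑ k, ∑ l, F k l := by
    simp only [Matrix.mul_apply, Finset.sum_mul_sum, hF, ← Finset.sum_sub_distrib]
    exact Finset.sum_congr rfl fun k _ => Finset.sum_congr rfl fun l _ => by ring
  have h2 : ∑ k, ∑ l, F k l
      = (∑ k, ∑ l, if k < l then F k l else 0) + ∑ k, ∑ l, if l < k then F k l else 0 := by
    simp only [← Finset.sum_add_distrib]
    refine Finset.sum_congr rfl fun k _ => Finset.sum_congr rfl fun l _ => ?_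
    rcases lt_trichotomy k l with hkl | rfl | hkl
    · simp [hkl, hkl.not_gt]
    · simp [hdiag]
    · simp [hkl, hkl.not_gt]
  rw [h1, h2, Finset.sum_comm (f := fun k l => if l < k then F k l else 0),
    ← Finset.sum_add_distrib]
  refine Finset.sum_congr rfl fun k _ => ?_
  rw [← Finset.sum_add_distrib]
  refine Finset.sum_congr rfl fun l _ => ?_
  split_ifs
  · simp only [hF, Matrix.cons_val_zero, Matrix.cons_val_one]; ring
  · simp

theorem abs_entry_le_norm {ι κ : Type*} [Fintype ι] [Fintype κ] [DecidableEq ι] [DecidableEq κ]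
    (M : Matrix ι κ ℝ) (i : ι) (j : κ) : |M i j| ≤ ‖M‖ := by
  have h := M.l2_opNorm_mulVec (EuclideanSpace.single j (1 : ℝ))
  have h2 := (PiLp.norm_apply_le ((EuclideanSpace.equiv ι ℝ).symm
    (M.mulVec (EuclideanSpace.single j (1 : ℝ)))) i).trans h
  simpa using h2

theorem norm_le_sum_abs_entry {d : ℕ} (M : Matrix (Fin d) (Fin d) ℝ) :
    ‖M‖ ≤ ∑ i, ∑ j, |M i j| := by
  rw [Matrix.l2_opNorm_def]
  refine ContinuousLinearMap.opNorm_le_bound _ (by positivity) fun x => ?_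
  have hsum : ∀ y : EuclideanSpace ℝ (Fin d), ‖y‖ ≤ ∑ i, |y i| := fun y => by
    conv_lhs => rw [← (EuclideanSpace.basisFun (Fin d) ℝ).sum_repr y]
    refine (norm_sum_le _ _).trans (Finset.sum_le_sum fun i _ => ?_)
    simp [norm_smul]
  refine (hsum _).trans ?_
  rw [Finset.sum_mul]
  refine Finset.sum_le_sum fun i _ => ?_
  change |∑ j, M i j * x j| ≤ _
  rw [Finset.sum_mul]
  refine (Finset.abs_sum_le_sum_abs _ _).trans (Finset.sum_le_sum fun j _ => ?_)
  rw [abs_mul]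
  exact mul_le_mul_of_nonneg_left (PiLp.norm_apply_le x j) (abs_nonneg _)

/-- Every `2 × 2` minor, up to sign an entry of `∧₂ g`, is bounded by the norm of `∧₂ g`. -/
theorem abs_minor_le_norm_wedge {m : ℕ} (g : Matrix (Fin m) (Fin m) ℝ) (i j k l : Fin m) :
    |g i k * g j l - g i l * g j k| ≤ ‖wedge 2 g‖ := by
  have key : ∀ i j k l : Fin m, i < j → k < l →
      |g i k * g j l - g i l * g j k| ≤ ‖wedge 2 g‖ := by
    intro i j k l hij hkl
    obtain ⟨a, ha⟩ := exists_tuple_eq (f := ![i, j]) (by rw [Fin.strictMono_iff_lt_succ]; simpa)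
    obtain ⟨b, hb⟩ := exists_tuple_eq (f := ![k, l]) (by rw [Fin.strictMono_iff_lt_succ]; simpa)
    have := abs_entry_le_norm (wedge 2 g) a b
    simpa [wedge, Matrix.det_fin_two, ha, hb] using this
  rcases lt_trichotomy i j with hij | rfl | hij <;> rcases lt_trichotomy k l with hkl | rfl | hkl
  · exact key i j k l hij hkl
  · simp
  · rw [abs_sub_comm]; exact key i j l k hij hkl
  · simp [mul_comm]
  · simp
  · simp [mul_comm]
  · rw [abs_sub_comm]
    convert! key j i k l hij hkl using 2; ring
  · simp
  · convert! key j i l k hij hkl using 2; ring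

/-- The Lagrange identity. -/
theorem two_mul_norm_sq_mul_norm_sq {m : ℕ} (u y : EuclideanSpace ℝ (Fin m)) :
    2 * (‖u‖ ^ 2 * ‖y‖ ^ 2 - inner ℝ u y ^ 2) = ∑ i, ∑ j, (u i * y j - u j * y i) ^ 2 := by
  have h1 : ∀ i j, (u i * y j - u j * y i) ^ 2
      = u i ^ 2 * y j ^ 2 + y i ^ 2 * u j ^ 2 - 2 * ((u i * y i) * (u j * y j)) :=
    fun i j => by ring
  simp only [h1, Finset.sum_sub_distrib, Finset.sum_add_distrib, ← Finset.mul_sum,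
    ← Finset.sum_mul, EuclideanSpace.real_norm_sq_eq, PiLp.inner_apply]
  simp only [RCLike.inner_apply, conj_trivial, mul_comm (y _) (u _)]
  ring

/-- On orthogonal images, the area `‖g v‖ ‖g w‖` is controlled by `∧₂ g`. -/
theorem norm_mul_norm_le_wedge {m : ℕ} (g : Matrix (Fin m) (Fin m) ℝ)
    (v w : EuclideanSpace ℝ (Fin m)) (hv : ‖v‖ = 1)
    (horth : inner ℝ (Matrix.toEuclideanLin g v) (Matrix.toEuclideanLin g w) = 0) :
    ‖Matrix.toEuclideanLin g v‖ * ‖Matrix.toEuclideanLin g w‖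
      ≤ m ^ 3 * ‖wedge 2 g‖ * ‖w‖ := by
  set u := Matrix.toEuclideanLin g v with hu
  set y := Matrix.toEuclideanLin g w with hy
  have hlag := two_mul_norm_sq_mul_norm_sq u y
  rw [horth] at hlag
  have hui : ∀ i, u i = ∑ k, g i k * v k := fun i => rfl
  have hyi : ∀ i, y i = ∑ k, g i k * w k := fun i => rfl
  have hent : ∀ i j, |u i * y j - u j * y i| ≤ m ^ 2 * (‖wedge 2 g‖ * ‖w‖) := by
    intro i j
    have : u i * y j - u j * y i
        = ∑ k, ∑ l, (g i k * g j l - g i l * g j k) * (v k * w l) := by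
      have h1 : u i * y j = ∑ k, ∑ l, g i k * g j l * (v k * w l) := by
        rw [hui, hyi, Finset.sum_mul_sum]
        exact Finset.sum_congr rfl fun k _ => Finset.sum_congr rfl fun l _ => by ring
      have h2 : u j * y i = ∑ k, ∑ l, g i l * g j k * (v k * w l) := by
        rw [hui, hyi, Finset.sum_mul_sum]
        exact Finset.sum_congr rfl fun k _ => Finset.sum_congr rfl fun l _ => by ring
      rw [h1, h2, ← Finset.sum_sub_distrib]
      refine Finset.sum_congr rfl fun k _ => ?_
      rw [← Finset.sum_sub_distrib]
      exact Finset.sum_congr rfl fun l _ => by ring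
    rw [this]
    calc |∑ k, ∑ l, (g i k * g j l - g i l * g j k) * (v k * w l)|
        ≤ ∑ k : Fin m, ∑ l : Fin m, ‖wedge 2 g‖ * ‖w‖ := by
          refine (Finset.abs_sum_le_sum_abs _ _).trans (Finset.sum_le_sum fun k _ => ?_)
          refine (Finset.abs_sum_le_sum_abs _ _).trans (Finset.sum_le_sum fun l _ => ?_)
          rw [abs_mul, abs_mul]
          have hvk : |v k| ≤ 1 := hv ▸ PiLp.norm_apply_le v k
          have hwl : |w l| ≤ ‖w‖ := PiLp.norm_apply_le w l
          refine mul_le_mul (abs_minor_le_norm_wedge g i j k l) ?_ (by positivity) (by positivity)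
          calc |v k| * |w l| ≤ 1 * ‖w‖ := by gcongr
            _ = ‖w‖ := one_mul _
      _ = m ^ 2 * (‖wedge 2 g‖ * ‖w‖) := by simp; ring
  have hsq : (‖u‖ * ‖y‖) ^ 2 ≤ (m ^ 3 * ‖wedge 2 g‖ * ‖w‖) ^ 2 := by
    have h3 : ∑ i, ∑ j, (u i * y j - u j * y i) ^ 2
        ≤ ∑ i : Fin m, ∑ j : Fin m, (m ^ 2 * (‖wedge 2 g‖ * ‖w‖)) ^ 2 :=
      Finset.sum_le_sum fun i _ => Finset.sum_le_sum fun j _ => by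
        rw [← sq_abs]; exact pow_le_pow_left₀ (abs_nonneg _) (hent i j) 2
    simp only [Finset.sum_const, Finset.card_univ, Fintype.card_fin, nsmul_eq_mul] at h3
    have h4 : (m ^ 3 * ‖wedge 2 g‖ * ‖w‖) ^ 2
        = m * (m * (m ^ 2 * (‖wedge 2 g‖ * ‖w‖)) ^ 2) := by ring
    nlinarith [sq_nonneg (‖u‖ * ‖y‖)]
  exact le_of_sq_le_sq hsq (by positivity)

theorem norm_vecMulVec {d : ℕ} (u v : EuclideanSpace ℝ (Fin d)) :
    ‖(Matrix.vecMulVec u v : Matrix (Fin d) (Fin d) ℝ)‖ = ‖u‖ * ‖v‖ := by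
  rw [← InnerProductSpace.norm_rankOne (𝕜 := ℝ) u v, Matrix.l2_opNorm_def]
  congr 1
  ext x i
  change ∑ j, u i * v j * x j = _
  simp only [InnerProductSpace.rankOne_apply, PiLp.smul_apply, PiLp.inner_apply, smul_eq_mul,
    RCLike.inner_apply, conj_trivial, Finset.sum_mul]
  exact Finset.sum_congr rfl fun j _ => by ring

theorem norm_mul_vecMulVec_mul {d : ℕ} (u v : EuclideanSpace ℝ (Fin d))
    (x y : Matrix (Fin d) (Fin d) ℝ) :
    ‖x * Matrix.vecMulVec u v * y‖ * ‖(Matrix.vecMulVec u v : Matrix (Fin d) (Fin d) ℝ)‖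
      = ‖x * Matrix.vecMulVec u v‖ * ‖Matrix.vecMulVec u v * y‖ := by
  have h1 : x * Matrix.vecMulVec u v * y
      = Matrix.vecMulVec (WithLp.toLp 2 (x.mulVec u) : EuclideanSpace ℝ (Fin d))
        (WithLp.toLp 2 (Matrix.vecMul v y) : EuclideanSpace ℝ (Fin d)) := by
    rw [Matrix.mul_vecMulVec, Matrix.vecMulVec_mul]
  have h2 : x * Matrix.vecMulVec u v
      = Matrix.vecMulVec (WithLp.toLp 2 (x.mulVec u) : EuclideanSpace ℝ (Fin d)) v := by
    rw [Matrix.mul_vecMulVec]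
  have h3 : Matrix.vecMulVec u v * y
      = Matrix.vecMulVec u (WithLp.toLp 2 (Matrix.vecMul v y) : EuclideanSpace ℝ (Fin d)) := by
    rw [Matrix.vecMulVec_mul]
  rw [h1, h2, h3, norm_vecMulVec, norm_vecMulVec, norm_vecMulVec, norm_vecMulVec]
  ring

/-- A matrix is the sum of a rank one matrix `p` of the same norm, its action on the top right
singular direction, and a remainder `q` of norm at most `s₂(g)`, which is also controlled by
`‖∧₂ g‖ / ‖g‖`. -/
theorem exists_rankOne_add {m : ℕ} (hm : 2 ≤ m) (g : Matrix (Fin m) (Fin m) ℝ) :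
    singVal 1 g = ‖g‖ ∧ ∃ (u v : EuclideanSpace ℝ (Fin m)) (q : Matrix (Fin m) (Fin m) ℝ),
      g = Matrix.vecMulVec u v + q ∧ ‖u‖ = ‖g‖ ∧ ‖v‖ = 1 ∧ ‖q‖ ≤ singVal 2 g ∧
      ‖g‖ * ‖q‖ ≤ m ^ 3 * ‖wedge 2 g‖ := by
  classical
  set S := Matrix.toEuclideanLin g with hS
  have hfr : Module.finrank ℝ (EuclideanSpace ℝ (Fin m)) = m := by simp
  set hsym := S.isSymmetric_adjoint_comp_self
  set e := hsym.eigenvectorBasis hfr with he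
  have hlam : ∀ i : Fin m, hsym.eigenvalues hfr i = S.singularValues i ^ 2 :=
    fun i => (S.sq_singularValues_fin hfr i).symm
  have hinner : ∀ w w' : EuclideanSpace ℝ (Fin m), inner ℝ (S w) (S w')
      = ∑ i : Fin m, S.singularValues i ^ 2 * (inner ℝ (e i) w * inner ℝ (e i) w') := by
    intro w w'
    rw [← LinearMap.adjoint_inner_right, ← e.sum_inner_mul_inner]
    refine Finset.sum_congr rfl fun i _ => ?_
    have h1 : inner ℝ (e i) ((LinearMap.adjoint S) (S w'))
        = hsym.eigenvalues hfr i * inner ℝ (e i) w' := by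
      have := hsym.eigenvectorBasis_apply_self_apply hfr w' i
      rw [OrthonormalBasis.repr_apply_apply, OrthonormalBasis.repr_apply_apply] at this
      simpa using this
    rw [h1, hlam, real_inner_comm]; ring
  have hsq : ∀ w, ‖S w‖ ^ 2 = ∑ i : Fin m, S.singularValues i ^ 2 * inner ℝ (e i) w ^ 2 := by
    intro w
    rw [← real_inner_self_eq_norm_sq, hinner]
    exact Finset.sum_congr rfl fun i _ => by ring
  have hpars : ∀ w : EuclideanSpace ℝ (Fin m), ∑ i, inner ℝ (e i) w ^ 2 = ‖w‖ ^ 2 := by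
    intro w
    rw [← e.sum_sq_norm_inner_right w]
    exact Finset.sum_congr rfl fun i _ => by rw [Real.norm_eq_abs, sq_abs]
  have hanti := S.singularValues_antitone
  let i0 : Fin m := ⟨0, by omega⟩
  set v := e i0 with hv
  have hv1 : ‖v‖ = 1 := e.orthonormal.1 i0
  have hev : ∀ i, inner ℝ (e i) v = if i = i0 then 1 else 0 :=
    fun i => orthonormal_iff_ite.mp e.orthonormal i i0
  have hSv : ‖S v‖ = S.singularValues 0 := by
    have h1 : ‖S v‖ ^ 2 = S.singularValues 0 ^ 2 := by
      rw [hsq v]; simp [hev, i0]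
    exact (pow_left_inj₀ (norm_nonneg _) (S.singularValues_nonneg 0) two_ne_zero).mp h1
  have hgS : ∀ w, ‖S w‖ ≤ ‖g‖ * ‖w‖ := fun w => g.l2_opNorm_mulVec w
  have hnorm : ‖g‖ = S.singularValues 0 := by
    apply le_antisymm
    · rw [Matrix.l2_opNorm_def]
      refine ContinuousLinearMap.opNorm_le_bound _ (S.singularValues_nonneg 0) fun w => ?_
      change ‖S w‖ ≤ _
      refine le_of_sq_le_sq ?_ (mul_nonneg (S.singularValues_nonneg 0) (norm_nonneg _))
      rw [hsq, mul_pow, ← hpars w, Finset.mul_sum]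
      refine Finset.sum_le_sum fun i _ => mul_le_mul_of_nonneg_right ?_ (sq_nonneg _)
      exact pow_le_pow_left₀ (S.singularValues_nonneg _) (hanti (Nat.zero_le _)) 2
    · have := hgS v
      rwa [hSv, hv1, mul_one] at this
  refine ⟨by rw [hnorm]; rfl, S v, v, g - Matrix.vecMulVec (S v) v, by abel,
    by rw [hSv, hnorm], hv1, ?_, ?_⟩
  all_goals
    have hq : ∀ w, Matrix.toEuclideanLin (g - Matrix.vecMulVec (S v) v) w
        = S (w - (inner ℝ v w) • v) := by
      intro w
      rw [map_sub, map_sub, LinearMap.sub_apply, map_smul, ← hS]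
      congr 1
      ext i
      change ∑ j, (S v) i * v j * w j = _
      simp only [PiLp.smul_apply, PiLp.inner_apply, smul_eq_mul, RCLike.inner_apply, conj_trivial,
        Finset.sum_mul]
      exact Finset.sum_congr rfl fun j _ => by ring
    have hproj : ∀ w i, inner ℝ (e i) (w - (inner ℝ v w : ℝ) • v)
        = if i = i0 then 0 else inner ℝ (e i) w := by
      intro w i
      rw [inner_sub_right, inner_smul_right, hev]
      split_ifs with h
      · rw [h]; simp [hv]
      · simp
    have hple : ∀ w : EuclideanSpace ℝ (Fin m), ‖w - (inner ℝ v w : ℝ) • v‖ ≤ ‖w‖ := by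
      intro w
      refine le_of_sq_le_sq ?_ (norm_nonneg _)
      rw [← hpars, ← hpars w]
      refine Finset.sum_le_sum fun i _ => ?_
      rw [hproj]
      split_ifs
      · simpa using sq_nonneg (inner ℝ (e i) w)
      · exact le_rfl
  · rw [Matrix.l2_opNorm_def]
    refine ContinuousLinearMap.opNorm_le_bound _ (S.singularValues_nonneg _) fun w => ?_
    change ‖Matrix.toEuclideanLin (g - Matrix.vecMulVec (S v) v) w‖ ≤ S.singularValues 1 * ‖w‖
    rw [hq]
    refine le_of_sq_le_sq ?_ (mul_nonneg (S.singularValues_nonneg 1) (norm_nonneg _))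
    rw [hsq, mul_pow, ← hpars w, Finset.mul_sum]
    refine Finset.sum_le_sum fun i _ => ?_
    rw [hproj]
    split_ifs with h
    · simpa using mul_nonneg (sq_nonneg (S.singularValues 1)) (sq_nonneg (inner ℝ (e i) w))
    · refine mul_le_mul_of_nonneg_right ?_ (sq_nonneg _)
      refine pow_le_pow_left₀ (S.singularValues_nonneg _) (hanti ?_) 2
      have : (i : ℕ) ≠ 0 := fun h0 => h (Fin.ext h0)
      omega
  · rcases (norm_nonneg g).eq_or_lt with h0 | h0
    · rw [← h0, zero_mul]; positivity
    rw [mul_comm, ← le_div_iff₀ h0, Matrix.l2_opNorm_def]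
    refine ContinuousLinearMap.opNorm_le_bound _ (by positivity) fun w => ?_
    change ‖Matrix.toEuclideanLin (g - Matrix.vecMulVec (S v) v) w‖ ≤ _
    rw [hq, div_mul_eq_mul_div, le_div_iff₀ h0]
    have horth : inner ℝ (S v) (S (w - (inner ℝ v w : ℝ) • v)) = 0 := by
      rw [hinner]
      refine Finset.sum_eq_zero fun i _ => ?_
      rw [hproj, hev]; split_ifs <;> simp
    have := norm_mul_norm_le_wedge g v _ hv1 horth
    rw [← hS, hSv, ← hnorm] at this
    rw [mul_comm]
    exact this.trans (mul_le_mul_of_nonneg_left (hple w) (by positivity))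

/-- `‖∧₂ g‖` is at most a constant times `s₁(g) s₂(g)`: in the rank one decomposition
`g = p + q` the `2 × 2` minors of `p` vanish. -/
theorem norm_wedge_two_le {m : ℕ} (hm : 2 ≤ m) (g : Matrix (Fin m) (Fin m) ℝ) :
    ‖wedge 2 g‖ ≤ (6 * (m.choose 2 : ℝ) ^ 2) * (‖g‖ * singVal 2 g) := by
  obtain ⟨-, u, v, q, hg, hu, hv, hq, -⟩ := exists_rankOne_add hm g
  have hqg : ‖q‖ ≤ 2 * ‖g‖ := by
    have : q = g - Matrix.vecMulVec u v := by rw [hg]; abel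
    rw [this]
    refine (norm_sub_le _ _).trans ?_
    rw [norm_vecMulVec, hu, hv]; linarith
  have hminor : ∀ i j k l : Fin m, |g i k * g j l - g i l * g j k| ≤ 6 * (‖g‖ * ‖q‖) := by
    intro i j k l
    have hp : ∀ i k, |(Matrix.vecMulVec u v) i k| ≤ ‖g‖ := fun i k =>
      (abs_entry_le_norm _ i k).trans (by rw [norm_vecMulVec, hu, hv, mul_one])
    have hge : ∀ i k, |g i k| ≤ ‖g‖ := fun i k => abs_entry_le_norm _ i k
    have hqe : ∀ i k, |q i k| ≤ ‖q‖ := fun i k => abs_entry_le_norm _ i k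
    have hgik : ∀ i k, g i k = u i * v k + q i k := fun i k => by
      conv_lhs => rw [hg]
      simp [Matrix.vecMulVec_apply]
    have hpe : ∀ i k, |u i * v k| ≤ ‖g‖ := fun i k => by simpa [Matrix.vecMulVec_apply] using hp i k
    -- the minor of the rank one part cancels; the other terms have a factor from `q`
    have : g i k * g j l - g i l * g j k
        = (u i * v k) * q j l + q i k * g j l - (u i * v l) * q j k - q i l * g j k := by
      rw [hgik i k, hgik j l, hgik i l, hgik j k]; ring
    rw [this]
    have t1 : |(u i * v k) * q j l| ≤ ‖g‖ * ‖q‖ := by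
      rw [abs_mul]; exact mul_le_mul (hpe _ _) (hqe _ _) (abs_nonneg _) (norm_nonneg _)
    have t2 : |q i k * g j l| ≤ ‖g‖ * ‖q‖ := by
      rw [abs_mul, mul_comm]; exact mul_le_mul (hge _ _) (hqe _ _) (abs_nonneg _) (norm_nonneg _)
    have t3 : |(u i * v l) * q j k| ≤ ‖g‖ * ‖q‖ := by
      rw [abs_mul]; exact mul_le_mul (hpe _ _) (hqe _ _) (abs_nonneg _) (norm_nonneg _)
    have t4 : |q i l * g j k| ≤ ‖g‖ * ‖q‖ := by
      rw [abs_mul, mul_comm]; exact mul_le_mul (hge _ _) (hqe _ _) (abs_nonneg _) (norm_nonneg _)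
    rw [abs_le] at *
    constructor <;>
      nlinarith [norm_nonneg g, norm_nonneg q, mul_nonneg (norm_nonneg g) (norm_nonneg q)]
  refine (norm_le_sum_abs_entry _).trans ?_
  calc ∑ a, ∑ b, |wedge 2 g a b|
      ≤ ∑ a : Fin (m.choose 2), ∑ b : Fin (m.choose 2), 6 * (‖g‖ * ‖q‖) := by
        refine Finset.sum_le_sum fun a _ => Finset.sum_le_sum fun b _ => ?_
        simpa [wedge, Matrix.det_fin_two] using
          hminor (tuple m 2 a 0) (tuple m 2 a 1) (tuple m 2 b 0) (tuple m 2 b 1)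
    _ = (6 * (m.choose 2 : ℝ) ^ 2) * (‖g‖ * ‖q‖) := by simp; ring
    _ ≤ _ := by gcongr

theorem abs_log_le_of_abs_sub_one_le {t z : ℝ} (hz0 : 0 ≤ z) (hz : z ≤ 1 / 8)
    (h : |t - 1| ≤ 4 * z) : |Real.log t| ≤ 8 * z := by
  rw [abs_le] at h
  have ht0 : 0 < t := by linarith
  rw [abs_le]
  constructor
  · have h1 := Real.one_sub_inv_le_log_of_pos ht0
    have h2 : t⁻¹ ≤ 1 + 8 * z := by
      rw [inv_le_comm₀ ht0 (by linarith), inv_le_iff_one_le_mul₀ (by linarith)]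
      nlinarith
    linarith
  · have h1 := Real.log_le_sub_one_of_pos ht0
    linarith

/-- If the middle factor `g` of `x g y` is close to rank one, as measured by `∧₂ g` relative to the
sizes of `x g` and `g y`, then `‖x g y‖ ‖g‖` is close to `‖x g‖ ‖g y‖`. -/
theorem abs_log_norm_mul_mul_le {m : ℕ} (hm : 2 ≤ m) (x g y : Matrix (Fin m) (Fin m) ℝ) {z : ℝ}
    (hz : z ≤ 1 / 8) (hxg : 0 < ‖x * g‖) (hgy : 0 < ‖g * y‖)
    (h : m ^ 3 * (‖x‖ * ‖y‖ * ‖wedge 2 g‖) ≤ z * (‖x * g‖ * ‖g * y‖)) :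
    |Real.log ‖x * g * y‖ + Real.log ‖g‖ - Real.log ‖x * g‖ - Real.log ‖g * y‖| ≤ 8 * z := by
  obtain ⟨-, u, v, q, hg, hu, hv, -, hqw⟩ := exists_rankOne_add hm g
  set p : Matrix (Fin m) (Fin m) ℝ := Matrix.vecMulVec u v with hp
  have hpn : ‖p‖ = ‖g‖ := by rw [hp, norm_vecMulVec, hu, hv, mul_one]
  have hmul := norm_mul_vecMulVec_mul u v x y
  rw [← hp, hpn] at hmul
  have hxgle : ‖x * g‖ ≤ ‖x‖ * ‖g‖ := norm_mul_le _ _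
  have hgyle : ‖g * y‖ ≤ ‖g‖ * ‖y‖ := norm_mul_le _ _
  have hg0 : 0 < ‖g‖ := by
    rcases (norm_nonneg g).eq_or_lt with h0 | h0
    · rw [← h0, mul_zero] at hxgle; linarith
    · exact h0
  have hz0 : 0 ≤ z := by
    have : 0 ≤ z * (‖x * g‖ * ‖g * y‖) := le_trans (by positivity) h
    exact nonneg_of_mul_nonneg_left this (by positivity)
  have hkey : ‖x‖ * ‖y‖ * (‖g‖ * ‖q‖) ≤ z * (‖x * g‖ * ‖g * y‖) := by
    refine le_trans ?_ h
    nlinarith [mul_nonneg (norm_nonneg x) (norm_nonneg y)]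
  -- relative errors of `‖x p‖`, `‖p y‖` and `‖x p y‖`
  have hP : |‖x * g‖ - ‖x * p‖| ≤ z * ‖x * g‖ := by
    have h1 : |‖x * g‖ - ‖x * p‖| ≤ ‖x‖ * ‖q‖ := by
      refine (abs_norm_sub_norm_le _ _).trans ?_
      rw [← Matrix.mul_sub, hg, add_sub_cancel_left]; exact norm_mul_le _ _
    refine h1.trans (le_of_mul_le_mul_right ?_ hgy)
    calc ‖x‖ * ‖q‖ * ‖g * y‖ ≤ ‖x‖ * ‖q‖ * (‖g‖ * ‖y‖) := by gcongr
      _ = ‖x‖ * ‖y‖ * (‖g‖ * ‖q‖) := by ring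
      _ ≤ _ := hkey.trans_eq (by ring)
  have hQ : |‖g * y‖ - ‖p * y‖| ≤ z * ‖g * y‖ := by
    have h1 : |‖g * y‖ - ‖p * y‖| ≤ ‖q‖ * ‖y‖ := by
      refine (abs_norm_sub_norm_le _ _).trans ?_
      rw [← Matrix.sub_mul, hg, add_sub_cancel_left]; exact norm_mul_le _ _
    refine h1.trans (le_of_mul_le_mul_right ?_ hxg)
    calc ‖q‖ * ‖y‖ * ‖x * g‖ ≤ ‖q‖ * ‖y‖ * (‖x‖ * ‖g‖) := by gcongr
      _ = ‖x‖ * ‖y‖ * (‖g‖ * ‖q‖) := by ring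
      _ ≤ _ := hkey.trans_eq (by ring)
  have hR : |‖x * g * y‖ * ‖g‖ - ‖x * p * y‖ * ‖g‖| ≤ z * (‖x * g‖ * ‖g * y‖) := by
    rw [← sub_mul, abs_mul, abs_norm]
    have h1 : |‖x * g * y‖ - ‖x * p * y‖| ≤ ‖x‖ * ‖q‖ * ‖y‖ := by
      refine (abs_norm_sub_norm_le _ _).trans ?_
      rw [← Matrix.sub_mul, ← Matrix.mul_sub, hg, add_sub_cancel_left]
      exact (norm_mul_le _ _).trans (by gcongr; exact norm_mul_le _ _)
    calc _ ≤ ‖x‖ * ‖q‖ * ‖y‖ * ‖g‖ := by gcongr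
      _ = ‖x‖ * ‖y‖ * (‖g‖ * ‖q‖) := by ring
      _ ≤ _ := hkey
  rw [hmul] at hR
  set P := ‖x * g‖
  set Q := ‖g * y‖
  set α := (‖x * p‖ - P) / P with hα
  set β := (‖p * y‖ - Q) / Q with hβ
  have hα' : ‖x * p‖ = P * (1 + α) := by rw [hα]; field_simp; ring
  have hβ' : ‖p * y‖ = Q * (1 + β) := by rw [hβ]; field_simp; ring
  have hαz : |α| ≤ z := by
    rw [hα, abs_div, abs_of_pos hxg, div_le_iff₀ hxg, abs_sub_comm]; exact hP
  have hβz : |β| ≤ z := by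
    rw [hβ, abs_div, abs_of_pos hgy, div_le_iff₀ hgy, abs_sub_comm]; exact hQ
  set t := ‖x * g * y‖ * ‖g‖ / (P * Q) with ht
  have hPQ : 0 < P * Q := mul_pos hxg hgy
  have ht1 : |t - (1 + α) * (1 + β)| ≤ z := by
    have : t - (1 + α) * (1 + β) = (‖x * g * y‖ * ‖g‖ - ‖x * p‖ * ‖p * y‖) / (P * Q) := by
      rw [hα', hβ', ht]; field_simp
    rw [this, abs_div, abs_of_pos hPQ, div_le_iff₀ hPQ]; exact hR
  have hab : |α * β| ≤ z * z := by
    rw [abs_mul]; exact mul_le_mul hαz hβz (abs_nonneg _) hz0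
  have ht2 : |t - 1| ≤ 4 * z := by
    have hzz : z * z ≤ z * 1 := mul_le_mul_of_nonneg_left (by linarith) hz0
    have he : t - 1 = (t - (1 + α) * (1 + β)) + (α + β + α * β) := by ring
    rw [he]
    refine (abs_add_le _ _).trans ?_
    have h3 := (abs_add_le (α + β) (α * β)).trans (add_le_add_left (abs_add_le α β) _)
    linarith
  have htl : 1 / 2 ≤ t := by rw [abs_le] at ht2; linarith
  have ht0 : 0 < t := by linarith
  have hxgy : 0 < ‖x * g * y‖ := by
    rcases (norm_nonneg (x * g * y)).eq_or_lt with h0 | h0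
    · rw [ht, ← h0] at ht0; simp at ht0
    · exact h0
  have hlog : Real.log ‖x * g * y‖ + Real.log ‖g‖ - Real.log P - Real.log Q = Real.log t := by
    rw [ht, Real.log_div (mul_pos hxgy hg0).ne' hPQ.ne', Real.log_mul hxgy.ne' hg0.ne',
      Real.log_mul hxg.ne' hgy.ne', sub_sub]
  rw [hlog]
  exact abs_log_le_of_abs_sub_one_le hz0 hz ht2

/-! ### Iterates of a cocycle -/

section Iterates

variable {X : Type*} {m : ℕ}

theorem iter_add (T : X → X) (B : X → Matrix (Fin m) (Fin m) ℝ) (n k : ℕ) (x : X) :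
    iter T B (n + k) x = iter T B n (T^[k] x) * iter T B k x := by
  induction n with
  | zero => simp [iter]
  | succ n ih =>
    rw [Nat.succ_add, iter, ih, iter, Function.iterate_add_apply, mul_assoc]

theorem iter_wedge_two (T : X → X) (B : X → Matrix (Fin m) (Fin m) ℝ) {n : ℕ} (hn : 1 ≤ n)
    (x : X) : iter T (fun x => wedge 2 (B x)) n x = wedge 2 (iter T B n x) := by
  induction n, hn using Nat.le_induction with
  | base => simp [iter]
  | succ n _ ih => rw [iter, ih, iter, wedge_two_mul]

theorem norm_one_le_one : ‖(1 : Matrix (Fin m) (Fin m) ℝ)‖ ≤ 1 := by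
  rw [← Matrix.l2_opNorm_toEuclideanCLM, map_one]
  exact ContinuousLinearMap.norm_id_le

theorem norm_iter_le (T : X → X) (B : X → Matrix (Fin m) (Fin m) ℝ) {M : ℝ} {x : X}
    (h : ∀ j, ‖B (T^[j] x)‖ ≤ M) (n : ℕ) : ‖iter T B n x‖ ≤ M ^ n := by
  have hM : 0 ≤ M := (norm_nonneg _).trans (h 0)
  induction n with
  | zero => simpa [iter] using norm_one_le_one
  | succ n ih =>
    rw [iter, pow_succ']
    exact (norm_mul_le _ _).trans (mul_le_mul (h n) ih (norm_nonneg _) hM)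

theorem norm_iter_add_le (T : X → X) (B : X → Matrix (Fin m) (Fin m) ℝ) (n k : ℕ) (x : X) :
    ‖iter T B (n + k) x‖ ≤ ‖iter T B n (T^[k] x)‖ * ‖iter T B k x‖ := by
  rw [iter_add]; exact norm_mul_le _ _

theorem norm_iter_sub_le (T : X → X) (A B : X → Matrix (Fin m) (Fin m) ℝ) {M δ : ℝ} {x : X}
    (hM : 1 ≤ M) (hA : ∀ j, ‖A (T^[j] x)‖ ≤ M) (hB : ∀ j, ‖B (T^[j] x)‖ ≤ M)
    (h : ∀ j, ‖B (T^[j] x) - A (T^[j] x)‖ ≤ δ) (n : ℕ) :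
    ‖iter T B n x - iter T A n x‖ ≤ n * M ^ n * δ := by
  have hδ : 0 ≤ δ := (norm_nonneg _).trans (h 0)
  induction n with
  | zero => simp [iter]
  | succ n ih =>
    have : iter T B (n + 1) x - iter T A (n + 1) x
        = B (T^[n] x) * (iter T B n x - iter T A n x)
          + (B (T^[n] x) - A (T^[n] x)) * iter T A n x := by
      simp only [iter]; noncomm_ring
    rw [this]
    calc _ ≤ M * (n * M ^ n * δ) + δ * M ^ n := by
          refine (norm_add_le _ _).trans (add_le_add ?_ ?_)
          · exact (norm_mul_le _ _).trans
              (mul_le_mul (hB n) ih (norm_nonneg _) (by linarith))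
          · exact (norm_mul_le _ _).trans
              (mul_le_mul (h n) (norm_iter_le T A hA n) (norm_nonneg _) hδ)
      _ ≤ M * (n * M ^ n * δ) + δ * (M * M ^ n) := by
          have : M ^ n ≤ M * M ^ n := le_mul_of_one_le_left (by positivity) hM
          gcongr
      _ = _ := by push_cast; ring

variable [MeasurableSpace X]

theorem measurable_iter_entry {T : X → X} (hT : Measurable T)
    {B : X → Matrix (Fin m) (Fin m) ℝ} (hB : ∀ i j, Measurable fun x => B x i j) (n : ℕ)
    (i j : Fin m) : Measurable fun x => iter T B n x i j := by
  induction n generalizing i j with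
  | zero => simp [iter]
  | succ n ih =>
    simp only [iter, Matrix.mul_apply]
    exact Finset.measurable_sum _ fun k _ => ((hB i k).comp (hT.iterate n)).mul (ih k j)

theorem measurable_norm_of_entries {B : X → Matrix (Fin m) (Fin m) ℝ}
    (hB : ∀ i j, Measurable fun x => B x i j) : Measurable fun x => ‖B x‖ := by
  have h1 : Continuous fun M : Fin m → Fin m → ℝ => ‖(Matrix.of M : Matrix (Fin m) (Fin m) ℝ)‖ :=
    (continuous_norm (E := Matrix (Fin m) (Fin m) ℝ)).comp continuous_id
  exact h1.measurable.comp (measurable_pi_lambda _ fun i => measurable_pi_lambda _ fun j => hB i j)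

theorem measurable_norm_iter {T : X → X} (hT : Measurable T)
    {B : X → Matrix (Fin m) (Fin m) ℝ} (hB : ∀ i j, Measurable fun x => B x i j) (n : ℕ) :
    Measurable fun x => ‖iter T B n x‖ :=
  measurable_norm_of_entries (measurable_iter_entry hT hB n)

theorem measurable_norm_wedge_iter {T : X → X} (hT : Measurable T)
    {B : X → Matrix (Fin m) (Fin m) ℝ} (hB : ∀ i j, Measurable fun x => B x i j) (n : ℕ) :
    Measurable fun x => ‖wedge 2 (iter T B n x)‖ := by
  refine measurable_norm_of_entries fun a b => ?_
  simp only [wedge, Matrix.of_apply, Matrix.det_fin_two, Matrix.submatrix_apply]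
  have h := measurable_iter_entry hT hB n
  exact ((h _ _).mul (h _ _)).sub ((h _ _).mul (h _ _))

/-- An almost sure property holds along almost every orbit. -/
theorem ae_forall_iterate {μ : Measure X} {T : X → X} (hT : MeasurePreserving T μ μ)
    {p : X → Prop} (h : ∀ᵐ x ∂μ, p x) : ∀ᵐ x ∂μ, ∀ j, p (T^[j] x) :=
  ae_all_iff.mpr fun j => (hT.iterate j).quasiMeasurePreserving.ae h

end Iterates

/-! ### Extended real integrals of logarithms -/

section ERealIntegral

variable {X : Type*} [MeasurableSpace X] {μ : Measure X}

theorem erealIntegral_congr_ae {f g : X → EReal} (h : f =ᵐ[μ] g) :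
    erealIntegral μ f = erealIntegral μ g := by
  unfold erealIntegral
  congr 2
  · exact lintegral_congr_ae (h.mono fun x hx => by simp only [hx])
  · exact lintegral_congr_ae (h.mono fun x hx => by simp only [hx])

theorem erealIntegral_mono_ae {f g : X → EReal} (h : f ≤ᵐ[μ] g) :
    erealIntegral μ f ≤ erealIntegral μ g := by
  refine EReal.sub_le_sub ?_ ?_
  · exact EReal.coe_ennreal_le_coe_ennreal_iff.mpr
      (lintegral_mono_ae (h.mono fun x hx => EReal.toENNReal_le_toENNReal hx))
  · exact EReal.coe_ennreal_le_coe_ennreal_iff.mpr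
      (lintegral_mono_ae (h.mono fun x hx =>
        EReal.toENNReal_le_toENNReal (EReal.neg_le_neg_iff.mpr hx)))

theorem erealIntegral_coe {f : X → ℝ} (hf : Integrable f μ) :
    erealIntegral μ (fun x => (f x : EReal)) = ((∫ x, f x ∂μ : ℝ) : EReal) := by
  rw [integral_eq_lintegral_pos_part_sub_lintegral_neg_part hf, EReal.coe_sub]
  unfold erealIntegral
  simp only [← EReal.coe_neg, EReal.real_coe_toENNReal]
  have h1 : ∫⁻ x, ENNReal.ofReal (f x) ∂μ ≠ ⊤ := hf.lintegral_lt_top.ne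
  have h2 : ∫⁻ x, ENNReal.ofReal (-f x) ∂μ ≠ ⊤ := hf.neg.lintegral_lt_top.ne
  rw [EReal.coe_ennreal_toReal h1, EReal.coe_ennreal_toReal h2]

theorem log_ofReal_div_natCast {t : ℝ} (ht : 0 < t) (n : ℕ) :
    ENNReal.log (ENNReal.ofReal t) / (n : EReal) = ((Real.log t / n : ℝ) : EReal) := by
  rw [ENNReal.log_ofReal_of_pos ht, EReal.coe_div]; rfl

/-- If the extended real integral of `(1/n) log w` is below `b`, then so is the integral of a
truncation of it from below (monotone convergence). -/
theorem exists_integral_log_max_lt_of_erealIntegral_lt [IsProbabilityMeasure μ] {w : X → ℝ}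
    (hw : Measurable w) (hw0 : ∀ x, 0 ≤ w x) {M : ℝ} (hwM : ∀ᵐ x ∂μ, w x ≤ M) {n : ℕ}
    (hn : 1 ≤ n) {b : ℝ}
    (h : erealIntegral μ (fun x => ENNReal.log (ENNReal.ofReal (w x)) / (n : EReal)) < b) :
    ∃ K : ℝ, 0 ≤ K ∧ Integrable (fun x => Real.log (max (w x) (Real.exp (-K)))) μ ∧
      ∫ x, Real.log (max (w x) (Real.exp (-K))) ∂μ < n * b := by
  set f : X → EReal := fun x => ENNReal.log (ENNReal.ofReal (w x)) / (n : EReal) with hf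
  have hn0 : (0 : ℝ) < n := by exact_mod_cast hn
  have hintK : ∀ K : ℝ, 0 ≤ K → Integrable (fun x => Real.log (max (w x) (Real.exp (-K)))) μ := by
    intro K hK
    refine Integrable.of_bound
      ((hw.max measurable_const).log.aestronglyMeasurable) (max |Real.log M| K) ?_
    filter_upwards [hwM] with x hx
    have h1 : -K ≤ Real.log (max (w x) (Real.exp (-K))) := by
      rw [Real.le_log_iff_exp_le (lt_max_of_lt_right (Real.exp_pos _))]; exact le_max_right _ _
    rw [Real.norm_eq_abs, abs_le]
    refine ⟨by linarith [le_max_right |Real.log M| K], ?_⟩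
    rcases le_total (w x) (Real.exp (-K)) with h2 | h2
    · rw [max_eq_right h2, Real.log_exp]
      linarith [le_max_right |Real.log M| K]
    · rw [max_eq_left h2]
      have := Real.log_le_log (lt_of_lt_of_le (Real.exp_pos _) h2) hx
      exact this.trans ((le_abs_self _).trans (le_max_left _ _))
  have hmeas : Measurable fun x => (-f x).toENNReal := by
    have h1 : Measurable f := by
      simp only [hf, EReal.div_eq_inv_mul]
      exact (ENNReal.measurable_log.comp hw.ennreal_ofReal).const_mul _
    exact measurable_ereal_toENNReal.comp (continuous_neg.measurable.comp h1)
  -- the truncated function, in terms of the positive and negative parts of `f`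
  have hpos : ∀ (K : ℕ) x,
      ENNReal.ofReal (Real.log (max (w x) (Real.exp (-(n * K : ℝ)))) / n) = (f x).toENNReal ∧
      ENNReal.ofReal (-(Real.log (max (w x) (Real.exp (-(n * K : ℝ)))) / n))
        = min (-f x).toENNReal K := by
    intro K x
    rcases (hw0 x).eq_or_lt with h0 | h0
    · have hfx : f x = ⊥ := by
        simp only [hf, ← h0, ENNReal.ofReal_zero, ENNReal.log_zero]
        exact EReal.bot_div_of_pos_ne_top (by exact_mod_cast hn) (EReal.natCast_ne_top n)
      rw [hfx, ← h0, max_eq_right (Real.exp_pos _).le, Real.log_exp]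
      have : -(n * K : ℝ) / n = -K := by field_simp
      rw [this]
      simp
    · have hfx : f x = ((Real.log (w x) / n : ℝ) : EReal) := log_ofReal_div_natCast h0 n
      have hl : Real.log (max (w x) (Real.exp (-(n * K : ℝ)))) / n
          = max (Real.log (w x) / n) (-K) := by
        have : Real.log (max (w x) (Real.exp (-(n * K : ℝ))))
            = max (Real.log (w x)) (-(n * K : ℝ)) := by
          rcases le_total (w x) (Real.exp (-(n * K : ℝ))) with h2 | h2
          · rw [max_eq_right h2, Real.log_exp, max_eq_right]
            rwa [Real.log_le_iff_le_exp h0]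
          · rw [max_eq_left h2, max_eq_left]
            rwa [Real.le_log_iff_exp_le h0]
        rw [this, ← max_div_div_right hn0.le]
        congr 1; field_simp
      rw [hfx, hl, ← EReal.coe_neg, EReal.real_coe_toENNReal, EReal.real_coe_toENNReal]
      constructor
      · rw [ENNReal.ofReal_max, ENNReal.ofReal_of_nonpos (p := -(K : ℝ)) (by simp)]; simp
      · rw [← min_neg_neg, neg_neg, ENNReal.ofReal_min, ENNReal.ofReal_natCast]
  set p := ∫⁻ x, (f x).toENNReal ∂μ with hp
  set q : ℕ → ℝ≥0∞ := fun K => ∫⁻ x, min (-f x).toENNReal K ∂μ with hq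
  have hpK : ∀ K : ℕ, p = ∫⁻ x, ENNReal.ofReal
      (Real.log (max (w x) (Real.exp (-(n * K : ℝ)))) / n) ∂μ :=
    fun K => lintegral_congr fun x => (hpos K x).1.symm
  have hqK : ∀ K : ℕ, q K = ∫⁻ x, ENNReal.ofReal
      (-(Real.log (max (w x) (Real.exp (-(n * K : ℝ)))) / n)) ∂μ :=
    fun K => lintegral_congr fun x => (hpos K x).2.symm
  have hint : ∀ K : ℕ,
      Integrable (fun x => Real.log (max (w x) (Real.exp (-(n * K : ℝ)))) / n) μ :=
    fun K => (hintK _ (by positivity)).div_const _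
  have hpt : p ≠ ⊤ := by rw [hpK 0]; exact (hint 0).lintegral_lt_top.ne
  have hqt : ∀ K, q K ≠ ⊤ := fun K => by rw [hqK K]; exact (hint K).neg.lintegral_lt_top.ne
  have hsup : ∫⁻ x, (-f x).toENNReal ∂μ = ⨆ K, q K := by
    rw [hq, ← lintegral_iSup (fun K => hmeas.min measurable_const)]
    · refine lintegral_congr fun x => ?_
      rw [← inf_iSup_eq, ENNReal.iSup_natCast, inf_top_eq]
    · intro K L hKL x
      exact min_le_min le_rfl (by exact_mod_cast hKL)
  have hIK : ∀ K : ℕ, ∫ x, Real.log (max (w x) (Real.exp (-(n * K : ℝ)))) / n ∂μ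
      = p.toReal - (q K).toReal := by
    intro K
    rw [integral_eq_lintegral_pos_part_sub_lintegral_neg_part (hint K), ← hpK, ← hqK]
  suffices hs : ∃ K : ℕ, p.toReal - (q K).toReal < b by
    obtain ⟨K, hK⟩ := hs
    refine ⟨n * K, by positivity, hintK _ (by positivity), ?_⟩
    rw [← hIK, integral_div, div_lt_iff₀ hn0] at hK
    linarith
  by_contra! hcon
  have hle : ⨆ K, q K ≤ ENNReal.ofReal (p.toReal - b) := by
    refine iSup_le fun K => ?_
    rw [← ENNReal.ofReal_toReal (hqt K)]
    exact ENNReal.ofReal_le_ofReal (by linarith [hcon K])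
  have hpb : 0 ≤ p.toReal - b :=
    le_trans ENNReal.toReal_nonneg (by linarith [hcon 0] : (q 0).toReal ≤ _)
  refine absurd h (not_lt.mpr ?_)
  have h1 : erealIntegral μ f = (p : EReal) - ((⨆ K, q K : ℝ≥0∞) : EReal) := by
    rw [← hsup]; rfl
  rw [h1]
  have h2 : (b : EReal) = (p.toReal : EReal) - ((p.toReal - b : ℝ) : EReal) := by
    rw [← EReal.coe_sub]; congr 1; ring
  rw [h2]
  refine EReal.sub_le_sub ?_ ?_
  · rw [EReal.coe_ennreal_toReal hpt]
  · refine (EReal.coe_ennreal_le_coe_ennreal_iff.mpr hle).trans_eq ?_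
    rw [EReal.coe_ennreal_ofReal, max_eq_left hpb]

/-- If `g ≤ e ^ h` with `h` integrable, then the logarithm of a truncation of `g` from below has
integral at most `∫ h + ε`. -/
theorem exists_integral_log_max_lt [IsProbabilityMeasure μ] {g h : X → ℝ} (hg : Measurable g)
    (hh : Integrable h μ) (hgh : ∀ᵐ x ∂μ, g x ≤ Real.exp (h x)) {ε : ℝ} (hε : 0 < ε) :
    ∃ K : ℝ, 0 ≤ K ∧ Integrable (fun x => Real.log (max (g x) (Real.exp (-K)))) μ ∧
      ∫ x, Real.log (max (g x) (Real.exp (-K))) ∂μ < ∫ x, h x ∂μ + ε := by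
  have hlim : Tendsto (fun K : ℕ => ∫ x, max (h x) (-(K : ℝ)) ∂μ) atTop (𝓝 (∫ x, h x ∂μ)) := by
    refine tendsto_integral_of_dominated_convergence (fun x => |h x|) ?_ hh.abs ?_ ?_
    · exact fun K => (hh.aemeasurable.max aemeasurable_const).aestronglyMeasurable
    · refine fun K => Eventually.of_forall fun x => ?_
      have : (0 : ℝ) ≤ K := K.cast_nonneg
      rw [Real.norm_eq_abs, abs_le]
      exact ⟨(neg_abs_le _).trans (le_max_left _ _),
        max_le (le_abs_self _) (by linarith [abs_nonneg (h x)])⟩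
    · refine Eventually.of_forall fun x => tendsto_const_nhds.congr' ?_
      filter_upwards [eventually_ge_atTop ⌈-h x⌉₊] with K hK
      have := Nat.le_of_ceil_le hK
      rw [max_eq_left]; linarith
  obtain ⟨K, hK⟩ := (hlim.eventually (gt_mem_nhds (lt_add_of_pos_right _ hε))).exists
  have hmaxint : Integrable (fun x => max (h x) (-(K : ℝ))) μ := hh.sup (integrable_const _)
  have hle : ∀ᵐ x ∂μ, Real.log (max (g x) (Real.exp (-(K : ℝ)))) ≤ max (h x) (-(K : ℝ)) := by
    filter_upwards [hgh] with x hx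
    rw [Real.log_le_iff_le_exp (lt_max_of_lt_right (Real.exp_pos _))]
    refine max_le (hx.trans ?_) ?_
    · exact Real.exp_le_exp.mpr (le_max_left _ _)
    · exact Real.exp_le_exp.mpr (le_max_right _ _)
  have hge : ∀ x, -(K : ℝ) ≤ Real.log (max (g x) (Real.exp (-(K : ℝ)))) := fun x => by
    rw [Real.le_log_iff_exp_le (lt_max_of_lt_right (Real.exp_pos _))]; exact le_max_right _ _
  have hint : Integrable (fun x => Real.log (max (g x) (Real.exp (-(K : ℝ))))) μ := by
    refine Integrable.mono' (hmaxint.abs.add (integrable_const (K : ℝ)))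
      ((hg.max measurable_const).log.aestronglyMeasurable) ?_
    filter_upwards [hle] with x hx
    rw [Real.norm_eq_abs, abs_le]
    have h0 : (0 : ℝ) ≤ K := K.cast_nonneg
    have h1 := abs_nonneg (max (h x) (-(K : ℝ)))
    have h2 := le_abs_self (max (h x) (-(K : ℝ)))
    have h3 := hge x
    simp only [Pi.add_apply]
    constructor <;> linarith
  exact ⟨K, K.cast_nonneg, hint, (integral_mono_ae hint hmaxint hle).trans_lt hK⟩

end ERealIntegral

/-! ### Square integrable logarithms and Lyapunov exponents -/

section LogNorm

variable {X : Type*} {T : X → X} {m : ℕ}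

/-- `log ‖A⁽ⁿ⁾(x)‖` as a real number; on the set where `A⁽ⁿ⁾(x) = 0`, which is null in all
applications, its value is `0`. -/
noncomputable def logNorm (T : X → X) (B : X → Matrix (Fin m) (Fin m) ℝ) (n : ℕ) (x : X) : ℝ :=
  Real.log ‖iter T B n x‖

theorem logNormRate_of_pos {B : X → Matrix (Fin m) (Fin m) ℝ} {n : ℕ} {x : X}
    (h : 0 < ‖iter T B n x‖) : logNormRate T B n x = ((logNorm T B n x / n : ℝ) : EReal) := by
  rw [logNormRate, ← ofReal_norm, log_ofReal_div_natCast h, logNorm]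

theorem logNormRate_of_eq_zero {B : X → Matrix (Fin m) (Fin m) ℝ} {n : ℕ} (hn : 1 ≤ n) {x : X}
    (h : ‖iter T B n x‖ = 0) : logNormRate T B n x = ⊥ := by
  rw [logNormRate, ← ofReal_norm, h, ENNReal.ofReal_zero, ENNReal.log_zero]
  exact EReal.bot_div_of_pos_ne_top (by exact_mod_cast hn) (EReal.natCast_ne_top n)

theorem logSingRate_one {B : X → Matrix (Fin m) (Fin m) ℝ} (hm : 2 ≤ m) (n : ℕ) (x : X) :
    logSingRate T B 1 n x = logNormRate T B n x := by
  rw [logSingRate, logNormRate, (exists_rankOne_add hm _).1, ofReal_norm]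

variable [MeasurableSpace X] {μ : Measure X}

/-- `F(n) = ∫ log ‖A⁽ⁿ⁾‖ dμ`, that is, `n` times the finite scale exponent. -/
noncomputable def logIntegral (μ : Measure X) (T : X → X) (B : X → Matrix (Fin m) (Fin m) ℝ)
    (n : ℕ) : ℝ :=
  ∫ x, logNorm T B n x ∂μ

/-- The rates `(1/n) log ‖B⁽ⁿ⁾‖` are finite almost everywhere and bounded in `L²` by `C`. -/
structure LogBounded (μ : Measure X) (T : X → X) (B : X → Matrix (Fin m) (Fin m) ℝ) (C : ℝ) :
    Prop where
  nonneg : 0 ≤ C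
  pos : ∀ n, 1 ≤ n → ∀ᵐ x ∂μ, 0 < ‖iter T B n x‖
  memLp : ∀ n, 1 ≤ n → MemLp (logNorm T B n) 2 μ
  norm_le : ∀ n, 1 ≤ n → eLpNorm (logNorm T B n) 2 μ ≤ ENNReal.ofReal (C * n)

theorem LogBounded.of_eLpNorm_lt (hT : Measurable T) {B : X → Matrix (Fin m) (Fin m) ℝ}
    (hB : ∀ i j, Measurable fun x => B x i j) {C : ℝ}
    (h : ∀ n, 1 ≤ n → eLpNorm (fun x => (logNormRate T B n x).abs) 2 μ < ENNReal.ofReal C) :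
    LogBounded μ T B C := by
  have hC : 0 < C := ENNReal.ofReal_pos.mp (bot_le.trans_lt (h 1 le_rfl))
  have hpos : ∀ n, 1 ≤ n → ∀ᵐ x ∂μ, 0 < ‖iter T B n x‖ := by
    intro n hn
    set Z := {x | ‖iter T B n x‖ = 0} with hZ
    have hZm : MeasurableSet Z := measurable_norm_iter hT hB n (measurableSet_singleton 0)
    have h1 : eLpNorm (fun x => (logNormRate T B n x).abs) 2 μ < ⊤ :=
      (h n hn).trans ENNReal.ofReal_lt_top
    rw [eLpNorm_lt_top_iff_lintegral_rpow_enorm_lt_top two_ne_zero ENNReal.ofNat_ne_top] at h1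
    have h2 : ∫⁻ x, Z.indicator (fun _ => (⊤ : ℝ≥0∞)) x ∂μ < ⊤ := by
      refine lt_of_le_of_lt (lintegral_mono fun x => ?_) h1
      by_cases hx : x ∈ Z
      · rw [Set.indicator_of_mem hx, logNormRate_of_eq_zero hn hx]
        simp
      · rw [Set.indicator_of_notMem hx]; exact bot_le
    rw [lintegral_indicator hZm, lintegral_const, Measure.restrict_apply_univ] at h2
    have h3 : μ Z = 0 := by
      by_contra h4
      rw [ENNReal.top_mul h4] at h2
      exact lt_irrefl _ h2
    have h4 : ∀ᵐ x ∂μ, x ∉ Z := measure_eq_zero_iff_ae_notMem.mp h3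
    filter_upwards [h4] with x hx
    exact lt_of_le_of_ne (norm_nonneg _) (Ne.symm hx)
  have hnorm : ∀ n, 1 ≤ n → eLpNorm (logNorm T B n) 2 μ ≤ ENNReal.ofReal (C * n) := by
    intro n hn
    have hn0 : (0 : ℝ) < n := by exact_mod_cast hn
    have h1 : eLpNorm (fun x => logNorm T B n x / n) 2 μ
        = eLpNorm (fun x => (logNormRate T B n x).abs) 2 μ := by
      refine eLpNorm_congr_enorm_ae ?_
      filter_upwards [hpos n hn] with x hx
      rw [logNormRate_of_pos hx, EReal.abs_def, Real.enorm_eq_ofReal_abs, enorm_eq_self]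
    have h2 : logNorm T B n = (n : ℝ) • fun x => logNorm T B n x / n := by
      ext x; simp only [Pi.smul_apply, smul_eq_mul]; field_simp
    rw [h2, eLpNorm_const_smul, h1, mul_comm C, ENNReal.ofReal_mul hn0.le,
      Real.enorm_eq_ofReal hn0.le]
    exact mul_le_mul_right (h n hn).le _
  refine ⟨hC.le, hpos, fun n hn => ⟨?_, (hnorm n hn).trans_lt ENNReal.ofReal_lt_top⟩, hnorm⟩
  exact (measurable_norm_iter hT hB n).log.aestronglyMeasurable

/-- Cauchy–Schwarz on a small set. -/
theorem setIntegral_abs_le [IsProbabilityMeasure μ] {f : X → ℝ} (hf : MemLp f 2 μ) {c : ℝ}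
    (hc : 0 ≤ c) (h : eLpNorm f 2 μ ≤ ENNReal.ofReal c) (S : Set X) :
    ∫ x in S, |f x| ∂μ ≤ c * (μ.real S) ^ (1 / 2 : ℝ) := by
  have h1 : eLpNorm f 1 (μ.restrict S) ≤ ENNReal.ofReal c * (μ S) ^ (1 / 2 : ℝ) := by
    have := eLpNorm_le_eLpNorm_mul_rpow_measure_univ (μ := μ.restrict S) (p := 1) (q := 2)
      (by norm_num) hf.1.restrict
    refine this.trans ?_
    rw [Measure.restrict_apply_univ]
    have he : (1 / (1 : ℝ≥0∞).toReal - 1 / (2 : ℝ≥0∞).toReal) = (1 / 2 : ℝ) := by norm_num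
    rw [he]
    gcongr
    exact (eLpNorm_mono_measure _ Measure.restrict_le_self).trans h
  have h2 : ∫ x in S, |f x| ∂μ = (eLpNorm f 1 (μ.restrict S)).toReal := by
    rw [eLpNorm_one_eq_lintegral_enorm,
      integral_eq_lintegral_of_nonneg_ae (Eventually.of_forall fun x => abs_nonneg _)
        hf.1.restrict.norm]
    simp only [Real.enorm_eq_ofReal_abs]
  rw [h2]
  refine (ENNReal.toReal_mono ?_ h1).trans_eq ?_
  · exact ENNReal.mul_ne_top ENNReal.ofReal_ne_top
      (ENNReal.rpow_ne_top_of_nonneg (by norm_num) (measure_ne_top _ _))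
  · rw [ENNReal.toReal_mul, ENNReal.toReal_ofReal hc, ← ENNReal.toReal_rpow, measureReal_def]

variable {B : X → Matrix (Fin m) (Fin m) ℝ} {C : ℝ}

theorem logNorm_add_le (hT : MeasurePreserving T μ μ) (h : LogBounded μ T B C) {n k : ℕ}
    (hn : 1 ≤ n) (hk : 1 ≤ k) :
    ∀ᵐ x ∂μ, logNorm T B (n + k) x ≤ logNorm T B n (T^[k] x) + logNorm T B k x := by
  filter_upwards [h.pos (n + k) (by omega),
    (hT.iterate k).quasiMeasurePreserving.ae (h.pos n hn), h.pos k hk] with x h1 h2 h3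
  rw [logNorm, logNorm, logNorm, ← Real.log_mul h2.ne' h3.ne']
  exact Real.log_le_log h1 (norm_iter_add_le T B n k x)

theorem integral_comp_iterate (hT : MeasurePreserving T μ μ) {f : X → ℝ}
    (hf : AEStronglyMeasurable f μ) (k : ℕ) : ∫ x, f (T^[k] x) ∂μ = ∫ x, f x ∂μ := by
  have h1 := (hT.iterate k).map_eq
  conv_rhs => rw [← h1]
  rw [integral_map (hT.iterate k).aemeasurable (by rwa [h1])]

theorem integrable_comp_iterate (hT : MeasurePreserving T μ μ) {f : X → ℝ}
    (hf : Integrable f μ) (k : ℕ) : Integrable (fun x => f (T^[k] x)) μ :=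
  (hT.iterate k).integrable_comp_of_integrable hf

variable [IsProbabilityMeasure μ]

theorem LogBounded.integrable (h : LogBounded μ T B C) {n : ℕ} (hn : 1 ≤ n) :
    Integrable (logNorm T B n) μ := (h.memLp n hn).integrable (by norm_num)

theorem LogBounded.abs_logIntegral_le (h : LogBounded μ T B C) {n : ℕ} (hn : 1 ≤ n) :
    |logIntegral μ T B n| ≤ C * n := by
  have h1 := setIntegral_abs_le (h.memLp n hn)
    (mul_nonneg h.nonneg n.cast_nonneg) (h.norm_le n hn) Set.univ
  rw [setIntegral_univ, probReal_univ, Real.one_rpow, mul_one] at h1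
  exact abs_integral_le_integral_abs.trans h1

theorem LogBounded.finiteLE_eq (h : LogBounded μ T B C) {n : ℕ} (hn : 1 ≤ n) :
    finiteLE μ T B n = ((logIntegral μ T B n / n : ℝ) : EReal) := by
  have h1 : logNormRate T B n =ᵐ[μ] fun x => ((logNorm T B n x / n : ℝ) : EReal) := by
    filter_upwards [h.pos n hn] with x hx using logNormRate_of_pos hx
  rw [finiteLE, erealIntegral_congr_ae h1, erealIntegral_coe ((h.integrable hn).div_const _),
    integral_div, logIntegral]

theorem subadditive_logIntegral (hT : MeasurePreserving T μ μ) (h : LogBounded μ T B C) :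
    Subadditive (logIntegral μ T B) := by
  have h0 : logIntegral μ T B 0 = 0 := by
    rcases isEmpty_or_nonempty (Fin m) with hm | hm
    · have : ∀ M : Matrix (Fin m) (Fin m) ℝ, M = 0 := fun M => Subsingleton.elim _ _
      simp [logIntegral, logNorm, this]
    · simp [logIntegral, logNorm, iter]
  intro n k
  rcases Nat.eq_zero_or_pos n with rfl | hn
  · simp [h0]
  rcases Nat.eq_zero_or_pos k with rfl | hk
  · simp [h0]
  calc logIntegral μ T B (n + k)
      ≤ ∫ x, (logNorm T B n (T^[k] x) + logNorm T B k x) ∂μ :=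
        integral_mono_ae (h.integrable (by omega))
          ((integrable_comp_iterate hT (h.integrable hn) k).add (h.integrable hk))
          (logNorm_add_le hT h hn hk)
    _ = _ := by
        rw [integral_add (integrable_comp_iterate hT (h.integrable hn) k) (h.integrable hk),
          integral_comp_iterate hT (h.memLp n hn).1 k]
        rfl

/-- By Fekete's lemma the top Lyapunov exponent is the limit and the infimum of the finite scale
exponents. -/
theorem exists_lyap_one_eq (hm : 2 ≤ m) (hT : MeasurePreserving T μ μ) (h : LogBounded μ T B C) :
    ∃ L : ℝ, lyap μ T B 1 = (L : EReal) ∧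
      Tendsto (fun n : ℕ => logIntegral μ T B n / n) atTop (𝓝 L) ∧
      ∀ n, 1 ≤ n → L * n ≤ logIntegral μ T B n := by
  have hsub := subadditive_logIntegral hT h
  have hbdd : BddBelow (Set.range fun n : ℕ => logIntegral μ T B n / n) := by
    refine ⟨-C, ?_⟩
    rintro _ ⟨n, rfl⟩
    rcases Nat.eq_zero_or_pos n with rfl | hn
    · simpa using h.nonneg
    · have hn0 : (0 : ℝ) < n := by exact_mod_cast hn
      change -C ≤ logIntegral μ T B n / n
      rw [le_div_iff₀ hn0]
      linarith [(abs_le.mp (h.abs_logIntegral_le hn)).1]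
  have hlim := hsub.tendsto_lim hbdd
  refine ⟨hsub.lim, ?_, hlim, fun n hn => ?_⟩
  · have h1 : (fun n : ℕ => erealIntegral μ (logSingRate T B 1 n))
        =ᶠ[atTop] fun n : ℕ => ((logIntegral μ T B n / n : ℝ) : EReal) := by
      filter_upwards [eventually_ge_atTop 1] with n hn
      rw [← h.finiteLE_eq hn, finiteLE]
      exact erealIntegral_congr_ae (Eventually.of_forall fun x => logSingRate_one hm n x)
    rw [lyap, limsup_congr h1]
    exact ((EReal.tendsto_coe).mpr hlim).limsup_eq
  · have hn0 : (0 : ℝ) < n := by exact_mod_cast hn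
    rw [← le_div_iff₀ hn0]
    exact hsub.lim_le_div hbdd (by omega)

/-- The lower half of a large deviation estimate, stated in terms of `‖B⁽ⁿ⁾‖`. -/
theorem measure_norm_iter_lt_le (h : LogBounded μ T B C) {n : ℕ} (hn : 1 ≤ n) {e ε i : ℝ}
    (heε : e ≤ ε) (hε : 0 ≤ ε)
    (hdev : μ {x | ENNReal.ofReal e < (logNormRate T B n x - finiteLE μ T B n).abs}
      < ENNReal.ofReal i) :
    μ {x | ‖iter T B n x‖ < Real.exp (logIntegral μ T B n - n * ε)} ≤ ENNReal.ofReal i := by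
  refine (measure_mono fun x hx => ?_).trans hdev.le
  have hn0 : (0 : ℝ) < n := by exact_mod_cast hn
  change ENNReal.ofReal e < _
  rw [h.finiteLE_eq hn]
  rcases (norm_nonneg (iter T B n x)).eq_or_lt with h0 | h0
  · rw [logNormRate_of_eq_zero hn h0.symm]
    simp
  · rw [logNormRate_of_pos h0, ← EReal.coe_sub, EReal.abs_def]
    have h1 : logNorm T B n x < logIntegral μ T B n - n * ε := by
      rw [logNorm, Real.log_lt_iff_lt_exp h0]; exact hx
    have h2 : logNorm T B n x / n - logIntegral μ T B n / n < -ε := by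
      rw [← sub_div, div_lt_iff₀ hn0]; linarith
    have h3 : ε < |logNorm T B n x / n - logIntegral μ T B n / n| := by
      rw [abs_of_neg (by linarith)]; linarith
    exact (ENNReal.ofReal_lt_ofReal_iff (hε.trans_lt h3)).mpr (heε.trans_lt h3)

/-- At a large scale the truncated exponent is close to the top Lyapunov exponent. -/
theorem exists_truncated_lt (hT : MeasurePreserving T μ μ)
    (hB : ∀ i j, Measurable fun x => B x i j) (h : LogBounded μ T B C) {L : ℝ}
    (hL : Tendsto (fun n : ℕ => logIntegral μ T B n / n) atTop (𝓝 L)) {ε : ℝ} (hε : 0 < ε) :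
    ∃ N : ℕ, 1 ≤ N ∧ ∃ K : ℝ, 0 ≤ K ∧
      Integrable (fun x => Real.log (max ‖iter T B N x‖ (Real.exp (-K)))) μ ∧
      ∫ x, Real.log (max ‖iter T B N x‖ (Real.exp (-K))) ∂μ < N * (L + ε) := by
  obtain ⟨N, hN, hN1⟩ := ((hL.eventually (gt_mem_nhds (show L < L + ε / 2 by linarith))).and
    (eventually_ge_atTop 1)).exists
  have hN0 : (0 : ℝ) < N := by exact_mod_cast hN1
  obtain ⟨K, hK, hint, hlt⟩ := exists_integral_log_max_lt (g := fun x => ‖iter T B N x‖)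
    (measurable_norm_iter hT.measurable hB N) (h.integrable hN1)
    ((h.pos N hN1).mono fun x hx => by rw [logNorm, Real.exp_log hx])
    (show 0 < N * (ε / 2) by positivity)
  refine ⟨N, hN1, K, hK, hint, hlt.trans_le ?_⟩
  rw [div_lt_iff₀ hN0] at hN
  change logIntegral μ T B N + _ ≤ _
  linarith

/-- A gap between the first two Lyapunov exponents shows in the truncated exponents of `∧₂ A` at
some finite scale. -/
theorem exists_truncated_wedge_lt (hm : 2 ≤ m) (hT : MeasurePreserving T μ μ)
    (hB : ∀ i j, Measurable fun x => B x i j) {M : ℝ} (hM : ∀ᵐ x ∂μ, ‖B x‖ ≤ M)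
    (h : LogBounded μ T B C) {L : ℝ}
    (hL : Tendsto (fun n : ℕ => logIntegral μ T B n / n) atTop (𝓝 L))
    (hgap : lyap μ T B 2 < (L : EReal)) :
    ∃ κ : ℝ, 0 < κ ∧ ∃ N : ℕ, 1 ≤ N ∧ ∃ K : ℝ, 0 ≤ K ∧
      Integrable (fun x => Real.log (max ‖wedge 2 (iter T B N x)‖ (Real.exp (-K)))) μ ∧
      ∫ x, Real.log (max ‖wedge 2 (iter T B N x)‖ (Real.exp (-K))) ∂μ < N * (2 * L - κ) := by
  obtain ⟨b, hb1, hb2⟩ := EReal.lt_iff_exists_real_btwn.mp hgap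
  have hbL : b < L := EReal.coe_lt_coe_iff.mp hb2
  set D : ℝ := 6 * (m.choose 2 : ℝ) ^ 2 with hD
  have hD0 : 0 < D := by
    have : 0 < m.choose 2 := Nat.choose_pos hm
    positivity
  have hlogD : ∀ᶠ n : ℕ in atTop, Real.log D / n < (L - b) / 8 :=
    (tendsto_const_div_atTop_nhds_zero_nat (Real.log D)).eventually
      (gt_mem_nhds (by linarith))
  obtain ⟨N, hN1, hNb, hNL, hND⟩ := ((eventually_ge_atTop 1).and
    ((eventually_lt_of_limsup_lt hb1).and
    ((hL.eventually (gt_mem_nhds (show L < L + (L - b) / 8 by linarith))).and hlogD))).exists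
  have hN0 : (0 : ℝ) < N := by exact_mod_cast hN1
  -- a measurable lower bound for the second singular value
  set w : X → ℝ := fun x => ‖wedge 2 (iter T B N x)‖ / (D * ‖iter T B N x‖) with hw
  have hwm := measurable_norm_wedge_iter hT.measurable hB N
  have hwmeas : Measurable w :=
    hwm.div ((measurable_norm_iter hT.measurable hB N).const_mul D)
  have hw0 : ∀ x, 0 ≤ w x := fun x => by positivity
  have hws : ∀ᵐ x ∂μ, w x ≤ singVal 2 (iter T B N x) := by
    filter_upwards [h.pos N hN1] with x hx
    simp only [hw]
    rw [div_le_iff₀ (by positivity)]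
    exact (norm_wedge_two_le hm _).trans_eq (by ring)
  have hwM : ∀ᵐ x ∂μ, w x ≤ M ^ N := by
    filter_upwards [hws, ae_forall_iterate hT hM] with x h1 h2
    refine h1.trans (le_trans ?_ (norm_iter_le T B h2 N))
    rw [← (exists_rankOne_add hm (iter T B N x)).1]
    exact LinearMap.singularValues_antitone _ (by norm_num)
  have hlt : erealIntegral μ (fun x => ENNReal.log (ENNReal.ofReal (w x)) / (N : EReal)) < b := by
    refine lt_of_le_of_lt (erealIntegral_mono_ae ?_) hNb
    filter_upwards [hws] with x hx
    exact EReal.div_le_div_right_of_nonneg (by exact_mod_cast hN0.le)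
      (ENNReal.log_le_log (ENNReal.ofReal_le_ofReal hx))
  obtain ⟨K', hK', hint', hlt'⟩ :=
    exists_integral_log_max_lt_of_erealIntegral_lt hwmeas hw0 hwM hN1 hlt
  set f : X → ℝ := fun x => Real.log D + logNorm T B N x
    + Real.log (max (w x) (Real.exp (-K'))) with hf
  have hfi1 : Integrable (fun x => Real.log D + logNorm T B N x) μ :=
    (integrable_const _).add (h.integrable hN1)
  obtain ⟨K, hK, hint, hKlt⟩ := exists_integral_log_max_lt (h := f) (ε := N * ((L - b) / 8)) hwm
    (hfi1.add hint') (by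
      filter_upwards [h.pos N hN1] with x hx
      have hmax : 0 < max (w x) (Real.exp (-K')) := lt_max_of_lt_right (Real.exp_pos _)
      simp only [hf]
      rw [Real.exp_add, Real.exp_add, Real.exp_log hD0, logNorm, Real.exp_log hx,
        Real.exp_log hmax]
      calc ‖wedge 2 (iter T B N x)‖ = D * ‖iter T B N x‖ * w x := by
            simp only [hw]; field_simp
        _ ≤ _ := by gcongr; exact le_max_left _ _)
    (by have : 0 < L - b := by linarith
        positivity)
  refine ⟨(L - b) / 2, by linarith, N, hN1, K, hK, hint, hKlt.trans ?_⟩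
  have hfint : ∫ x, f x ∂μ = Real.log D + logIntegral μ T B N
      + ∫ x, Real.log (max (w x) (Real.exp (-K'))) ∂μ := by
    simp only [hf]
    rw [integral_add hfi1 hint', integral_add (integrable_const _) (h.integrable hN1)]
    simp [logIntegral]
  rw [div_lt_iff₀ hN0] at hNL hND
  rw [hfint]
  nlinarith

end LogNorm

/-! ### Upper deviation estimates for Birkhoff sums -/

section UpperDeviation

variable {X : Type*} [MeasurableSpace X] {μ : Measure X} {T : X → X} {P : LDTParameters}

/-- The averages of `f` exceed `s + ε` only on sets whose measure is controlled by some deviation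
function in `P`, for every `ε > 0`. -/
def UpperDeviation (μ : Measure X) (T : X → X) (P : LDTParameters) (f : X → ℝ) (s : ℝ) : Prop :=
  ∀ ε : ℝ, 0 < ε → ∃ i ∈ P.measures, ∃ n₀ : ℕ, ∀ n : ℕ, n₀ ≤ n →
    μ {x | n * (s + ε) < ∑ j ∈ Finset.range n, f (T^[j] x)} ≤ ENNReal.ofReal (i n)

theorem UpperDeviation.const (hP : P.measures.Nonempty) (c : ℝ) :
    UpperDeviation μ T P (fun _ => c) c := by
  intro ε hε
  obtain ⟨i, hi⟩ := hP
  refine ⟨i, hi, 0, fun n _ => ?_⟩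
  have : {x : X | n * (c + ε) < ∑ j ∈ Finset.range n, (fun _ : X => c) (T^[j] x)} = ∅ := by
    ext x
    simp only [Finset.sum_const, Finset.card_range, nsmul_eq_mul, Set.mem_ofPred_eq,
      Set.mem_empty_iff_false, iff_false, not_lt]
    have : (0 : ℝ) ≤ n := n.cast_nonneg
    nlinarith
  rw [this, measure_empty]
  exact bot_le

theorem UpperDeviation.const_mul {f : X → ℝ} {s c : ℝ} (h : UpperDeviation μ T P f s)
    (hc : 0 < c) : UpperDeviation μ T P (fun x => c * f x) (c * s) := by
  intro ε hε
  obtain ⟨i, hi, n₀, hn⟩ := h (ε / c) (by positivity)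
  refine ⟨i, hi, n₀, fun n hn' => (measure_mono fun x hx => ?_).trans (hn n hn')⟩
  simp only [Set.mem_ofPred_eq, ← Finset.mul_sum] at hx ⊢
  refine lt_of_mul_lt_mul_left (lt_of_eq_of_lt ?_ hx) hc.le
  field_simp

theorem UpperDeviation.add {f g : X → ℝ} {s t : ℝ} (hf : UpperDeviation μ T P f s)
    (hg : UpperDeviation μ T P g t) : UpperDeviation μ T P (fun x => f x + g x) (s + t) := by
  intro ε hε
  obtain ⟨i, hi, n₁, h1⟩ := hf (ε / 2) (by positivity)
  obtain ⟨j, hj, n₂, h2⟩ := hg (ε / 2) (by positivity)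
  refine ⟨_, P.add_mem i hi j hj, max 1 (max n₁ n₂), fun n hn => ?_⟩
  have hn0 : (0 : ℝ) < n := by
    have : 1 ≤ n := (le_max_left _ _).trans hn
    exact_mod_cast this
  rw [ENNReal.ofReal_add ((P.isDevMeasure i hi).pos n hn0).le ((P.isDevMeasure j hj).pos n hn0).le]
  refine le_trans ((measure_mono ?_).trans (measure_union_le _ _))
    (add_le_add (h1 n (by omega)) (h2 n (by omega)))
  intro x hx
  simp only [Set.mem_ofPred_eq, Set.mem_union, Finset.sum_add_distrib] at hx ⊢
  by_contra! hcon
  linarith [hcon.1, hcon.2]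

theorem UpperDeviation.sum (hP : P.measures.Nonempty) {f : ℕ → X → ℝ} {s : ℕ → ℝ}
    (h : ∀ k, UpperDeviation μ T P (f k) (s k)) (J : ℕ) :
    UpperDeviation μ T P (fun x => ∑ k ∈ Finset.range J, f k x) (∑ k ∈ Finset.range J, s k) := by
  induction J with
  | zero => simpa using UpperDeviation.const hP 0
  | succ J ih => simp only [Finset.sum_range_succ]; exact ih.add (h J)

/-- Base estimates for an observable dominating the indicator of `F` bound the frequency of visits
to `F` from above. -/
theorem UpperDeviation.indicator {m : ℕ} {A : X → Matrix (Fin m) (Fin m) ℝ} {Ξ : Set (X → ℝ)}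
    (hcompat : Compatible μ T Ξ A) (hbase : ∀ ξ ∈ Ξ, BaseLDT μ T P ξ) {N : ℕ} {F : Set X}
    (hF : F ∈ normAlgebra T A N) :
    UpperDeviation μ T P (F.indicator fun _ => 1) (μ.real F) := by
  intro ε hε
  obtain ⟨ξ, hξ, hFξ, hint⟩ := hcompat N F hF (ε / 2) (by positivity)
  obtain ⟨p, hp, hn⟩ := hbase ξ hξ (ε / 2) (by positivity)
  obtain ⟨hp1, -, hp3⟩ := P.params_mem p hp
  refine ⟨p.2.2, hp3, p.1, fun n hpn => ?_⟩
  obtain ⟨hsmall, hdev⟩ := hn n hpn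
  refine (measure_mono fun x hx => ?_).trans hdev.le
  have hn0 : (0 : ℝ) < n := by
    have : 1 ≤ n := hp1.trans hpn
    exact_mod_cast this
  simp only [Set.mem_ofPred_eq] at hx ⊢
  have h1 : n * (μ.real F + ε) < ∑ j ∈ Finset.range n, ξ (T^[j] x) :=
    hx.trans_le (Finset.sum_le_sum fun j _ => hFξ _)
  have h2 : μ.real F + ε < 1 / (n : ℝ) * ∑ j ∈ Finset.range n, ξ (T^[j] x) := by
    rw [one_div_mul_eq_div, lt_div_iff₀ hn0]; linarith
  exact lt_of_lt_of_le (by linarith) (le_abs_self _)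

/-- A bounded function whose superlevel sets satisfy upper deviation estimates satisfies one as
well: it lies within `η` below a step function on its superlevel sets. -/
theorem UpperDeviation.of_superlevel [IsProbabilityMeasure μ] (hT : MeasurePreserving T μ μ)
    (hP : P.measures.Nonempty) {H : X → ℝ} (hH : Measurable H) (hint : Integrable H μ) {K M : ℝ}
    (hK : ∀ x, -K ≤ H x) (hM : ∀ᵐ x ∂μ, H x ≤ M)
    (hlev : ∀ c, -K ≤ c →
      UpperDeviation μ T P ({x | c ≤ H x}.indicator fun _ => 1) (μ.real {x | c ≤ H x})) :
    UpperDeviation μ T P H (∫ x, H x ∂μ) := by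
  intro ε hε
  set η := ε / 2 with hη
  have hη0 : 0 < η := by positivity
  obtain ⟨J, hJ⟩ := exists_nat_ge ((M + K) / η)
  rw [div_le_iff₀ hη0] at hJ
  let F : ℕ → Set X := fun k => {x | -K + (k + 1) * η ≤ H x}
  have hFm : ∀ k, MeasurableSet (F k) := fun k => measurableSet_le measurable_const hH
  have hcount : ∀ x, ∑ k ∈ Finset.range J, η * (F k).indicator (fun _ => (1 : ℝ)) x
      = η * (min J ⌊(H x + K) / η⌋₊ : ℕ) := by
    intro x
    rw [← Finset.mul_sum]
    congr 1
    have h1 : ∀ k, (F k).indicator (fun _ => (1 : ℝ)) x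
        = if k < ⌊(H x + K) / η⌋₊ then 1 else 0 := by
      intro k
      have : x ∈ F k ↔ k < ⌊(H x + K) / η⌋₊ := by
        rw [← Nat.add_one_le_iff, Nat.le_floor_iff (div_nonneg (by linarith [hK x]) hη0.le),
          le_div_iff₀ hη0]
        simp only [F, Set.mem_ofPred_eq]
        push_cast
        constructor <;> intro h <;> linarith
      simp only [Set.indicator_apply, this]
    simp only [h1, Finset.sum_boole]
    congr 1
    have : Finset.filter (fun k => k < ⌊(H x + K) / η⌋₊) (Finset.range J)
        = Finset.range (min J ⌊(H x + K) / η⌋₊) := by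
      ext k; simp
    rw [this, Finset.card_range]
  have hfl : ∀ x, (⌊(H x + K) / η⌋₊ : ℝ) * η ≤ H x + K := fun x => by
    rw [← le_div_iff₀ hη0]
    exact Nat.floor_le (div_nonneg (by linarith [hK x]) hη0.le)
  have hupper : ∀ᵐ x ∂μ, H x ≤ -K + η
      + ∑ k ∈ Finset.range J, η * (F k).indicator (fun _ => (1 : ℝ)) x := by
    filter_upwards [hM] with x hx
    have h1 : ⌊(H x + K) / η⌋₊ ≤ J := by
      have : (⌊(H x + K) / η⌋₊ : ℝ) * η ≤ J * η := (hfl x).trans (by linarith)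
      exact_mod_cast le_of_mul_le_mul_right this hη0
    rw [hcount, min_eq_right h1]
    have h2 := Nat.lt_floor_add_one ((H x + K) / η)
    rw [div_lt_iff₀ hη0] at h2
    linarith
  have hdev : UpperDeviation μ T P
      (fun x => (-K + η) + ∑ k ∈ Finset.range J, η * (F k).indicator (fun _ => (1 : ℝ)) x)
      ((-K + η) + ∑ k ∈ Finset.range J, η * μ.real (F k)) := by
    refine (UpperDeviation.const hP _).add (UpperDeviation.sum hP (fun k => ?_) J)
    refine (hlev _ ?_).const_mul hη0
    have : 0 ≤ ((k : ℝ) + 1) * η := by positivity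
    linarith
  have hmean : ∑ k ∈ Finset.range J, η * μ.real (F k) ≤ ∫ x, H x ∂μ + K := by
    have h1 : ∑ k ∈ Finset.range J, η * μ.real (F k)
        = ∫ x, ∑ k ∈ Finset.range J, η * (F k).indicator (fun _ => (1 : ℝ)) x ∂μ := by
      rw [integral_finsetSum _ fun k _ =>
        ((integrable_const (1 : ℝ)).indicator (hFm k)).const_mul η]
      refine Finset.sum_congr rfl fun k _ => ?_
      rw [integral_const_mul, integral_indicator_const _ (hFm k)]
      simp
    have h2 : ∫ x, H x ∂μ + K = ∫ x, (H x + K) ∂μ := by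
      rw [integral_add hint (integrable_const _)]; simp
    rw [h1, h2]
    refine integral_mono (integrable_finsetSum _ fun k _ =>
        ((integrable_const (1 : ℝ)).indicator (hFm k)).const_mul η)
      (hint.add (integrable_const _)) fun x => ?_
    simp only
    rw [hcount]
    refine le_trans ?_ (hfl x)
    rw [mul_comm]
    refine mul_le_mul_of_nonneg_right ?_ hη0.le
    exact_mod_cast min_le_right _ _
  obtain ⟨i, hi, n₀, hn⟩ := hdev η hη0
  refine ⟨i, hi, n₀, fun n hn' => (measure_mono_ae ?_).trans (hn n hn')⟩
  filter_upwards [ae_forall_iterate hT hupper] with x hx hlt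
  change _ < _ at hlt
  change _ < _
  refine lt_of_le_of_lt (mul_le_mul_of_nonneg_left ?_ n.cast_nonneg)
    (hlt.trans_le (Finset.sum_le_sum fun j _ => hx j))
  linarith

end UpperDeviation

/-! ### Nearly uniform upper semicontinuity -/

section UpperSemicontinuity

variable {X : Type*} {T : X → X} {m : ℕ}

/-- A subadditivity estimate along one orbit: if `‖B⁽ᴺ⁾(Tʲ x)‖ ≤ e ^ h j` for all `j`, then
`‖B⁽ⁿ⁺ᴺ⁾(x)‖ ^ N` is at most a constant times `exp (h 0 + ⋯ + h (n - 1))`. -/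
theorem norm_iter_pow_le {B : X → Matrix (Fin m) (Fin m) ℝ} {N : ℕ} (hN : 1 ≤ N) {M : ℝ}
    (hM : 1 ≤ M) {x : X} (hB : ∀ j, ‖B (T^[j] x)‖ ≤ M) {h : ℕ → ℝ}
    (hh : ∀ j, ‖iter T B N (T^[j] x)‖ ≤ Real.exp (h j)) (n : ℕ) :
    ‖iter T B (n + N) x‖ ^ N ≤ M ^ (2 * N * N) * Real.exp (∑ j ∈ Finset.range n, h j) := by
  set b : ℕ → ℝ := fun n => ‖iter T B n x‖ with hb
  have hb0 : ∀ n, 0 ≤ b n := fun n => norm_nonneg _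
  -- the product of `N` consecutive norms changes by a factor `‖B⁽ᴺ⁾(Tⁿ x)‖` at each step
  set U : ℕ → ℝ := fun n => ∏ i ∈ Finset.range N, b (n + i) with hU
  have hU0 : ∀ n, 0 ≤ U n := fun n => Finset.prod_nonneg fun i _ => hb0 _
  have hstep : ∀ n, U (n + 1) ≤ U n * Real.exp (h n) := by
    intro n
    have hprod : U (n + 1) * b n = U n * b (n + N) := by
      have h1 := Finset.prod_range_succ (fun i => b (n + i)) N
      rw [Finset.prod_range_succ'] at h1
      simp only [add_zero] at h1
      rw [← h1]
      congr 1
      exact Finset.prod_congr rfl fun i _ => by rw [add_assoc, add_comm 1 i]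
    have hbN : b (n + N) ≤ Real.exp (h n) * b n := by
      rw [add_comm]
      exact (norm_iter_add_le T B N n x).trans (mul_le_mul_of_nonneg_right (hh n) (norm_nonneg _))
    rcases (hb0 n).eq_or_lt with h0 | h0
    · have h1 : b (n + 1) = 0 := by
        refine le_antisymm ?_ (hb0 _)
        have : b (n + 1) ≤ ‖B (T^[n] x)‖ * b n := norm_mul_le _ _
        rwa [← h0, mul_zero] at this
      have h2 : U (n + 1) = 0 :=
        Finset.prod_eq_zero (Finset.mem_range.mpr hN) (by simpa using h1)
      rw [h2]
      exact mul_nonneg (hU0 n) (Real.exp_pos _).le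
    · refine le_of_mul_le_mul_right ?_ h0
      rw [hprod]
      calc U n * b (n + N) ≤ U n * (Real.exp (h n) * b n) :=
            mul_le_mul_of_nonneg_left hbN (hU0 n)
        _ = _ := by ring
  have hUn : U n ≤ M ^ (N * N) * Real.exp (∑ j ∈ Finset.range n, h j) := by
    induction n with
    | zero =>
      simp only [Finset.range_zero, Finset.sum_empty, Real.exp_zero, mul_one]
      calc U 0 ≤ ∏ i ∈ Finset.range N, M ^ N := by
            refine Finset.prod_le_prod (fun i _ => hb0 _) fun i hi => ?_
            rw [zero_add]
            exact (norm_iter_le T B hB i).trans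
              (pow_le_pow_right₀ hM (Finset.mem_range.mp hi).le)
        _ = M ^ (N * N) := by simp [pow_mul]
    | succ n ih =>
      rw [Finset.sum_range_succ, Real.exp_add, ← mul_assoc]
      exact (hstep n).trans (mul_le_mul_of_nonneg_right ih (Real.exp_pos _).le)
  have hlast : b (n + N) ^ N ≤ M ^ (N * N) * U n := by
    have h1 : ∀ i ∈ Finset.range N, b (n + N) ≤ M ^ N * b (n + i) := by
      intro i hi
      have hi' := Finset.mem_range.mp hi
      have h2 : n + N = (N - i) + (n + i) := by omega
      rw [h2]
      refine (norm_iter_add_le T B (N - i) (n + i) x).trans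
        (mul_le_mul_of_nonneg_right ?_ (norm_nonneg _))
      refine (norm_iter_le T B (fun j => ?_) (N - i)).trans (pow_le_pow_right₀ hM (by omega))
      rw [← Function.iterate_add_apply]; exact hB _
    calc b (n + N) ^ N = ∏ i ∈ Finset.range N, b (n + N) := by simp
      _ ≤ ∏ i ∈ Finset.range N, (M ^ N * b (n + i)) :=
          Finset.prod_le_prod (fun i _ => hb0 _) h1
      _ = M ^ (N * N) * U n := by simp [Finset.prod_mul_distrib, pow_mul, hU]
  refine hlast.trans ((mul_le_mul_of_nonneg_left hUn (by positivity)).trans_eq ?_)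
  rw [← mul_assoc, ← pow_add]
  congr 2; ring

/-- Truncated logarithms of nearby numbers are close. -/
theorem log_max_le_add {a b τ K σ : ℝ} (hba : b ≤ a + τ) (hτ : 0 ≤ τ)
    (hσ : τ * Real.exp K ≤ σ) :
    Real.log (max b (Real.exp (-K))) ≤ Real.log (max a (Real.exp (-K))) + σ := by
  have hpos : 0 < max a (Real.exp (-K)) := lt_max_of_lt_right (Real.exp_pos _)
  rw [Real.log_le_iff_le_exp (lt_max_of_lt_right (Real.exp_pos _)), Real.exp_add,
    Real.exp_log hpos]
  have h1 : 1 + τ * Real.exp K ≤ Real.exp σ := by linarith [Real.add_one_le_exp σ]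
  have h2 : τ ≤ max a (Real.exp (-K)) * (τ * Real.exp K) := by
    have : Real.exp (-K) * (τ * Real.exp K) = τ := by
      rw [mul_left_comm, ← Real.exp_add]; simp
    calc τ = Real.exp (-K) * (τ * Real.exp K) := this.symm
      _ ≤ _ := mul_le_mul_of_nonneg_right (le_max_right _ _) (by positivity)
  calc max b (Real.exp (-K)) ≤ max a (Real.exp (-K)) + τ :=
        max_le (hba.trans (by gcongr; exact le_max_left _ _))
          ((le_max_right a _).trans (by linarith))
    _ ≤ max a (Real.exp (-K)) * (1 + τ * Real.exp K) := by linarith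
    _ ≤ _ := mul_le_mul_of_nonneg_left h1 hpos.le

variable [MeasurableSpace X] {μ : Measure X} {P : LDTParameters}

/-- The truncated logarithm of the norm of an iterate of a compatible bounded cocycle satisfies an
upper deviation estimate. -/
theorem upperDeviation_log_max [IsProbabilityMeasure μ] (hT : MeasurePreserving T μ μ)
    (hP : P.measures.Nonempty) {A : X → Matrix (Fin m) (Fin m) ℝ} {Ξ : Set (X → ℝ)}
    (hcompat : Compatible μ T Ξ A) (hbase : ∀ ξ ∈ Ξ, BaseLDT μ T P ξ)
    (hA : ∀ i j, Measurable fun x => A x i j) {M : ℝ} (hM : ∀ᵐ x ∂μ, ‖A x‖ ≤ M) (N : ℕ) (K : ℝ)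
    (hint : Integrable (fun x => Real.log (max ‖iter T A N x‖ (Real.exp (-K)))) μ) :
    UpperDeviation μ T P (fun x => Real.log (max ‖iter T A N x‖ (Real.exp (-K))))
      (∫ x, Real.log (max ‖iter T A N x‖ (Real.exp (-K))) ∂μ) := by
  have hpos : ∀ x, 0 < max ‖iter T A N x‖ (Real.exp (-K)) :=
    fun x => lt_max_of_lt_right (Real.exp_pos _)
  have hK : ∀ x, -K ≤ Real.log (max ‖iter T A N x‖ (Real.exp (-K))) := fun x => by
    rw [Real.le_log_iff_exp_le (hpos x)]; exact le_max_right _ _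
  refine UpperDeviation.of_superlevel hT hP
    (((measurable_norm_iter hT.measurable hA N).max measurable_const).log) hint
    (M := Real.log (max (M ^ N) (Real.exp (-K)))) hK ?_ ?_
  · filter_upwards [ae_forall_iterate hT hM] with x hx
    exact Real.log_le_log (hpos x) (max_le_max (norm_iter_le T A hx N) le_rfl)
  · intro c hc
    rcases hc.eq_or_lt with rfl | hc
    · have : {x | -K ≤ Real.log (max ‖iter T A N x‖ (Real.exp (-K)))} = Set.univ := by
        ext x; simpa using hK x
      rw [this]
      simpa using UpperDeviation.const (μ := μ) (T := T) hP 1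
    · have : {x | c ≤ Real.log (max ‖iter T A N x‖ (Real.exp (-K)))}
          = {x | Real.exp c ≤ ‖iter T A N x‖} := by
        ext x
        simp only [Set.mem_ofPred_eq]
        rw [Real.le_log_iff_exp_le (hpos x), le_max_iff, or_iff_left]
        exact not_le.mpr (Real.exp_lt_exp.mpr hc)
      rw [this]
      refine UpperDeviation.indicator hcompat hbase (N := N) ?_
      exact generateSetAlgebra.base _ ⟨N, le_rfl, Real.exp c, (Real.exp_pos c).le, Or.inr rfl⟩

/-- Nearly uniform upper semicontinuity of the top Lyapunov exponent: if some truncated finite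
scale exponent of `A` is below `t`, then for all `B` near `A` the rate `(1/n) log ‖B⁽ⁿ⁾‖` exceeds
`t` only on a small set. -/
theorem exists_measure_lt_norm_iter_le [IsProbabilityMeasure μ] (hT : MeasurePreserving T μ μ)
    {A : X → Matrix (Fin m) (Fin m) ℝ} {M : ℝ} (hM : ∀ᵐ x ∂μ, ‖A x‖ ≤ M) {N : ℕ} (hN : 1 ≤ N)
    {K t : ℝ}
    (hdev : UpperDeviation μ T P (fun x => Real.log (max ‖iter T A N x‖ (Real.exp (-K))))
      (∫ x, Real.log (max ‖iter T A N x‖ (Real.exp (-K))) ∂μ))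
    (hlt : ∫ x, Real.log (max ‖iter T A N x‖ (Real.exp (-K))) ∂μ < N * t) :
    ∃ δ : ℝ, 0 < δ ∧ ∃ i ∈ P.measures, ∃ n₀ : ℕ, ∀ B : X → Matrix (Fin m) (Fin m) ℝ,
      (∀ᵐ x ∂μ, ‖B x - A x‖ ≤ δ) → ∀ n, n₀ ≤ n →
        μ {x | Real.exp (n * t) < ‖iter T B n x‖} ≤ ENNReal.ofReal (i n) := by
  set H : X → ℝ := fun x => Real.log (max ‖iter T A N x‖ (Real.exp (-K))) with hH
  set s := ∫ x, H x ∂μ with hs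
  set σ := (N * t - s) / 4 with hσ
  have hσ0 : 0 < σ := by have : 0 < N * t - s := by linarith
                         positivity
  set M' := max M 0 + 1 with hM'
  have hM'1 : 1 ≤ M' := by linarith [le_max_right M 0]
  have hN0 : (0 : ℝ) < N := by exact_mod_cast hN
  have hD0 : 0 < N * M' ^ N * Real.exp K := by positivity
  set δ := min 1 (σ / (N * M' ^ N * Real.exp K)) with hδ
  have hδ0 : 0 < δ := lt_min one_pos (by positivity)
  obtain ⟨i, hi, n₀, hn⟩ := hdev σ hσ0
  set R := 2 * N * N * Real.log M' + N * K with hR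
  obtain ⟨n₁, hn₁⟩ := exists_nat_ge (R / (2 * σ))
  refine ⟨δ, hδ0, i, hi, max N (max n₀ n₁), fun B hB n hnn => ?_⟩
  refine (measure_mono_ae ?_).trans (hn n (by omega))
  filter_upwards [ae_forall_iterate hT hM, ae_forall_iterate hT hB] with x hAx hBx hlarge
  change Real.exp (n * t) < ‖iter T B n x‖ at hlarge
  change n * (s + σ) < ∑ j ∈ Finset.range n, H (T^[j] x)
  have hAM : ∀ j, ‖A (T^[j] x)‖ ≤ M' := fun j =>
    (hAx j).trans (by linarith [le_max_left M 0])
  have hBM : ∀ j, ‖B (T^[j] x)‖ ≤ M' := fun j => by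
    have h1 : B (T^[j] x) = A (T^[j] x) + (B (T^[j] x) - A (T^[j] x)) := by abel
    rw [h1]
    refine (norm_add_le _ _).trans ?_
    have h2 := hAx j
    have h3 := (hBx j).trans (min_le_left _ _)
    linarith [le_max_left M 0]
  have hshift : ∀ j k, T^[k] (T^[j] x) = T^[k + j] x :=
    fun j k => (Function.iterate_add_apply T k j x).symm
  have hh : ∀ j, ‖iter T B N (T^[j] x)‖ ≤ Real.exp (H (T^[j] x) + σ) := by
    intro j
    have h1 := norm_iter_sub_le T A B (x := T^[j] x) hM'1 (fun k => by rw [hshift]; exact hAM _)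
      (fun k => by rw [hshift]; exact hBM _) (fun k => by rw [hshift]; exact hBx _) N
    have h2 : ‖iter T B N (T^[j] x)‖ ≤ ‖iter T A N (T^[j] x)‖ + N * M' ^ N * δ := by
      have := norm_le_norm_add_norm_sub' (iter T B N (T^[j] x)) (iter T A N (T^[j] x))
      linarith
    have h3 : N * M' ^ N * δ * Real.exp K ≤ σ := by
      have : δ ≤ σ / (N * M' ^ N * Real.exp K) := min_le_right _ _
      rw [le_div_iff₀ hD0] at this
      linarith
    have h4 := log_max_le_add h2 (by positivity) h3
    refine (le_max_left _ (Real.exp (-K))).trans ?_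
    rwa [← Real.log_le_iff_le_exp (lt_max_of_lt_right (Real.exp_pos _))]
  obtain ⟨k, rfl⟩ : ∃ k, n = k + N := ⟨n - N, by omega⟩
  have hpow := norm_iter_pow_le hN hM'1 hBM hh k
  have hlow : Real.exp ((k + N : ℕ) * t) ^ N < ‖iter T B (k + N) x‖ ^ N :=
    pow_lt_pow_left₀ hlarge (Real.exp_pos _).le (by omega)
  have h1 := hlow.trans_le hpow
  rw [← Real.exp_nat_mul, ← Real.exp_log (show 0 < M' ^ (2 * N * N) by positivity),
    ← Real.exp_add, Real.exp_lt_exp, Real.log_pow, Finset.sum_add_distrib, Finset.sum_const,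
    Finset.card_range, nsmul_eq_mul] at h1
  have hHK : ∀ y, -K ≤ H y := fun y => by
    simp only [hH]
    rw [Real.le_log_iff_exp_le (lt_max_of_lt_right (Real.exp_pos _))]; exact le_max_right _ _
  have h2 : ∑ j ∈ Finset.range k, H (T^[j] x)
      ≤ ∑ j ∈ Finset.range (k + N), H (T^[j] x) + N * K := by
    rw [Finset.sum_range_add]
    have : ∑ j ∈ Finset.range N, (-K) ≤ ∑ j ∈ Finset.range N, H (T^[k + j] x) :=
      Finset.sum_le_sum fun j _ => hHK _
    rw [Finset.sum_const, Finset.card_range, nsmul_eq_mul] at this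
    linarith
  have h3 : R ≤ 2 * σ * (k + N : ℕ) := by
    have h4 : (n₁ : ℝ) ≤ (k + N : ℕ) := by
      exact_mod_cast (le_max_right n₀ n₁).trans ((le_max_right _ _).trans hnn)
    rw [div_le_iff₀ (by positivity)] at hn₁
    nlinarith
  have h5 : (N : ℝ) * t = s + 4 * σ := by rw [hσ]; ring
  have h6 : (N : ℝ) * ((k + N : ℕ) * t) = (k + N : ℕ) * (s + 4 * σ) := by rw [← h5]; ring
  rw [h6] at h1
  push_cast at h1 h3 ⊢
  nlinarith [mul_pos hN0 hσ0]

end UpperSemicontinuity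

/-! ### Almost additivity over three blocks -/

section ThreeBlocks

variable {X : Type*} [MeasurableSpace X] {μ : Measure X} [IsProbabilityMeasure μ] {T : X → X}
  {m : ℕ}

/-- Integrated form of `abs_log_norm_mul_mul_le` for the blocks of lengths `b`, `b`, `a` along an
orbit. Off a set of measure at most `5 ρ` the pointwise estimate applies; on that set the `L²` bound
is used. -/
theorem abs_logIntegral_three_blocks_le (hm : 2 ≤ m) (hT : MeasurePreserving T μ μ)
    {B : X → Matrix (Fin m) (Fin m) ℝ} (hB : ∀ i j, Measurable fun x => B x i j) {C : ℝ}
    (h : LogBounded μ T B C) {a b : ℕ} (hb : 1 ≤ b) (hba : b ≤ a) (hab : a ≤ 2 * b)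
    {u₁ u₃ w p q ρ : ℝ} (hρ : 0 ≤ ρ)
    (h1 : μ {x | Real.exp u₁ < ‖iter T B b x‖} ≤ ENNReal.ofReal ρ)
    (h3 : μ {x | Real.exp u₃ < ‖iter T B a x‖} ≤ ENNReal.ofReal ρ)
    (hw : μ {x | Real.exp w < ‖wedge 2 (iter T B b x)‖} ≤ ENNReal.ofReal ρ)
    (hp : μ {x | ‖iter T B (a + b) x‖ < Real.exp p} ≤ ENNReal.ofReal ρ)
    (hq : μ {x | ‖iter T B (2 * b) x‖ < Real.exp q} ≤ ENNReal.ofReal ρ)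
    (hz : m ^ 3 * Real.exp (u₃ + u₁ + w - p - q) ≤ 1 / 8) :
    |logIntegral μ T B (a + 2 * b) + logIntegral μ T B b - logIntegral μ T B (a + b)
        - logIntegral μ T B (2 * b)|
      ≤ 8 * (m ^ 3 * Real.exp (u₃ + u₁ + w - p - q)) + 10 * C * b * (5 * ρ) ^ (1 / 2 : ℝ) := by
  set z := m ^ 3 * Real.exp (u₃ + u₁ + w - p - q) with hzdef
  have hTb := hT.iterate b
  have hT2b := hT.iterate (2 * b)
  have hmn : ∀ n, Measurable fun x => ‖iter T B n x‖ :=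
    fun n => measurable_norm_iter hT.measurable hB n
  -- the five exceptional sets
  set S₁ := {x | Real.exp u₁ < ‖iter T B b x‖} with hS₁
  set S₃ := {x | Real.exp u₃ < ‖iter T B a x‖} with hS₃
  set W := {x | Real.exp w < ‖wedge 2 (iter T B b x)‖} with hW
  set P := {x | ‖iter T B (a + b) x‖ < Real.exp p} with hP
  set Q := {x | ‖iter T B (2 * b) x‖ < Real.exp q} with hQ
  have mS₁ : MeasurableSet S₁ := measurableSet_lt measurable_const (hmn b)
  have mS₃ : MeasurableSet S₃ := measurableSet_lt measurable_const (hmn a)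
  have mW : MeasurableSet W :=
    measurableSet_lt measurable_const (measurable_norm_wedge_iter hT.measurable hB b)
  have mP : MeasurableSet P := measurableSet_lt (hmn _) measurable_const
  have mQ : MeasurableSet Q := measurableSet_lt (hmn _) measurable_const
  set S := S₁ ∪ T^[2 * b] ⁻¹' S₃ ∪ T^[b] ⁻¹' W ∪ T^[b] ⁻¹' P ∪ Q with hS
  have mS : MeasurableSet S :=
    (((mS₁.union (hT2b.measurable mS₃)).union (hTb.measurable mW)).union
      (hTb.measurable mP)).union mQ
  have hSle : μ S ≤ ENNReal.ofReal (5 * ρ) := by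
    have e5 : ENNReal.ofReal (5 * ρ) = ENNReal.ofReal ρ + ENNReal.ofReal ρ + ENNReal.ofReal ρ
        + ENNReal.ofReal ρ + ENNReal.ofReal ρ := by
      rw [← ENNReal.ofReal_add hρ hρ, ← ENNReal.ofReal_add (by linarith) hρ,
        ← ENNReal.ofReal_add (by linarith) hρ, ← ENNReal.ofReal_add (by linarith) hρ]
      congr 1; ring
    rw [e5]
    refine (measure_union_le _ _).trans (add_le_add ?_ hq)
    refine (measure_union_le _ _).trans (add_le_add ?_ ?_)
    · refine (measure_union_le _ _).trans (add_le_add ?_ ?_)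
      · refine (measure_union_le _ _).trans (add_le_add h1 ?_)
        rwa [hT2b.measure_preimage mS₃.nullMeasurableSet]
      · rwa [hTb.measure_preimage mW.nullMeasurableSet]
    · rwa [hTb.measure_preimage mP.nullMeasurableSet]
  have hSreal : μ.real S ≤ 5 * ρ :=
    ENNReal.toReal_le_of_le_ofReal (by linarith) hSle
  -- the four terms and their contributions over `S`
  set f₁ := logNorm T B (a + 2 * b) with hf₁
  set f₂ := fun x => logNorm T B b (T^[b] x) with hf₂
  set f₃ := fun x => logNorm T B (a + b) (T^[b] x) with hf₃
  set f₄ := logNorm T B (2 * b) with hf₄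
  have i₁ : Integrable f₁ μ := h.integrable (by omega)
  have i₂ : Integrable f₂ μ := integrable_comp_iterate hT (h.integrable hb) b
  have i₃ : Integrable f₃ μ := integrable_comp_iterate hT (h.integrable (by omega)) b
  have i₄ : Integrable f₄ μ := h.integrable (by omega)
  have hC := h.nonneg
  set r := (5 * ρ) ^ (1 / 2 : ℝ) with hr
  have hr' : (μ.real S) ^ (1 / 2 : ℝ) ≤ r :=
    Real.rpow_le_rpow measureReal_nonneg hSreal (by norm_num)
  have hcs : ∀ n, 1 ≤ n → ∫ x in S, |logNorm T B n x| ∂μ ≤ C * n * r := fun n hn =>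
    (setIntegral_abs_le (h.memLp n hn) (by positivity) (h.norm_le n hn) S).trans (by gcongr)
  have hcs' : ∀ n, 1 ≤ n → ∫ x in S, |logNorm T B n (T^[b] x)| ∂μ ≤ C * n * r := by
    intro n hn
    have e1 := eLpNorm_comp_measurePreserving (p := 2) (h.memLp n hn).1 hTb
    exact (setIntegral_abs_le ((h.memLp n hn).comp_measurePreserving hTb) (by positivity)
      (e1.le.trans (h.norm_le n hn)) S).trans (by gcongr)
  have hint : ∫ x, (f₁ x + f₂ x - f₃ x - f₄ x) ∂μ = logIntegral μ T B (a + 2 * b)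
      + logIntegral μ T B b - logIntegral μ T B (a + b) - logIntegral μ T B (2 * b) := by
    have i12 : Integrable (fun x => f₁ x + f₂ x) μ := i₁.add i₂
    have i123 : Integrable (fun x => f₁ x + f₂ x - f₃ x) μ := i12.sub i₃
    rw [integral_sub i123 i₄, integral_sub i12 i₃, integral_add i₁ i₂]
    simp only [hf₂, hf₃]
    rw [integral_comp_iterate hT (h.memLp b hb).1,
      integral_comp_iterate hT (h.memLp (a + b) (by omega)).1]
    rfl
  have i0 : Integrable (fun x => f₁ x + f₂ x - f₃ x - f₄ x) μ := ((i₁.add i₂).sub i₃).sub i₄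
  have hgood : ∀ᵐ x ∂μ, x ∈ Sᶜ → |f₁ x + f₂ x - f₃ x - f₄ x| ≤ 8 * z := by
    refine Eventually.of_forall fun x hx => ?_
    simp only [hS, Set.mem_compl_iff, Set.mem_union, not_or] at hx
    obtain ⟨⟨⟨⟨hx1, hx3⟩, hxw⟩, hxp⟩, hxq⟩ := hx
    have hx1 : ‖iter T B b x‖ ≤ Real.exp u₁ := not_lt.mp hx1
    have hx3 : ‖iter T B a (T^[2 * b] x)‖ ≤ Real.exp u₃ := not_lt.mp hx3
    have hxw : ‖wedge 2 (iter T B b (T^[b] x))‖ ≤ Real.exp w := not_lt.mp hxw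
    have hxp : Real.exp p ≤ ‖iter T B (a + b) (T^[b] x)‖ := not_lt.mp hxp
    have hxq : Real.exp q ≤ ‖iter T B (2 * b) x‖ := not_lt.mp hxq
    have e2 : T^[b] (T^[b] x) = T^[2 * b] x := by
      rw [← Function.iterate_add_apply, two_mul]
    have eP : iter T B (a + b) (T^[b] x) = iter T B a (T^[2 * b] x) * iter T B b (T^[b] x) := by
      rw [iter_add, e2]
    have eQ : iter T B (2 * b) x = iter T B b (T^[b] x) * iter T B b x := by
      rw [two_mul, iter_add]
    have eR : iter T B (a + 2 * b) x
        = iter T B a (T^[2 * b] x) * iter T B b (T^[b] x) * iter T B b x := by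
      rw [iter_add, eQ, mul_assoc]
    rw [eP] at hxp
    rw [eQ] at hxq
    have hkey := abs_log_norm_mul_mul_le hm (iter T B a (T^[2 * b] x)) (iter T B b (T^[b] x))
      (iter T B b x) hz ((Real.exp_pos p).trans_le hxp) ((Real.exp_pos q).trans_le hxq) (by
        calc (m : ℝ) ^ 3 * (‖iter T B a (T^[2 * b] x)‖ * ‖iter T B b x‖
              * ‖wedge 2 (iter T B b (T^[b] x))‖)
            ≤ m ^ 3 * (Real.exp u₃ * Real.exp u₁ * Real.exp w) := by gcongr
          _ = z * (Real.exp p * Real.exp q) := by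
              have he : Real.exp u₃ * Real.exp u₁ * Real.exp w
                  = Real.exp (u₃ + u₁ + w - p - q) * (Real.exp p * Real.exp q) := by
                simp only [← Real.exp_add]
                congr 1; ring
              rw [he, hzdef]; ring
          _ ≤ _ := by gcongr)
    simpa only [hf₁, hf₂, hf₃, hf₄, logNorm, eP, eQ, eR] using hkey
  have hSc : ∫ x in Sᶜ, |f₁ x + f₂ x - f₃ x - f₄ x| ∂μ ≤ 8 * z := by
    have e1 : ∫ x in Sᶜ, |f₁ x + f₂ x - f₃ x - f₄ x| ∂μ ≤ ∫ _ in Sᶜ, 8 * z ∂μ :=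
      setIntegral_mono_on_ae i0.abs.integrableOn (integrable_const _).integrableOn mS.compl hgood
    refine e1.trans ?_
    rw [setIntegral_const, smul_eq_mul]
    have : 0 ≤ 8 * z := by positivity
    exact mul_le_of_le_one_left this measureReal_le_one
  have hSi : ∫ x in S, |f₁ x + f₂ x - f₃ x - f₄ x| ∂μ ≤ 10 * C * b * r := by
    have a₁ := i₁.abs.integrableOn (s := S)
    have a₂ := i₂.abs.integrableOn (s := S)
    have a₃ := i₃.abs.integrableOn (s := S)
    have a₄ := i₄.abs.integrableOn (s := S)
    have a12 : IntegrableOn (fun x => |f₁ x| + |f₂ x|) S μ := a₁.add a₂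
    have a123 : IntegrableOn (fun x => |f₁ x| + |f₂ x| + |f₃ x|) S μ := a12.add a₃
    have a1234 : IntegrableOn (fun x => |f₁ x| + |f₂ x| + |f₃ x| + |f₄ x|) S μ := a123.add a₄
    have e1 : ∫ x in S, |f₁ x + f₂ x - f₃ x - f₄ x| ∂μ
        ≤ ∫ x in S, (|f₁ x| + |f₂ x| + |f₃ x| + |f₄ x|) ∂μ :=
      integral_mono i0.abs.integrableOn a1234 fun x =>
        (abs_sub _ _).trans (add_le_add_left ((abs_sub _ _).trans
          (add_le_add_left (abs_add_le _ _) _)) _)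
    rw [integral_add a123 a₄, integral_add a12 a₃, integral_add a₁ a₂] at e1
    have t1 := hcs (a + 2 * b) (by omega)
    have t2 := hcs' b hb
    have t3 := hcs' (a + b) (by omega)
    have t4 := hcs (2 * b) (by omega)
    have hr0 : 0 ≤ r := Real.rpow_nonneg (by linarith) _
    have hab' : (a : ℝ) ≤ 2 * b := by exact_mod_cast hab
    have hCr : 0 ≤ C * r := mul_nonneg hC hr0
    push_cast at t1 t3 t4
    have := mul_le_mul_of_nonneg_left hab' hCr
    nlinarith
  rw [← hint]
  refine abs_integral_le_integral_abs.trans ?_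
  rw [← integral_add_compl mS i0.abs]
  linarith

end ThreeBlocks

/-! ### Lower semicontinuity at a finite scale -/

section FiniteScale

variable {X : Type*} [MeasurableSpace X] {μ : Measure X} [IsProbabilityMeasure μ] {T : X → X}
  {m : ℕ}

/-- At a fixed scale the integrated logarithm is lower semicontinuous: `‖A⁽ⁿ⁾‖` is bounded away
from `0` off a small set, on which the uniform `L²` bound is used. -/
theorem exists_logIntegral_sub_le (hT : MeasurePreserving T μ μ)
    {A : X → Matrix (Fin m) (Fin m) ℝ} (hA : ∀ i j, Measurable fun x => A x i j) {M : ℝ}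
    (hM : ∀ᵐ x ∂μ, ‖A x‖ ≤ M) {C : ℝ} (hAC : LogBounded μ T A C) {n : ℕ} (hn : 1 ≤ n) {η : ℝ}
    (hη : 0 < η) :
    ∃ δ : ℝ, 0 < δ ∧ ∀ B : X → Matrix (Fin m) (Fin m) ℝ, LogBounded μ T B C →
      (∀ᵐ x ∂μ, ‖B x - A x‖ ≤ δ) → logIntegral μ T A n - η ≤ logIntegral μ T B n := by
  have hC := hAC.nonneg
  have hmA := measurable_norm_iter hT.measurable hA n
  have hn0 : (0 : ℝ) < n := by exact_mod_cast hn
  set r := η / (4 * (C * n + 1)) with hr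
  have hr0 : 0 < r := by positivity
  obtain ⟨τ, hτ, hμτ⟩ : ∃ τ : ℝ, 0 < τ ∧ μ.real {x | ‖iter T A n x‖ < τ} ≤ r ^ 2 := by
    set s : ℕ → Set X := fun k => {x | ‖iter T A n x‖ < 1 / ((k : ℝ) + 1)} with hs
    have hanti : Antitone s := fun k l hkl x hx =>
      lt_of_lt_of_le (show ‖iter T A n x‖ < 1 / ((l : ℝ) + 1) from hx)
        (one_div_le_one_div_of_le (by positivity) (by gcongr))
    have hlim := tendsto_measure_iInter_atTop (μ := μ)
      (fun k => (measurableSet_lt hmA measurable_const : MeasurableSet (s k)).nullMeasurableSet)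
      hanti ⟨0, measure_ne_top _ _⟩
    have hzero : μ (⋂ k, s k) = 0 := by
      refine measure_mono_null (t := {x | ¬ 0 < ‖iter T A n x‖}) (fun x hx hpos => ?_)
        (hAC.pos n hn)
      obtain ⟨k, hk⟩ := exists_nat_one_div_lt hpos
      exact lt_irrefl _ (hk.trans (Set.mem_iInter.mp hx k))
    rw [hzero] at hlim
    obtain ⟨k, hk⟩ := (hlim.eventually (gt_mem_nhds
      (show (0 : ℝ≥0∞) < ENNReal.ofReal (r ^ 2) by simpa using pow_pos hr0 2))).exists
    exact ⟨1 / ((k : ℝ) + 1), by positivity,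
      ENNReal.toReal_le_of_le_ofReal (by positivity) hk.le⟩
  set S := {x | ‖iter T A n x‖ < τ} with hS
  have mS : MeasurableSet S := measurableSet_lt hmA measurable_const
  have hSr : (μ.real S) ^ (1 / 2 : ℝ) ≤ r := by
    rw [← Real.sqrt_eq_rpow]
    exact (Real.sqrt_le_sqrt hμτ).trans_eq (Real.sqrt_sq hr0.le)
  set M' := max M 0 + 1 with hM'
  have hM'1 : 1 ≤ M' := by linarith [le_max_right M 0]
  have hγ : 0 < 1 - Real.exp (-(η / 2)) := by
    have : Real.exp (-(η / 2)) < 1 := by rw [Real.exp_lt_one_iff]; linarith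
    linarith
  set D := n * M' ^ n with hD
  have hD0 : 0 < D := by positivity
  set δ := min 1 (τ * (1 - Real.exp (-(η / 2))) / D) with hδ
  refine ⟨δ, lt_min one_pos (by positivity), fun B hBC hBA => ?_⟩
  have hgood : ∀ᵐ x ∂μ, x ∈ Sᶜ → logNorm T A n x - logNorm T B n x ≤ η / 2 := by
    filter_upwards [ae_forall_iterate hT hM, ae_forall_iterate hT hBA, hAC.pos n hn,
      hBC.pos n hn] with x hAx hBx hApos hBpos hx
    have hAM : ∀ j, ‖A (T^[j] x)‖ ≤ M' := fun j =>
      (hAx j).trans (by linarith [le_max_left M 0])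
    have hBM : ∀ j, ‖B (T^[j] x)‖ ≤ M' := fun j => by
      have h1 : B (T^[j] x) = A (T^[j] x) + (B (T^[j] x) - A (T^[j] x)) := by abel
      rw [h1]
      refine (norm_add_le _ _).trans ?_
      have h2 := hAx j
      have h3 := (hBx j).trans (min_le_left _ _)
      linarith [le_max_left M 0]
    have h1 := norm_iter_sub_le T A B hM'1 hAM hBM hBx n
    have h2 : n * M' ^ n * δ ≤ τ * (1 - Real.exp (-(η / 2))) := by
      have : δ ≤ τ * (1 - Real.exp (-(η / 2))) / D := min_le_right _ _
      rw [le_div_iff₀ hD0] at this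
      linarith
    have h3 : τ ≤ ‖iter T A n x‖ := not_lt.mp hx
    have h4 : ‖iter T A n x‖ ≤ ‖iter T B n x‖ + n * M' ^ n * δ := by
      have := norm_le_norm_add_norm_sub (iter T B n x) (iter T A n x)
      linarith
    have h5 : ‖iter T A n x‖ * Real.exp (-(η / 2)) ≤ ‖iter T B n x‖ := by nlinarith
    have h6 := Real.log_le_log (by positivity) h5
    rw [Real.log_mul hApos.ne' (Real.exp_pos _).ne', Real.log_exp] at h6
    simp only [logNorm]
    linarith
  have iA := hAC.integrable hn
  have iB := hBC.integrable hn
  have hdiff : logIntegral μ T A n - logIntegral μ T B n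
      = ∫ x in S, (logNorm T A n x - logNorm T B n x) ∂μ
        + ∫ x in Sᶜ, (logNorm T A n x - logNorm T B n x) ∂μ := by
    have hi : Integrable (fun x => logNorm T A n x - logNorm T B n x) μ := iA.sub iB
    rw [integral_add_compl mS hi, integral_sub iA iB]; rfl
  have hSc : ∫ x in Sᶜ, (logNorm T A n x - logNorm T B n x) ∂μ ≤ η / 2 := by
    have e1 : ∫ x in Sᶜ, (logNorm T A n x - logNorm T B n x) ∂μ ≤ ∫ _ in Sᶜ, η / 2 ∂μ :=
      setIntegral_mono_on_ae (iA.sub iB).integrableOn (integrable_const _).integrableOn mS.compl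
        hgood
    refine e1.trans ?_
    rw [setIntegral_const, smul_eq_mul]
    exact mul_le_of_le_one_left (by positivity) measureReal_le_one
  have hSi : ∫ x in S, (logNorm T A n x - logNorm T B n x) ∂μ ≤ 2 * (C * n * r) := by
    have e1 : ∫ x in S, (logNorm T A n x - logNorm T B n x) ∂μ
        ≤ ∫ x in S, (|logNorm T A n x| + |logNorm T B n x|) ∂μ :=
      integral_mono (iA.sub iB).integrableOn (iA.abs.add iB.abs).integrableOn fun x => by
        have h1 := le_abs_self (logNorm T A n x)
        have h2 := neg_abs_le (logNorm T B n x)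
        simp only
        linarith
    rw [integral_add iA.abs.integrableOn iB.abs.integrableOn] at e1
    have h1 := (setIntegral_abs_le (hAC.memLp n hn) (by positivity) (hAC.norm_le n hn) S).trans
      (mul_le_mul_of_nonneg_left hSr (by positivity))
    have h2 := (setIntegral_abs_le (hBC.memLp n hn) (by positivity) (hBC.norm_le n hn) S).trans
      (mul_le_mul_of_nonneg_left hSr (by positivity))
    linarith
  have hsmall : 2 * (C * n * r) ≤ η / 2 := by
    have : (C * n + 1) * r = η / 4 := by rw [hr]; field_simp
    nlinarith
  linarith

end FiniteScale

/-! ### Uniform estimates near a cocycle with a gap -/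

section LocalEstimates

variable {X : Type*} [MeasurableSpace X] {μ : Measure X} {T : X → X} {m : ℕ}

theorem CocycleSpace.ae_norm_sub_le (𝒞 : CocycleSpace μ) {A B : 𝒞.carrier m} {δ : ℝ}
    (h : dist B A < δ) : ∀ᵐ x ∂μ, ‖B.1 x - A.1 x‖ ≤ δ := by
  have h1 := 𝒞.dist_ge m A B
  rw [eLpNorm_exponent_top] at h1
  filter_upwards [ae_le_eLpNormEssSup (f := fun x => B.1 x - A.1 x) (μ := μ)] with x hx
  have h2 := hx.trans (h1.trans (ENNReal.ofReal_le_ofReal h.le))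
  rw [← ofReal_norm] at h2
  exact (ENNReal.ofReal_le_ofReal_iff (dist_nonneg.trans h.le)).mp h2

theorem CocycleSpace.exists_ae_norm_le (𝒞 : CocycleSpace μ) (A : 𝒞.carrier m) :
    ∃ M : ℝ, ∀ᵐ x ∂μ, ‖A.1 x‖ ≤ M := by
  have h := (𝒞.bounded m A.1 A.2).2
  rw [eLpNorm_exponent_top] at h
  refine ⟨(eLpNormEssSup (fun x => ‖A.1 x‖) μ).toReal, ?_⟩
  filter_upwards [ae_le_eLpNormEssSup (f := fun x => ‖A.1 x‖) (μ := μ)] with x hx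
  rw [enorm_norm, ← ofReal_norm] at hx
  exact (ENNReal.ofReal_le_iff_le_toReal h.ne).mp hx

theorem LDTParameters.antitone_natCast (P : LDTParameters) {i : ℝ → ℝ} (hi : i ∈ P.measures)
    {a b : ℕ} (hb : 1 ≤ b) (hba : b ≤ a) : i a ≤ i b := by
  have h1 : (0 : ℝ) < b := by exact_mod_cast hb
  have h2 : (b : ℝ) ≤ a := by exact_mod_cast hba
  exact (P.isDevMeasure i hi).strictAntiOn.antitoneOn h1 (h1.trans_le h2) h2

/-- Uniform estimates in a neighbourhood of a cocycle `A` whose first two Lyapunov exponents differ.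
Here `ℓ = L₁(A)`, and `ε` is small compared with the gap. -/
theorem exists_local_estimates [IsProbabilityMeasure μ] (hT : MeasurePreserving T μ μ)
    (𝒞 : CocycleSpace μ) (Ξ : Set (X → ℝ)) (P : LDTParameters)
    (hslow : ∀ c : ℝ, 0 < c → ∃ i ∈ P.measures, ∀ᶠ t : ℝ in atTop, Real.exp (-(c * t)) ≤ i t)
    (hcompat : ∀ m : ℕ, ∀ A ∈ 𝒞.carrier m, Compatible μ T Ξ A)
    (hbase : ∀ ξ ∈ Ξ, BaseLDT μ T P ξ)
    (hm : 2 ≤ m) (A : 𝒞.carrier m)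
    (hbdd : UniformlyL2Bounded T 𝒞 A) (hfiber : UniformFiberLDT T 𝒞 P A)
    (hA : lyap μ T A.1 2 < lyap μ T A.1 1) :
    ∃ ℓ ε δ C D : ℝ, 0 < ε ∧ ε ≤ 1 / 1000 ∧ 0 < δ ∧ 0 ≤ D ∧
      (∀ n : ℕ, 1 ≤ n → ℓ * n ≤ logIntegral μ T A.1 n) ∧
      ∃ i ∈ P.measures, ∃ n₀ : ℕ, 1 ≤ n₀ ∧ ∀ B : 𝒞.carrier m, dist B A < δ →
        LogBounded μ T B.1 C ∧
        (∀ n : ℕ, n₀ ≤ n → logIntegral μ T B.1 n ≤ n * (ℓ + 2 * ε)) ∧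
        ∀ a b : ℕ, n₀ ≤ b → b ≤ a → a ≤ 2 * b →
          (a + b) * (ℓ - 20 * ε) ≤ logIntegral μ T B.1 (a + b) →
          2 * b * (ℓ - 20 * ε) ≤ logIntegral μ T B.1 (2 * b) →
          |logIntegral μ T B.1 (a + 2 * b) + logIntegral μ T B.1 b
            - logIntegral μ T B.1 (a + b) - logIntegral μ T B.1 (2 * b)|
            ≤ D * b * (i b) ^ (1 / 2 : ℝ) := by
  have hPne : P.measures.Nonempty := by
    obtain ⟨i, hi, -⟩ := hslow 1 one_pos
    exact ⟨i, hi⟩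
  have hent : ∀ B : 𝒞.carrier m, ∀ i j, Measurable fun x => B.1 x i j :=
    fun B => 𝒞.measurable m B.1 B.2
  obtain ⟨δ₁, hδ₁, C, hC⟩ := hbdd
  have hLB : ∀ B : 𝒞.carrier m, dist B A < δ₁ → LogBounded μ T B.1 C := fun B hB =>
    LogBounded.of_eLpNorm_lt hT.measurable (hent B) (hC B hB)
  have hAC := hLB A (by simpa using hδ₁)
  obtain ⟨ℓ, hℓ, hlim, hinf⟩ := exists_lyap_one_eq hm hT hAC
  rw [hℓ] at hA
  obtain ⟨M, hM⟩ := 𝒞.exists_ae_norm_le A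
  obtain ⟨κ, hκ, Nw, hNw, Kw, -, hintw, hltw⟩ :=
    exists_truncated_wedge_lt hm hT (hent A) hM hAC hlim hA
  set ε := min (κ / 300) (1 / 1000) with hε
  have hε0 : 0 < ε := lt_min (by positivity) (by norm_num)
  have hεκ : 300 * ε ≤ κ := by
    have := min_le_left (κ / 300) (1 / 1000)
    linarith
  -- upper bounds for `‖B⁽ⁿ⁾‖`
  obtain ⟨N₁, hN₁, K₁, -, hint₁, hlt₁⟩ := exists_truncated_lt hT (hent A) hAC hlim hε0
  obtain ⟨δ₂, hδ₂, i₁, hi₁, n₁, husc⟩ := exists_measure_lt_norm_iter_le hT hM hN₁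
    (upperDeviation_log_max hT hPne (hcompat m A.1 A.2) hbase (hent A) hM N₁ K₁ hint₁) hlt₁
  -- upper bounds for `‖∧₂ B⁽ⁿ⁾‖`
  have hm1 : 1 ≤ 2 := one_le_two
  set wA : 𝒞.carrier m → 𝒞.carrier (m.choose 2) := fun B =>
    ⟨fun x => wedge 2 (B.1 x), 𝒞.wedge_mem m 2 hm1 hm B.1 B.2⟩ with hwA
  have hwmem := (wA A).2
  obtain ⟨Mw, hMw⟩ := 𝒞.exists_ae_norm_le (wA A)
  have hiterw : ∀ B : 𝒞.carrier m, ∀ n : ℕ, 1 ≤ n → ∀ x,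
      iter T (wA B).1 n x = wedge 2 (iter T B.1 n x) := fun B n hn x =>
    iter_wedge_two T B.1 hn x
  simp only [← hiterw A Nw hNw] at hintw hltw
  obtain ⟨δ₃, hδ₃, i₂, hi₂, n₂, huscw⟩ := exists_measure_lt_norm_iter_le hT hMw hNw
    (upperDeviation_log_max hT hPne (hcompat _ _ hwmem) hbase
      (𝒞.measurable _ _ hwmem) hMw Nw Kw hintw) hltw
  obtain ⟨δ₄, hδ₄, hw⟩ :=
    Metric.continuous_iff.mp (𝒞.wedge_lipschitz m 2 hm1 hm).continuous A δ₃ hδ₃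
  -- lower bounds for `‖B⁽ⁿ⁾‖`
  obtain ⟨δ₅, hδ₅, p, hp, hldt⟩ := hfiber ε hε0
  obtain ⟨-, -, hp3⟩ := P.params_mem p hp
  -- a deviation function above the exponentially small error of the pointwise estimate
  obtain ⟨i₃, hi₃, hslow₃⟩ := hslow κ hκ
  set i : ℝ → ℝ := fun t => i₁ t + i₂ t + p.2.2 t + i₃ t with hidef
  have hi : i ∈ P.measures :=
    P.add_mem _ (P.add_mem _ (P.add_mem _ hi₁ _ hi₂) _ hp3) _ hi₃
  have hpos : ∀ j ∈ P.measures, ∀ n : ℕ, 1 ≤ n → 0 < j n := fun j hj n hn =>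
    (P.isDevMeasure j hj).pos n (by exact_mod_cast hn)
  have hle : ∀ n : ℕ, 1 ≤ n → i₁ n ≤ i n ∧ i₂ n ≤ i n ∧ p.2.2 n ≤ i n ∧ i₃ n ≤ i n := by
    intro n hn
    have h1 := hpos i₁ hi₁ n hn
    have h2 := hpos i₂ hi₂ n hn
    have h3 := hpos _ hp3 n hn
    have h4 := hpos i₃ hi₃ n hn
    simp only [hidef]
    refine ⟨?_, ?_, ?_, ?_⟩ <;> linarith
  have hizero : ∀ᶠ n : ℕ in atTop, i n < 1 / 2 :=
    ((P.isDevMeasure i hi).tendsto_zero.comp tendsto_natCast_atTop_atTop).eventually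
      (gt_mem_nhds (by norm_num))
  have hexp : ∀ᶠ n : ℕ in atTop, (m : ℝ) ^ 3 * Real.exp (-(κ / 2 * n)) ≤ 1 / 8 := by
    have h1 : Tendsto (fun n : ℕ => (m : ℝ) ^ 3 * Real.exp (-(κ / 2 * n))) atTop
        (𝓝 (m ^ 3 * 0)) := by
      refine Tendsto.const_mul _ (Real.tendsto_exp_neg_atTop_nhds_zero.comp ?_)
      exact tendsto_natCast_atTop_atTop.const_mul_atTop (by positivity)
    rw [mul_zero] at h1
    exact (h1.eventually (gt_mem_nhds (by norm_num))).mono fun n hn => hn.le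
  have hslowN : ∀ᶠ n : ℕ in atTop, Real.exp (-(κ * n)) ≤ i₃ n :=
    tendsto_natCast_atTop_atTop.eventually hslow₃
  obtain ⟨n₃, hn₃⟩ := eventually_atTop.mp (hizero.and (hexp.and hslowN))
  have hC0 := hAC.nonneg
  refine ⟨ℓ, ε, min δ₁ (min δ₂ (min δ₄ δ₅)), C, 8 * m ^ 3 + 30 * C, hε0, min_le_right _ _,
    by positivity, by positivity, hinf, i, hi, n₁ + n₂ + n₃ + p.1 + 1, by omega, fun B hB => ?_⟩
  simp only [lt_min_iff] at hB
  obtain ⟨hB1, hB2, hB4, hB5⟩ := hB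
  have hBC := hLB B hB1
  have hup : ∀ n : ℕ, n₁ + n₂ + n₃ + p.1 + 1 ≤ n →
      μ {x | Real.exp (n * (ℓ + ε)) < ‖iter T B.1 n x‖} ≤ ENNReal.ofReal (i n) := fun n hn =>
    (husc B.1 (𝒞.ae_norm_sub_le hB2) n (by omega)).trans
      (ENNReal.ofReal_le_ofReal (hle n (by omega)).1)
  have hupw : ∀ n : ℕ, n₁ + n₂ + n₃ + p.1 + 1 ≤ n →
      μ {x | Real.exp (n * (2 * ℓ - κ)) < ‖wedge 2 (iter T B.1 n x)‖}
        ≤ ENNReal.ofReal (i n) := by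
    intro n hn
    have h1 := huscw (wA B).1 (𝒞.ae_norm_sub_le (hw B hB4)) n (by omega)
    simp only [hiterw B n (by omega)] at h1
    exact h1.trans (ENNReal.ofReal_le_ofReal (hle n (by omega)).2.1)
  have hlow : ∀ n : ℕ, n₁ + n₂ + n₃ + p.1 + 1 ≤ n →
      μ {x | ‖iter T B.1 n x‖ < Real.exp (logIntegral μ T B.1 n - n * ε)}
        ≤ ENNReal.ofReal (i n) := by
    intro n hn
    obtain ⟨h1, h2⟩ := hldt B hB5 n (by omega)
    exact (measure_norm_iter_lt_le hBC (by omega) h1 hε0.le h2).trans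
      (ENNReal.ofReal_le_ofReal (hle n (by omega)).2.2.1)
  refine ⟨hBC, fun n hn => ?_, fun a b hb hba hab hLa hLb => ?_⟩
  · -- both deviation estimates hold at some common point
    by_contra! hcon
    have hcover : (Set.univ : Set X) ⊆ {x | Real.exp (n * (ℓ + ε)) < ‖iter T B.1 n x‖}
        ∪ {x | ‖iter T B.1 n x‖ < Real.exp (logIntegral μ T B.1 n - n * ε)} := by
      intro x _
      by_cases hx : Real.exp (n * (ℓ + ε)) < ‖iter T B.1 n x‖
      · exact Or.inl hx
      · refine Or.inr ((not_lt.mp hx).trans_lt (Real.exp_lt_exp.mpr ?_))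
        linarith
    have h1 := (measure_mono hcover).trans
      ((measure_union_le _ _).trans (add_le_add (hup n hn) (hlow n hn)))
    have hin := hpos i hi n (by omega)
    rw [measure_univ, ← ENNReal.ofReal_add hin.le hin.le, ← ENNReal.ofReal_one,
      ENNReal.ofReal_le_ofReal_iff (by linarith)] at h1
    have h2 := (hn₃ n (by omega)).1
    linarith
  · have hb1 : 1 ≤ b := by omega
    have hib := hpos i hi b hb1
    have hmono : ∀ n : ℕ, b ≤ n → ENNReal.ofReal (i n) ≤ ENNReal.ofReal (i b) := fun n hn =>
      ENNReal.ofReal_le_ofReal (P.antitone_natCast hi hb1 hn)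
    obtain ⟨-, hz8, hi3b⟩ := hn₃ b (by omega)
    have hb0 : (1 : ℝ) ≤ b := by exact_mod_cast hb1
    have hab' : (a : ℝ) ≤ 2 * b := by exact_mod_cast hab
    have hexple : a * (ℓ + ε) + b * (ℓ + ε) + b * (2 * ℓ - κ)
        - (logIntegral μ T B.1 (a + b) - (a + b : ℕ) * ε)
        - (logIntegral μ T B.1 (2 * b) - (2 * b : ℕ) * ε) ≤ -(κ / 2 * b) := by
      push_cast
      have h1 : (a : ℝ) * ε ≤ 2 * b * ε := mul_le_mul_of_nonneg_right hab' hε0.le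
      have h2 : 300 * ε * b ≤ κ * b := mul_le_mul_of_nonneg_right hεκ (by linarith)
      have h3 : 0 ≤ ε * b := mul_nonneg hε0.le (by linarith)
      nlinarith
    have hzle : (m : ℝ) ^ 3 * Real.exp (a * (ℓ + ε) + b * (ℓ + ε) + b * (2 * ℓ - κ)
        - (logIntegral μ T B.1 (a + b) - (a + b : ℕ) * ε)
        - (logIntegral μ T B.1 (2 * b) - (2 * b : ℕ) * ε))
        ≤ m ^ 3 * Real.exp (-(κ / 2 * b)) := by
      gcongr
    have hcore := abs_logIntegral_three_blocks_le hm hT (hent B) hBC hb1 hba hab hib.le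
      (hup b hb) ((hup a (by omega)).trans (hmono a hba)) (hupw b hb)
      ((hlow (a + b) (by omega)).trans (hmono _ (by omega)))
      ((hlow (2 * b) (by omega)).trans (hmono _ (by omega))) (hzle.trans hz8)
    refine hcore.trans ?_
    set r := (i b) ^ (1 / 2 : ℝ) with hr
    have hr0 : 0 ≤ r := Real.rpow_nonneg hib.le _
    have hexpr : Real.exp (-(κ / 2 * b)) ≤ r := by
      have h1 : Real.exp (-(κ / 2 * b)) = Real.exp (-(κ * b)) ^ (1 / 2 : ℝ) := by
        rw [← Real.exp_mul]; congr 1; ring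
      rw [h1]
      exact Real.rpow_le_rpow (Real.exp_pos _).le
        (hi3b.trans (hle b hb1).2.2.2) (by norm_num)
    have h5 : (5 * i b) ^ (1 / 2 : ℝ) ≤ 3 * r := by
      rw [Real.mul_rpow (by norm_num) hib.le]
      refine mul_le_mul_of_nonneg_right ?_ hr0
      rw [← Real.sqrt_eq_rpow, Real.sqrt_le_left (by norm_num)]
      norm_num
    calc _ ≤ 8 * (m ^ 3 * r) + 10 * C * b * (3 * r) := by
          gcongr
          exact (Real.exp_le_exp.mpr hexple).trans hexpr
      _ ≤ 8 * (m ^ 3 * (b * r)) + 10 * C * b * (3 * r) := by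
          gcongr
          exact le_mul_of_one_le_left hr0 hb0
      _ = _ := by ring

end LocalEstimates

/-! ### Almost additive sequences -/

section AlmostAdditive

/-- The hypotheses on `F(n) = n L₁⁽ⁿ⁾(B)` used below: `L` is the limit and a lower bound of
`F(n)/n`, upper bounds `ℓ + 2ε` for `F(n)/n`, and almost additivity over blocks of lengths `b`, `b`,
`a` with error `D b r(b)`, valid as long as `F(n)/n` is not much below `ℓ` at the two shorter
combined scales. The errors `r` decay geometrically along `n, 2n, 4n, …`. -/
structure AlmostAdditive (F : ℕ → ℝ) (ℓ ε L D q : ℝ) (r : ℕ → ℝ) (n₀ : ℕ) : Prop where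
  eps_pos : 0 < ε
  D_nonneg : 0 ≤ D
  q_nonneg : 0 ≤ q
  q_lt_one : q < 1
  two_le : 2 ≤ n₀
  r_nonneg : ∀ n, n₀ ≤ n → 0 ≤ r n
  r_antitone : ∀ a b, n₀ ≤ b → b ≤ a → r a ≤ r b
  r_double : ∀ n, n₀ ≤ n → r (2 * n) ≤ q * r n
  r_small : D / (1 - q) * r n₀ ≤ ε
  tendsto : Tendsto (fun n : ℕ => F n / n) atTop (𝓝 L)
  lower : ∀ n, 1 ≤ n → L * n ≤ F n
  upper : ∀ n, n₀ ≤ n → F n ≤ n * (ℓ + 2 * ε)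
  three : ∀ a b : ℕ, n₀ ≤ b → b ≤ a → a ≤ 2 * b →
    (a + b) * (ℓ - 20 * ε) ≤ F (a + b) → 2 * b * (ℓ - 20 * ε) ≤ F (2 * b) →
      |F (a + 2 * b) + F b - F (a + b) - F (2 * b)| ≤ D * b * r b

namespace AlmostAdditive

variable {F : ℕ → ℝ} {ℓ ε L D q : ℝ} {r : ℕ → ℝ} {n₀ : ℕ}

theorem D_le (h : AlmostAdditive F ℓ ε L D q r n₀) : D ≤ D / (1 - q) := by
  have h1 := h.q_nonneg
  have h2 := h.q_lt_one
  rw [le_div_iff₀ (by linarith)]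
  nlinarith [h.D_nonneg]

theorem D_mul_r_le (h : AlmostAdditive F ℓ ε L D q r n₀) {n : ℕ} (hn : n₀ ≤ n) : D * r n ≤ ε := by
  refine le_trans ?_ h.r_small
  exact mul_le_mul h.D_le (h.r_antitone n n₀ le_rfl hn) (h.r_nonneg n hn)
    (h.D_nonneg.trans h.D_le)

/-- The combination `2 L⁽²ⁿ⁾ - L⁽ⁿ⁾` changes little when `n` is doubled: combine the blocks
`n, n, n` and `n, n, 2n`. -/
theorem abs_extrapolation_double_sub_le (h : AlmostAdditive F ℓ ε L D q r n₀) {n : ℕ}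
    (hn : n₀ ≤ n) (h2 : 2 * n * (ℓ - 8 * ε) ≤ F (2 * n)) :
    |(F (2 * (2 * n)) - F (2 * n)) / (2 * n) - (F (2 * n) - F n) / n| ≤ D * r n := by
  have hε := h.eps_pos
  have hn0 : (0 : ℝ) < n := by
    have := h.two_le
    exact_mod_cast (by omega : 0 < n)
  have hnε : 0 < n * ε := mul_pos hn0 hε
  have hD : D * r n * n ≤ ε * n := mul_le_mul_of_nonneg_right (h.D_mul_r_le hn) hn0.le
  have hup := h.upper n hn
  have hlow2 : 2 * n * (ℓ - 20 * ε) ≤ F (2 * n) := by linarith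
  have e1 := h.three n n hn le_rfl (by omega) (by rw [← two_mul, ← two_mul]; exact hlow2) hlow2
  rw [show n + 2 * n = 3 * n by ring, ← two_mul] at e1
  have hlow3 : 3 * n * (ℓ - 20 * ε) ≤ F (3 * n) := by
    have := (abs_le.mp e1).1
    linarith
  have e2 := h.three (2 * n) n hn (by omega) le_rfl
    (by rw [show 2 * n + n = 3 * n by ring]; push_cast; linarith) hlow2
  rw [show 2 * n + 2 * n = 2 * (2 * n) by ring, show 2 * n + n = 3 * n by ring] at e2
  have e3 : (F (2 * (2 * n)) - F (2 * n)) / (2 * n) - (F (2 * n) - F n) / n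
      = (F (2 * (2 * n)) - 3 * F (2 * n) + 2 * F n) / (2 * n) := by
    field_simp; ring
  rw [e3, abs_div, abs_of_pos (show (0 : ℝ) < 2 * n by positivity), div_le_iff₀ (by positivity)]
  rw [abs_le] at *
  constructor <;> linarith [e1.1, e1.2, e2.1, e2.2]

theorem r_two_pow_le (h : AlmostAdditive F ℓ ε L D q r n₀) {n : ℕ} (hn : n₀ ≤ n) (j : ℕ) :
    r (2 ^ j * n) ≤ q ^ j * r n := by
  induction j with
  | zero => simp
  | succ j ih =>
    rw [pow_succ', mul_assoc, pow_succ', mul_assoc]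
    exact (h.r_double _ (hn.trans (Nat.le_mul_of_pos_left n (by positivity)))).trans
      (mul_le_mul_of_nonneg_left ih h.q_nonneg)

theorem geom_le (h : AlmostAdditive F ℓ ε L D q r n₀) {n : ℕ} (hn : n₀ ≤ n) (j : ℕ) :
    D * r n * ∑ k ∈ Finset.range j, q ^ k ≤ D / (1 - q) * r n := by
  have h1 : 0 < 1 - q := by linarith [h.q_lt_one]
  have h2 : ∑ k ∈ Finset.range j, q ^ k ≤ 1 / (1 - q) := by
    rw [le_div_iff₀ h1, geom_sum_mul_neg]
    linarith [pow_nonneg h.q_nonneg j]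
  calc _ ≤ D * r n * (1 / (1 - q)) :=
        mul_le_mul_of_nonneg_left h2 (mul_nonneg h.D_nonneg (h.r_nonneg n hn))
    _ = _ := by ring

theorem tendsto_two_pow (h : AlmostAdditive F ℓ ε L D q r n₀) {n : ℕ} (hn : 1 ≤ n) :
    Tendsto (fun j : ℕ => F (2 ^ j * n) / (2 ^ j * n : ℕ)) atTop (𝓝 L) := by
  refine h.tendsto.comp (tendsto_atTop_mono (fun j => ?_) tendsto_id)
  exact (Nat.lt_two_pow_self (n := j)).le.trans (Nat.le_mul_of_pos_right _ hn)

/-- If `F(n)/n` is close to `ℓ` at the scales `n₀` and `2 n₀`, then its limit is close to `ℓ`. -/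
theorem le_limit (h : AlmostAdditive F ℓ ε L D q r n₀) (h1 : n₀ * (ℓ - ε) ≤ F n₀)
    (h2 : 2 * n₀ * (ℓ - ε) ≤ F (2 * n₀)) : ℓ - 8 * ε ≤ L := by
  have hε := h.eps_pos
  have hn₀ : (0 : ℝ) < n₀ := by
    have := h.two_le
    exact_mod_cast (by omega : 0 < n₀)
  have hV0 : ℓ - 4 * ε ≤ (F (2 * n₀) - F n₀) / n₀ := by
    rw [le_div_iff₀ hn₀]
    linarith [h.upper n₀ le_rfl]
  have key : ∀ j : ℕ, (2 ^ j * n₀ : ℕ) * (ℓ - 8 * ε) ≤ F (2 ^ j * n₀) ∧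
      2 * (2 ^ j * n₀ : ℕ) * (ℓ - 8 * ε) ≤ F (2 * (2 ^ j * n₀)) ∧
      ℓ - 4 * ε - D * r n₀ * ∑ k ∈ Finset.range j, q ^ k
        ≤ (F (2 * (2 ^ j * n₀)) - F (2 ^ j * n₀)) / (2 ^ j * n₀ : ℕ) := by
    intro j
    induction j with
    | zero =>
      simp only [pow_zero, one_mul, Finset.range_zero, Finset.sum_empty, mul_zero, sub_zero]
      have := mul_pos hn₀ hε
      exact ⟨by linarith, by linarith, hV0⟩
    | succ j ih =>
      obtain ⟨-, ih2, ih3⟩ := ih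
      have hle : n₀ ≤ 2 ^ j * n₀ := Nat.le_mul_of_pos_left n₀ (by positivity)
      have hpos : (0 : ℝ) < (2 ^ j * n₀ : ℕ) := by
        have h3 := h.two_le
        exact_mod_cast (by omega : 0 < 2 ^ j * n₀)
      have hstep := h.abs_extrapolation_double_sub_le hle ih2
      have hr := mul_le_mul_of_nonneg_left (h.r_two_pow_le le_rfl j) h.D_nonneg
      have e : 2 ^ (j + 1) * n₀ = 2 * (2 ^ j * n₀) := by ring
      rw [e]
      have hc : ((2 * (2 ^ j * n₀) : ℕ) : ℝ) = 2 * (2 ^ j * n₀ : ℕ) := by push_cast; ring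
      rw [hc]
      have hV : ℓ - 4 * ε - D * r n₀ * ∑ k ∈ Finset.range (j + 1), q ^ k
          ≤ (F (2 * (2 * (2 ^ j * n₀))) - F (2 * (2 ^ j * n₀))) / (2 * (2 ^ j * n₀ : ℕ)) := by
        rw [Finset.sum_range_succ]
        have := (abs_le.mp hstep).1
        linarith
      refine ⟨ih2, ?_, hV⟩
      have hg := (h.geom_le le_rfl (j + 1)).trans h.r_small
      have hV' : ℓ - 8 * ε
          ≤ (F (2 * (2 * (2 ^ j * n₀))) - F (2 * (2 ^ j * n₀))) / (2 * (2 ^ j * n₀ : ℕ)) := by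
        linarith
      rw [le_div_iff₀ (by positivity)] at hV'
      linarith
  refine ge_of_tendsto (h.tendsto_two_pow (one_le_two.trans h.two_le)) (Eventually.of_forall ?_)
  intro j
  have hpos : (0 : ℝ) < (2 ^ j * n₀ : ℕ) := by
    have h3 := h.two_le
    have h4 : n₀ ≤ 2 ^ j * n₀ := Nat.le_mul_of_pos_left n₀ (by positivity)
    exact_mod_cast (by omega : 0 < 2 ^ j * n₀)
  rw [le_div_iff₀ hpos, mul_comm]
  exact (key j).1

theorem lower_bound (h : AlmostAdditive F ℓ ε L D q r n₀) (hL : ℓ - 8 * ε ≤ L) {n : ℕ}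
    (hn : 1 ≤ n) : n * (ℓ - 8 * ε) ≤ F n :=
  (mul_comm _ _).trans_le ((mul_le_mul_of_nonneg_right hL n.cast_nonneg).trans (h.lower n hn))

/-- The combination `2 L⁽²ⁿ⁾ - L⁽ⁿ⁾` approximates the limit `L` much better than `L⁽ⁿ⁾` does. -/
theorem abs_extrapolation_sub_limit_le (h : AlmostAdditive F ℓ ε L D q r n₀)
    (hL : ℓ - 8 * ε ≤ L) {n : ℕ} (hn : n₀ ≤ n) :
    |(F (2 * n) - F n) / n - L| ≤ D / (1 - q) * r n := by
  have hn1 : 1 ≤ n := by have := h.two_le; omega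
  set V : ℕ → ℝ := fun j => (F (2 * (2 ^ j * n)) - F (2 ^ j * n)) / (2 ^ j * n : ℕ) with hV
  have hle : ∀ j, n ≤ 2 ^ j * n := fun j => Nat.le_mul_of_pos_left n (by positivity)
  have hsum : ∀ j, |V j - V 0| ≤ D * r n * ∑ k ∈ Finset.range j, q ^ k := by
    intro j
    induction j with
    | zero => simp
    | succ j ih =>
      have hlow := h.lower_bound hL (n := 2 * (2 ^ j * n)) (by have := hle j; omega)
      have hstep := h.abs_extrapolation_double_sub_le (hn.trans (hle j))
        (by push_cast at hlow ⊢; linarith)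
      have hr := mul_le_mul_of_nonneg_left (h.r_two_pow_le hn j) h.D_nonneg
      have e : V (j + 1) = (F (2 * (2 * (2 ^ j * n))) - F (2 * (2 ^ j * n)))
          / (2 * (2 ^ j * n : ℕ)) := by
        have e1 : 2 ^ (j + 1) * n = 2 * (2 ^ j * n) := by ring
        simp only [hV]
        rw [e1]
        congr 1
        push_cast; ring
      rw [← e] at hstep
      rw [Finset.sum_range_succ]
      have := abs_sub_le (V (j + 1)) (V j) (V 0)
      linarith
  have hlim : Tendsto V atTop (𝓝 L) := by
    have h1 := h.tendsto_two_pow hn1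
    have h2 := ((tendsto_add_atTop_iff_nat 1).mpr h1).const_mul 2
    have h3 := h2.sub h1
    rw [show 2 * L - L = L by ring] at h3
    refine h3.congr fun j => ?_
    have e1 : 2 ^ (j + 1) * n = 2 * (2 ^ j * n) := by ring
    have hpos : (0 : ℝ) < (2 ^ j * n : ℕ) := by
      have := hle j
      exact_mod_cast (by omega : 0 < 2 ^ j * n)
    simp only [hV]
    rw [e1]
    push_cast at hpos ⊢
    field_simp
  have hV0 : V 0 = (F (2 * n) - F n) / n := by simp [hV]
  rw [← hV0, abs_sub_comm]
  refine le_of_tendsto ((hlim.sub_const (V 0)).abs) (Eventually.of_forall fun j => ?_)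
  exact (hsum j).trans (h.geom_le hn j)

/-- An upper bound for `L⁽ᴺ⁾ - L` in terms of any smaller scale `n`. -/
theorem sub_limit_le (h : AlmostAdditive F ℓ ε L D q r n₀) (hL : ℓ - 8 * ε ≤ L) {n : ℕ}
    (hn : n₀ ≤ n) (N : ℕ) (hN : n ≤ N) :
    F N - L * N ≤ 30 * ε * n + (D + D / (1 - q)) * N * r n := by
  have hε := h.eps_pos
  have hD := h.D_nonneg
  have hD' := hD.trans h.D_le
  have hrn := h.r_nonneg n hn
  have h2 := h.two_le
  induction N using Nat.strong_induction_on with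
  | _ N ih =>
    rcases lt_or_ge N (3 * n) with hlt | hge
    · have h1 := h.upper N (hn.trans hN)
      have h3 : (N : ℝ) ≤ 3 * n := by exact_mod_cast hlt.le
      have h4 : ε * N ≤ ε * (3 * n) := mul_le_mul_of_nonneg_left h3 hε.le
      have h5 : (ℓ - 8 * ε) * N ≤ L * N := mul_le_mul_of_nonneg_right hL N.cast_nonneg
      have h6 : 0 ≤ (D + D / (1 - q)) * N * r n := by positivity
      linarith
    · -- split `N` into blocks of lengths `b`, `b` and `N - 2 b`, with `b` about a third of `N`
      obtain ⟨b, hb⟩ : ∃ b, b = N / 3 := ⟨_, rfl⟩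
      obtain ⟨a, ha⟩ : ∃ a, a = N - 2 * b := ⟨_, rfl⟩
      have hbn : n ≤ b := by omega
      have hab : N = a + 2 * b := by omega
      have hthree := h.three a b (hn.trans hbn) (by omega) (by omega)
        (by
          have e1 := h.lower_bound hL (n := a + b) (by omega)
          have e2 : 0 ≤ ε * ((a + b : ℕ) : ℝ) := by positivity
          push_cast at e1 e2
          linarith)
        (by
          have e1 := h.lower_bound hL (n := 2 * b) (by omega)
          have e2 : 0 ≤ ε * ((2 * b : ℕ) : ℝ) := by positivity
          push_cast at e1 e2
          linarith)
      have hV := h.abs_extrapolation_sub_limit_le hL (hn.trans hbn)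
      have hih := ih (a + b) (by omega) (by omega)
      have hb0 : (0 : ℝ) < b := by exact_mod_cast (by omega : 0 < b)
      have hrb : r b ≤ r n := h.r_antitone b n hn hbn
      have hV' : F (2 * b) - F b ≤ (L + D / (1 - q) * r b) * b := by
        rw [← div_le_iff₀ hb0]
        linarith [(abs_le.mp hV).2]
      have h3 := (abs_le.mp hthree).2
      have h4 : (D + D / (1 - q)) * b * r b ≤ (D + D / (1 - q)) * b * r n :=
        mul_le_mul_of_nonneg_left hrb (by positivity)
      rw [hab]
      push_cast at hih ⊢
      linarith

end AlmostAdditive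

end AlmostAdditive

/-! ### Deviation measure functions -/

namespace IsDevMeasure

variable {i : ℝ → ℝ}

theorem psi_eq (h : IsDevMeasure i) {t : ℝ} (ht : 0 < t) : psi i t = t / (i t) ^ (1 / 2 : ℝ) := by
  rw [psi, Real.rpow_neg (h.pos t ht).le]
  exact (div_eq_mul_inv _ _).symm

theorem rpow_pos (h : IsDevMeasure i) {t : ℝ} (ht : 0 < t) : 0 < (i t) ^ (1 / 2 : ℝ) :=
  Real.rpow_pos_of_pos (h.pos t ht) _

theorem rpow_le (h : IsDevMeasure i) {s t : ℝ} (hs : 0 < s) (hst : s ≤ t) :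
    (i t) ^ (1 / 2 : ℝ) ≤ (i s) ^ (1 / 2 : ℝ) :=
  Real.rpow_le_rpow (h.pos t (hs.trans_le hst)).le
    (h.strictAntiOn.antitoneOn hs (hs.trans_le hst) hst) (by norm_num)

theorem psi_strictMonoOn (h : IsDevMeasure i) : StrictMonoOn (psi i) (Set.Ioi 0) := by
  intro s hs t ht hst
  have hs : 0 < s := hs
  have ht : 0 < t := ht
  rw [h.psi_eq hs, h.psi_eq ht]
  exact div_lt_div₀ hst (h.rpow_le hs hst.le) ht.le (h.rpow_pos ht)

theorem continuousOn_psi (h : IsDevMeasure i) : ContinuousOn (psi i) (Set.Ioi 0) :=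
  continuousOn_id.mul (h.continuousOn.rpow_const fun t ht => Or.inl (h.pos t ht).ne')

theorem tendsto_psi (h : IsDevMeasure i) : Tendsto (psi i) atTop atTop := by
  have h1 : Tendsto (fun t : ℝ => t / (i 1) ^ (1 / 2 : ℝ)) atTop atTop :=
    tendsto_id.atTop_div_const (h.rpow_pos one_pos)
  refine tendsto_atTop_mono' _ ?_ h1
  filter_upwards [eventually_ge_atTop 1] with t ht
  have ht0 : 0 < t := one_pos.trans_le ht
  rw [h.psi_eq ht0]
  exact div_le_div_of_nonneg_left ht0.le (h.rpow_pos ht0) (h.rpow_le one_pos ht)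

theorem exists_psi_eq (h : IsDevMeasure i) {t : ℝ} (ht : 0 < t) :
    ∃ s ∈ Set.Ioi (0 : ℝ), psi i s = t := by
  have hc := h.rpow_pos one_pos
  set s₁ := min 1 (t * (i 1) ^ (1 / 2 : ℝ)) with hs₁
  have hs₁0 : 0 < s₁ := lt_min one_pos (by positivity)
  have h1 : psi i s₁ ≤ t := by
    rw [h.psi_eq hs₁0, div_le_iff₀ (h.rpow_pos hs₁0)]
    exact (min_le_right _ _).trans
      (mul_le_mul_of_nonneg_left (h.rpow_le hs₁0 (min_le_left _ _)) ht.le)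
  obtain ⟨s₂, hs₂, hle⟩ := ((h.tendsto_psi.eventually_ge_atTop t).and
    (eventually_ge_atTop s₁)).exists
  have hsub : Set.Icc s₁ s₂ ⊆ Set.Ioi 0 := fun s hs => hs₁0.trans_le hs.1
  obtain ⟨s, hs, hst⟩ := intermediate_value_Icc hle (h.continuousOn_psi.mono hsub) ⟨h1, hs₂⟩
  exact ⟨s, hsub hs, hst⟩

theorem phi_pos (h : IsDevMeasure i) {t : ℝ} (ht : 0 < t) : 0 < phi i t :=
  Function.invFunOn_mem (h.exists_psi_eq ht)

theorem psi_phi (h : IsDevMeasure i) {t : ℝ} (ht : 0 < t) : psi i (phi i t) = t :=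
  Function.invFunOn_eq (h.exists_psi_eq ht)

theorem phi_psi (h : IsDevMeasure i) {s : ℝ} (hs : 0 < s) : phi i (psi i s) = s := by
  have hp : 0 < psi i s := by rw [h.psi_eq hs]; exact div_pos hs (h.rpow_pos hs)
  exact h.psi_strictMonoOn.injOn (h.phi_pos hp) hs (h.psi_phi hp)

theorem phi_eq (h : IsDevMeasure i) {t : ℝ} (ht : 0 < t) :
    phi i t = t * (i (phi i t)) ^ (1 / 2 : ℝ) := by
  have h1 := h.psi_phi ht
  rw [h.psi_eq (h.phi_pos ht), div_eq_iff (h.rpow_pos (h.phi_pos ht)).ne'] at h1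
  exact h1

theorem tendsto_phi (h : IsDevMeasure i) : Tendsto (phi i) atTop atTop := by
  refine tendsto_atTop.mpr fun b => ?_
  have hb : 0 < max b 1 := lt_max_of_lt_right one_pos
  filter_upwards [eventually_ge_atTop (psi i (max b 1)), eventually_gt_atTop 0] with t ht ht0
  refine (le_max_left b 1).trans ?_
  rw [← h.psi_phi ht0] at ht
  exact (h.psi_strictMonoOn.le_iff_le hb (h.phi_pos ht0)).mp ht

/-- The condition on `φ` says that `ι` decays by a definite factor when its argument is doubled. -/
theorem exists_rpow_double_le (h : IsDevMeasure i) :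
    ∃ q : ℝ, 0 ≤ q ∧ q < 1 ∧ ∃ s₀ : ℝ, ∀ s, s₀ ≤ s →
      (i (2 * s)) ^ (1 / 2 : ℝ) ≤ q * (i s) ^ (1 / 2 : ℝ) := by
  obtain ⟨c, hc1, hc2⟩ := EReal.lt_iff_exists_real_btwn.mp h.limsup_phi
  have hc2' : c < 2 := EReal.coe_lt_coe_iff.mp hc2
  have hev := eventually_lt_of_limsup_lt hc1
  set q := max (c / 2) 0 with hq
  have hq1 : q < 1 := max_lt (by linarith) one_pos
  have hev2 : ∀ᶠ s in atTop, phi i (2 * psi i s) / phi i (psi i s) < c :=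
    h.tendsto_psi.eventually (hev.mono fun t ht => EReal.coe_lt_coe_iff.mp ht)
  obtain ⟨s₀, hs₀⟩ := eventually_atTop.mp (hev2.and (eventually_gt_atTop 0))
  refine ⟨q, le_max_right _ _, hq1, s₀, fun s hs => ?_⟩
  obtain ⟨hlt, hs0⟩ := hs₀ s hs
  rw [h.phi_psi hs0, div_lt_iff₀ hs0] at hlt
  have hp : 0 < psi i s := by rw [h.psi_eq hs0]; exact div_pos hs0 (h.rpow_pos hs0)
  have hu := h.phi_pos (show 0 < 2 * psi i s by positivity)
  have h1 : (i (2 * s)) ^ (1 / 2 : ℝ) ≤ (i (phi i (2 * psi i s))) ^ (1 / 2 : ℝ) :=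
    h.rpow_le hu (by nlinarith)
  refine h1.trans ?_
  have h2 := h.phi_eq (show 0 < 2 * psi i s by positivity)
  have h3 : s = psi i s * (i s) ^ (1 / 2 : ℝ) := by
    rw [h.psi_eq hs0, div_mul_cancel₀ _ (h.rpow_pos hs0).ne']
  have h4 : 2 * psi i s * (i (phi i (2 * psi i s))) ^ (1 / 2 : ℝ)
      ≤ 2 * psi i s * (q * (i s) ^ (1 / 2 : ℝ)) := by
    rw [← h2]
    calc phi i (2 * psi i s) ≤ c * s := hlt.le
      _ ≤ 2 * q * s := by
          have := le_max_left (c / 2) 0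
          nlinarith
      _ = 2 * psi i s * (q * (i s) ^ (1 / 2 : ℝ)) := by
          conv_lhs => rw [h3]
          ring
  exact le_of_mul_le_mul_left h4 (by positivity)

end IsDevMeasure

/-! ### Uniform speed of convergence -/

namespace AlmostAdditive

variable {F : ℕ → ℝ} {ℓ ε L D q : ℝ} {r : ℕ → ℝ} {n₀ : ℕ} {j : ℝ → ℝ}

/-- Apply `sub_limit_le` to the scale `⌈φ(N)⌉`, at which the two error terms balance. -/
theorem div_sub_limit_lt (h : AlmostAdditive F ℓ ε L D q r n₀) (hL : ℓ - 8 * ε ≤ L)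
    (hε : ε ≤ 1 / 1000) (hj : IsDevMeasure j)
    (hr : ∀ n : ℕ, n₀ ≤ n → 16 * ((D + D / (1 - q)) * r n) ≤ (j n) ^ (1 / 2 : ℝ))
    {N : ℕ} (hN : 0 < N) (h1 : (n₀ : ℝ) ≤ phi j N) (h2 : phi j N ≤ N) :
    F N / N - L < 1 / 2 * (phi j N / N) ∧
      1 / 2 * (phi j N / N) ≤ (j (prevScale j N)) ^ (1 / 2 : ℝ) := by
  have hN0 : (0 : ℝ) < N := by exact_mod_cast hN
  have hn₀ : (2 : ℝ) ≤ n₀ := by exact_mod_cast h.two_le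
  have hphi := hj.phi_eq hN0
  rw [prevScale]
  set p := phi j N with hp
  have hp0 : 0 < p := by linarith
  have hρ := hj.rpow_pos hp0
  constructor
  · have hle : n₀ ≤ ⌈p⌉₊ := by exact_mod_cast h1.trans (Nat.le_ceil p)
    have hsub := h.sub_limit_le hL hle N (Nat.ceil_le.mpr h2)
    have hceil := Nat.ceil_lt_add_one hp0.le
    have e1 := mul_le_mul_of_nonneg_left
      ((hr _ hle).trans (hj.rpow_le hp0 (Nat.le_ceil p))) hN0.le
    rw [← hphi] at e1
    have e2 : ε * ⌈p⌉₊ ≤ 1 / 1000 * (2 * p) :=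
      mul_le_mul hε (by linarith) (Nat.cast_nonneg _) (by norm_num)
    rw [← mul_div_assoc, sub_lt_iff_lt_add, div_lt_iff₀ hN0, add_mul, div_mul_cancel₀ _ hN0.ne']
    linarith
  · have hfl : (1 : ℝ) ≤ ⌊p⌋₊ := by exact_mod_cast (Nat.one_le_floor_iff p).mpr (by linarith)
    have e1 := hj.rpow_le (by linarith) (Nat.floor_le hp0.le)
    have e2 : p / N = (j p) ^ (1 / 2 : ℝ) := by
      rw [div_eq_iff hN0.ne', mul_comm]; exact hphi
    rw [e2]
    linarith

/-- The exponent at the scale `n₊₊ ≥ n` nearly equals the limit, which in turn is approximated by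
`2 L⁽²ⁿ⁾ - L⁽ⁿ⁾`. -/
theorem abs_nextScale_lt (h : AlmostAdditive F ℓ ε L D q r n₀) (hL : ℓ - 8 * ε ≤ L)
    (hε : ε ≤ 1 / 1000) (hj : IsDevMeasure j)
    (hr : ∀ n : ℕ, n₀ ≤ n → 16 * ((D + D / (1 - q)) * r n) ≤ (j n) ^ (1 / 2 : ℝ))
    {n : ℕ} (hn : n₀ ≤ n) (h1 : (j n) ^ (1 / 2 : ℝ) ≤ 1) :
    n ≤ nextScale j n ∧
      |F (nextScale j n) / nextScale j n + F n / n - 2 * (F (2 * n) / (2 * n : ℕ))|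
        < 1 / 2 * (n / nextScale j n) ∧
      1 / 2 * ((n : ℝ) / nextScale j n) ≤ (j n) ^ (1 / 2 : ℝ) := by
  have h2 := h.two_le
  have hn0 : (0 : ℝ) < n := by exact_mod_cast (by omega : 0 < n)
  have hρ := hj.rpow_pos hn0
  have hrn := hr n hn
  have hlim := h.abs_extrapolation_sub_limit_le hL hn
  have hDr : 0 ≤ D * r n := mul_nonneg h.D_nonneg (h.r_nonneg n hn)
  set ρ := (j n) ^ (1 / 2 : ℝ) with hρdef
  have hpsi : psi j n = n / ρ := hj.psi_eq hn0
  have hnle : n ≤ nextScale j n := by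
    rw [nextScale, hpsi]
    exact Nat.le_floor ((le_div_iff₀ hρ).mpr (mul_le_of_le_one_right hn0.le h1))
  have hub : (nextScale j n : ℝ) ≤ n / ρ := by
    rw [nextScale, hpsi]; exact Nat.floor_le (by positivity)
  have hlb : (n : ℝ) / ρ < nextScale j n + 1 := by
    rw [nextScale, hpsi]; exact Nat.lt_floor_add_one _
  set k := nextScale j n with hk
  have hk1 : (1 : ℝ) ≤ k := by exact_mod_cast (by omega : 1 ≤ k)
  have hk0 : (0 : ℝ) < k := by linarith
  have hρx : ρ ≤ n / k := by
    rw [le_div_iff₀ hk0, mul_comm]; exact (le_div_iff₀ hρ).mp hub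
  have hxρ : (n : ℝ) / k ≤ 2 * ρ := by
    rw [div_le_iff₀ hk0]
    rw [div_lt_iff₀ hρ] at hlb
    nlinarith
  refine ⟨hnle, ?_, by linarith⟩
  have hsub := h.sub_limit_le hL hn k hnle
  have hlow := h.lower k (by omega)
  have e1 : F k / k - L ≤ 30 * ε * (n / k) + (D + D / (1 - q)) * r n := by
    rw [sub_le_iff_le_add, div_le_iff₀ hk0]
    have : (30 * ε * (n / k) + (D + D / (1 - q)) * r n + L) * k
        = 30 * ε * n + (D + D / (1 - q)) * k * r n + L * k := by
      field_simp
    linarith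
  have e2 : 0 ≤ F k / k - L := by
    rw [sub_nonneg, le_div_iff₀ hk0]; exact hlow
  have e3 : ε * (n / k) ≤ 1 / 1000 * (n / k) := mul_le_mul_of_nonneg_right hε (by positivity)
  have e4 : F k / k + F n / n - 2 * (F (2 * n) / (2 * n : ℕ))
      = (F k / k - L) - ((F (2 * n) - F n) / n - L) := by
    push_cast
    field_simp
    ring
  rw [e4]
  have hx0 : 0 < (n : ℝ) / k := by positivity
  rw [abs_le] at hlim
  rw [abs_lt]
  constructor <;> linarith [hlim.1, hlim.2]

end AlmostAdditive

theorem proposition6p1 {X : Type*} [MeasurableSpace X] (μ : Measure X) [IsProbabilityMeasure μ]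
    (T : X → X) (hT : Ergodic T μ)
    (𝒞 : CocycleSpace μ) (Ξ : Set (X → ℝ)) (P : LDTParameters)
    (hslow : ∀ c : ℝ, 0 < c → ∃ i ∈ P.measures, ∀ᶠ t : ℝ in atTop, Real.exp (-(c * t)) ≤ i t)
    (hΞ : ∀ ξ ∈ Ξ, Measurable ξ ∧ Integrable ξ μ)
    (hcompat : ∀ m : ℕ, ∀ A ∈ 𝒞.carrier m, Compatible μ T Ξ A)
    (hbase : ∀ ξ ∈ Ξ, BaseLDT μ T P ξ)
    (hbdd : ∀ m : ℕ, ∀ A : 𝒞.carrier m, ⊥ < lyap μ T A.1 1 → UniformlyL2Bounded T 𝒞 A)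
    (hfiber : ∀ m : ℕ, 2 ≤ m → ∀ A : 𝒞.carrier m,
      lyap μ T A.1 2 < lyap μ T A.1 1 → UniformFiberLDT T 𝒞 P A)
    (m : ℕ) (hm : 2 ≤ m) (A : 𝒞.carrier m) (hA : lyap μ T A.1 2 < lyap μ T A.1 1) :
    ∃ δ : ℝ, 0 < δ ∧ ∃ C : ℝ, 0 < C ∧ ∃ n₀ : ℕ, ∃ i ∈ P.measures,
      ∀ n : ℕ, n₀ ≤ n → ∀ B : 𝒞.carrier m, dist B A < δ →
        ⊥ < lyap μ T B.1 1 ∧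
        (finiteLE μ T B.1 n - lyap μ T B.1 1 < ((C * (phi i n / n) : ℝ) : EReal) ∧
          C * (phi i n / n) ≤ (i (prevScale i n)) ^ (1 / 2 : ℝ)) ∧
        ((finiteLE μ T B.1 (nextScale i n) + finiteLE μ T B.1 n
              - 2 * finiteLE μ T B.1 (2 * n)).abs
            < ENNReal.ofReal (C * (n / nextScale i n)) ∧
          C * ((n : ℝ) / nextScale i n) ≤ (i n) ^ (1 / 2 : ℝ)) := by
  have hTm := hT.toMeasurePreserving
  obtain ⟨ℓ, ε, δ, C, D, hε, hε1, hδ, hD, hℓ, i, hi, n₁, -, hloc⟩ :=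
    exists_local_estimates hTm 𝒞 Ξ P hslow hcompat hbase hm A (hbdd m A (bot_le.trans_lt hA))
      (hfiber m hm A hA) hA
  have hdi := P.isDevMeasure i hi
  obtain ⟨q, hq0, hq1, s₀, hs₀⟩ := hdi.exists_rpow_double_le
  have hr0 : Tendsto (fun n : ℕ => (i n) ^ (1 / 2 : ℝ)) atTop (𝓝 0) := by
    have h1 := (hdi.tendsto_zero.comp tendsto_natCast_atTop_atTop).rpow_const
      (p := 1 / 2) (Or.inr (by norm_num))
    rwa [Real.zero_rpow (by norm_num)] at h1
  have hsmall : ∀ᶠ n : ℕ in atTop, D / (1 - q) * (i n) ^ (1 / 2 : ℝ) < ε := by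
    have h1 := hr0.const_mul (D / (1 - q))
    rw [mul_zero] at h1
    exact h1.eventually_lt_const hε
  obtain ⟨n₀, hn₀s, hn₀1, hn₀2, hn₀r⟩ := ((tendsto_natCast_atTop_atTop.eventually_ge_atTop s₀).and
    ((eventually_ge_atTop n₁).and ((eventually_ge_atTop 2).and hsmall))).exists
  have hn₀0 : (0 : ℝ) < n₀ := by exact_mod_cast (by omega : 0 < n₀)
  -- the exponents at the scales `n₀` and `2 n₀` are lower semicontinuous in the cocycle
  obtain ⟨M, hM⟩ := 𝒞.exists_ae_norm_le A
  have hη : 0 < ε * n₀ := by positivity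
  have hAC := (hloc A (by simpa using hδ)).1
  obtain ⟨δ₁, hδ₁, hlsc₁⟩ := exists_logIntegral_sub_le hTm (𝒞.measurable m A.1 A.2) hM hAC
    (show 1 ≤ n₀ by omega) hη
  obtain ⟨δ₂, hδ₂, hlsc₂⟩ := exists_logIntegral_sub_le hTm (𝒞.measurable m A.1 A.2) hM hAC
    (show 1 ≤ 2 * n₀ by omega) hη
  -- a large multiple of `ι` absorbs all constants into `C = 1 / 2`
  obtain ⟨K, hK⟩ : ∃ K, K = D + D / (1 - q) := ⟨_, rfl⟩
  have hK0 : 0 ≤ K := by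
    have : 0 < 1 - q := by linarith
    rw [hK]; positivity
  have hR : 0 < 16 * K + 1 := by positivity
  set j : ℝ → ℝ := fun t => (16 * K + 1) ^ 2 * i t with hj
  have hjP : j ∈ P.measures := P.smul_mem _ (by positivity) i hi
  have hdj := P.isDevMeasure j hjP
  have hjr : ∀ n : ℕ, 1 ≤ n → (j n) ^ (1 / 2 : ℝ) = (16 * K + 1) * (i n) ^ (1 / 2 : ℝ) := by
    intro n hn
    have hn0 : (0 : ℝ) < n := by exact_mod_cast hn
    simp only [hj]
    rw [Real.mul_rpow (by positivity) (hdi.pos n hn0).le, ← Real.sqrt_eq_rpow,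
      Real.sqrt_sq hR.le]
  have hjK : ∀ n : ℕ, n₀ ≤ n →
      16 * ((D + D / (1 - q)) * (i n) ^ (1 / 2 : ℝ)) ≤ (j n) ^ (1 / 2 : ℝ) := by
    intro n hn
    have hn0 : (0 : ℝ) < n := by exact_mod_cast (by omega : 0 < n)
    rw [hjr n (by omega), ← hK]
    linarith [(hdi.rpow_pos hn0).le]
  have hj0 : Tendsto (fun t : ℝ => (j t) ^ (1 / 2 : ℝ)) atTop (𝓝 0) := by
    have h1 := hdj.tendsto_zero.rpow_const (p := 1 / 2) (Or.inr (by norm_num))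
    rwa [Real.zero_rpow (by norm_num)] at h1
  have hjle := hj0.eventually_le_const one_pos
  have hphi : Tendsto (fun n : ℕ => phi j n) atTop atTop :=
    hdj.tendsto_phi.comp tendsto_natCast_atTop_atTop
  obtain ⟨N, hN⟩ := eventually_atTop.mp ((eventually_ge_atTop n₀).and
    ((tendsto_natCast_atTop_atTop.eventually hjle).and
      ((hphi.eventually_ge_atTop (n₀ : ℝ)).and (hphi.eventually hjle))))
  refine ⟨min δ (min δ₁ δ₂), by positivity, 1 / 2, by norm_num, N, j, hjP, fun n hn B hB => ?_⟩
  obtain ⟨hnn₀, hjn, hphin, hjphi⟩ := hN n hn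
  obtain ⟨hB0, hB1, hB2⟩ : dist B A < δ ∧ dist B A < δ₁ ∧ dist B A < δ₂ := by
    simpa only [lt_min_iff] using hB
  obtain ⟨hBC, hup, hthree⟩ := hloc B hB0
  obtain ⟨L, hL, hlim, hlow⟩ := exists_lyap_one_eq hm hTm hBC
  have hAA : AlmostAdditive (logIntegral μ T B.1) ℓ ε L D q
      (fun n : ℕ => (i n) ^ (1 / 2 : ℝ)) n₀ :=
    { eps_pos := hε
      D_nonneg := hD
      q_nonneg := hq0
      q_lt_one := hq1
      two_le := hn₀2
      r_nonneg := fun n hn => (hdi.rpow_pos (by exact_mod_cast (by omega : 0 < n))).le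
      r_antitone := fun a b hb hba => hdi.rpow_le
        (by exact_mod_cast (by omega : 0 < b)) (by exact_mod_cast hba)
      r_double := fun n hn => by
        push_cast
        exact hs₀ n (hn₀s.trans (by exact_mod_cast hn))
      r_small := hn₀r.le
      tendsto := hlim
      lower := hlow
      upper := fun n hn => hup n (hn₀1.trans hn)
      three := fun a b hb => hthree a b (hn₀1.trans hb) }
  have hℓL : ℓ - 8 * ε ≤ L := by
    refine hAA.le_limit ?_ ?_
    · have h1 := hlsc₁ B.1 hBC (𝒞.ae_norm_sub_le hB1)
      have h2 := hℓ n₀ (by omega)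
      linarith
    · have h1 := hlsc₂ B.1 hBC (𝒞.ae_norm_sub_le hB2)
      have h2 := hℓ (2 * n₀) (by omega)
      push_cast at h2
      linarith
  have hn0 : 0 < n := by omega
  have hn0' : (0 : ℝ) < n := by exact_mod_cast hn0
  have hphile : phi j n ≤ n := by
    rw [hdj.phi_eq hn0']
    exact mul_le_of_le_one_right hn0'.le hjphi
  obtain ⟨h1, h2⟩ := hAA.div_sub_limit_lt hℓL hε1 hdj hjK hn0 hphin hphile
  obtain ⟨h3, h4, h5⟩ := hAA.abs_nextScale_lt hℓL hε1 hdj hjK hnn₀ hjn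
  rw [hL, hBC.finiteLE_eq (show 1 ≤ n by omega), hBC.finiteLE_eq (show 1 ≤ 2 * n by omega),
    hBC.finiteLE_eq (show 1 ≤ nextScale j n by omega)]
  refine ⟨EReal.bot_lt_coe L, ⟨?_, h2⟩, ?_, h5⟩
  · rw [← EReal.coe_sub, EReal.coe_lt_coe_iff]
    exact h1
  · rw [show (2 : EReal) = ((2 : ℝ) : EReal) from rfl, ← EReal.coe_add, ← EReal.coe_mul,
      ← EReal.coe_sub, EReal.abs_def, ENNReal.ofReal_lt_ofReal_iff_of_nonneg (abs_nonneg _)]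
    exact h4
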